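/- \textbf{Notation.} For $x=(x_1,x_2,x_3,x_4)\in\mathbb{C}^4$ let $y_1(x),\dots,y_4(x)$ be the following basic invariants of the Coxeter group $H_4$, of degrees $30,20,12,2$: \begin{align*} y_1=& \, \frac{32}{3}x_1^{24}h_2^3-40x_1^{22}\left(2h_2^4+3h_2h_6\right)+x_1^{20}\left(360h_{10}+\frac{1344}{5}h_2^5+672h_2^2h_6\right) \\ &+x_1^{18}\left(1080h_6^2-1608h_2^3h_6-\frac{1328}{3}h_2^6-2880h_{10}h_2\right) \\ &+x_1^{16}\left(10024h_{10}h_2^2+272h_2^7+1248h_2^4h_6-5628h_2h_6^2\right) \\ &+x_1^{14}\left(18588h_2^2h_6^2+272h_2^8-7620h_{10}h_6-16856h_{10}h_2^3\right) \\ &+x_1^{12}\left(14216h_{10}h_2^4+23508h_{10}h_6h_2-\frac{1328}{3}h_2^9-1248h_6h_2^6-27396h_6^2h_2^3 \right. \\ &\biggl. -5796h_6^3\biggr)+x_1^{10}\left(3240h_{10}^2-7160h_{10}h_2^5-25332h_{10}h_6h_2^2+\frac{1344}{5}h_2^{10} \right. \\ &\biggl. +1608h_2^7h_6+19968h_2^4h_6^2+7350h_2h_6^3\biggr)+x_1^8\left(2144h_{10}h_2^6-3232h_{10}^2h_2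 \right. \\ &\left. +10908h_{10}h_2^3h_6-906h_{10}h_6^2-80h_2^{11}-672h_2^8h_6-6924h_2^5h_6^2-1956h_2^2h_6^3\right) \\ &+x_1^6\left(1168h_{10}^2h_2^2-344h_{10}h_2^7-2172h_{10}h_2^4h_6-1908h_{10}h_2h_6^2+\frac{32}{3}h_2^{12} \right. \\ &\biggl. +120h_2^9h_6+1332h_2^6h_6^2+288h_2^3h_6^3+2394h_6^4\biggr)+x_1^4\left(348h_{10}^2h_6-152h_{10}^2h_2^3 \right. \\ &\left. +16h_{10}h_2^8+60h_{10}h_6h_2^5+408h_{10}h_6^2h_2^2-84h_2^7h_6^2+84h_2^4h_6^3-909h_2h_6^4\right) \\ &+x_1^2\left(8h_{10}^2h_2^4-42h_{10}h_6^2h_2^3-87h_{10}h_6^3-6h_2^5h_6^3+135h_2^2h_6^4\right) \\ &+\frac{4}{3}h_{10}^3-3h_{10}h_2h_6^3+\frac{9}{5}h_6^5, \\ y_2=& \, 4x_1^{16}h_2^2-10x_1^{14}\left(2h_2^3+3h_6\right)+x_1^{12}\left(44h_2^4+138h_2h_6\right) \\ &+x_1^{10}\left(180h_{10}-44h_2^5-402h_2^2h_6\right)+x_1^8\left(44h_2^6-464h_{10}h_2+402h_2^3h_6+294h_6^2\right)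 \\ &+x_1^6\left(296h_{10}h_2^2-20h_2^7-138h_2^4h_6-306h_2h_6^2\right)+x_1^4\left(4h_2^8-76h_{10}h_2^3-114h_{10}h_6 \right. \\ &\left. +30h_2^5h_6+168h_2^2h_6^2\right)+x_1^2\left(4h_{10}h_2^4-21h_2^3h_6^2+\frac{57}{2}h_6^3\right)+h_{10}^2-\frac{3}{2}h_2h_6^3, \\ y_3=& \, -2x_1^{10}h_2+6x_1^8h_2^2+x_1^6\left(33h_6-14h_2^3\right)-x_1^4\left(33h_2h_6-6h_2^4\right) \\ &+x_1^2\left(11h_{10}-2h_2^5\right)-h_{10}h_2+\frac{3}{2}h_6^2, \\ y_4=& \, x_1^2+h_2, \end{align*} where \begin{align*} h_2=& \, \epsilon_1, \\ h_6=& \, \sqrt{5}\delta+\epsilon_1\epsilon_2-11\epsilon_3, \\ h_{10}=& \, 95\epsilon_2\epsilon_3-32\epsilon_1^2\epsilon_3-5\epsilon_1\epsilon_2^2+2\epsilon_1^3\epsilon_2+3\sqrt{5}\delta\epsilon_2, \end{align*} and \begin{align*} \epsilon_1=& \, x_2^2+x_3^2+x_4^2, \\ \epsilon_2=& \, x_2^2x_3^2+x_2^2x_4^2+x_3^2x_4^2,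 \\ \epsilon_3=& \, x_2^2x_3^2x_4^2, \\ \delta=& \, (x_2^2-x_3^2)(x_2^2-x_4^2)(x_3^2-x_4^2). \end{align*} The Saito form of $H_4$ is the symmetric matrix $S^{ij}(y)$ of polynomials in $y_1,\dots,y_4$ with entries \begin{align*} S^{11}(y)=& \, \frac{928}{3}y_2y_3^3y_4+240y_1y_3^2y_4^2+96y_2^2y_3y_4^3+160y_1y_2y_4^4, \\ S^{12}(y)=& \, -32y_3^4-112y_2y_3^2y_4^2-120y_1y_3y_4^3+48y_2^2y_4^4, \\ S^{22}(y)=& \, \frac{152}{3}y_3^3y_4-56y_2y_3y_4^3+20y_1y_4^4, \\ S^{13}(y)=& \, -80y_2^2-\frac{16}{3}y_3^3y_4^2-16y_2y_3y_4^4-40y_1y_4^5, \\ S^{23}(y)=& \, -30y_1+8y_3^2y_4^3-24y_2y_4^5, \hspace{6mm} S^{33}(y)=44y_2y_4-8y_3y_4^5, \\ S^{14}(y)=& \, 60y_1, \hspace{8mm} S^{24}(y)=40y_2, \hspace{8mm} S^{34}(y)=24y_3, \hspace{8mm} S^{44}(y)=4y_4. \end{align*} Let the algebraic Frobenius manifold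 $H_4(3)$ be given by the prepotential \begin{align*} F(t)=& \, \frac{2016569088}{43793750}t_4^{13}+\frac{7929073152}{43793750}t_4^{10}t_3+\frac{11291664384}{43793750}t_4^7t_3^2-\frac{6228045824}{43793750}t_4^4t_3^3 \\ &-\frac{1582124544}{43793750}t_4t_3^4+t_1t_2t_3+\frac{1}{2}t_1^2t_4-\frac{256}{9375}t_4^3\left(t_4^3-t_3\right)\left(779t_4^6+20532t_4^3t_3-18480t_3^2\right)Z \\ &+\frac{32256}{3125}t_4^2\left(17t_4^3-10t_3\right)\left(t_4^3-t_3\right)^2Z^2-\frac{7168}{125}t_4\left(t_4^3-t_3\right)^3Z^3+\frac{96}{5}t_4\left(t_4^3-t_3\right)^2Z^6 \\ &-\frac{8}{2625}\left(1573t_4^9-27588t_4^6t_3+25536t_4^3t_3^2-2352t_3^3\right)Z^4+\frac{544}{175}\left(t_4^3-t_3\right)^2Z^7 \\ &-\frac{288}{125}t_4^2\left(17t_4^3-10t_3\right)\left(t_4^3-t_3\right)Z^5+\frac{9}{70}t_4^2\left(17t_4^3-10t_3\right)Z^8+\frac{50}{1911}Z^{13} \\ &-\frac{15}{7}t_4\left(t_4^3-t_3\right)Z^9-\frac{10}{21}\left(t_4^3-t_3\right)Z^{10}+\frac{125}{1568}t_4Z^{12},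 \end{align*} where \begin{equation*} P(t_2, t_3, t_4, Z):=Z^4-\frac{224}{25}\left(t_4^3-t_3\right)Z+\frac{48}{25}t_4^4+\frac{224}{25}t_4t_3-t_2=0. \end{equation*} Its Euler vector field is $E=t_1\partial_{t_1}+\frac23t_2\partial_{t_2}+\frac12t_3\partial_{t_3}+\frac16t_4\partial_{t_4}$ and its charge is $d=\frac56$. A branch of it is an open set $U\subseteq\mathbb{C}^4$ with a holomorphic function $Z=Z(t)$ on $U$ such that $P(t_2,t_3,t_4,Z(t))=0$. On a branch, $F$ and all the quantities below are functions of $t=(t_1,\dots,t_4)\in U$, and $\partial/\partial t_i$ takes into account that $Z$ depends on $t$. Put $c_{ijk}=\frac{\partial^3F}{\partial t_i\partial t_j\partial t_k}$, $\eta_{ij}=c_{ij1}$, $(\eta^{ij})=(\eta_{ij})^{-1}$, $c^{ij}_k=\sum_{\lambda,\mu}\eta^{i\lambda}\eta^{j\mu}c_{\lambda\mu k}$. The intersection form is $g^{ij}(t)=\sum_kE^k(t)c^{ij}_k(t)$. Flat coordinates of $g$ on an open set $V\subseteq U$ are holomorphic coordinates $x=(x_1,\dots,x_4)$ on $V$ (an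 injective holomorphic map) with \[\sum_{\lambda,\mu}g^{\lambda\mu}\frac{\partial x_i}{\partial t_\lambda}\frac{\partial x_j}{\partial t_\mu}=\delta_{ij},\qquad E(x_i)=\frac{1-d}{2}x_i .\] Let $\hat y_1,\dots,\hat y_4$ be the polynomials in $t_1,\dots,t_4,Z$ on the right-hand sides of the following relations: \begin{align*} y_1=& \, \frac{32768}{45}\left(273437500 Z t_1 t_2^2 + 166015625 Z^3 t_2^3 - 7717500000 t_1^2 t_3- 1684375000 Z^2 t_1 t_2 t_3 \right. \\ &+ 2810937500 t_2^3 t_3 + 3430000000 Z^3 t_1 t_3^2+ 10143000000 Z t_2^2 t_3^2 + 44562560000 t_1 t_3^3 \\ &+ 13088880000 Z^2 t_2 t_3^3 - 98467891200 Z^3 t_3^4 - 1066905133056 t_3^5 - 3691406250 t_1 t_2^2 t_4 \\ &- 615234375 Z^2 t_2^3 t_4 - 4900000000 Z t_1 t_2 t_3 t_4 + 656250000 Z^3 t_2^2 t_3 t_4 \\ &+ 15092000000 Z^2 t_1 t_3^2 t_4 + 17272500000 t_2^2 t_3^2 t_4 - 75075840000 Z t_2 t_3^3 t_4 \\ &-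 117276364800 Z^2 t_3^4 t_4 + 1289062500 Z t_2^3 t_4^2 - 85995000000 t_1 t_2 t_3 t_4^2 \\ &- 4633125000 Z^2 t_2^2 t_3 t_4^2 + 21952000000 Z t_1 t_3^2 t_4^2 + 74499600000 Z^3 t_2 t_3^2 t_4^2 \\ &+ 1219784832000 t_2 t_3^3 t_4^2 + 2152574484480 Z t_3^4 t_4^2 + 7717500000 t_1^2 t_4^3 \\ &+ 1684375000 Z^2 t_1 t_2 t_4^3 - 7557031250 t_2^3 t_4^3 - 6860000000 Z^3 t_1 t_3 t_4^3 \\ &- 17206000000 Z t_2^2 t_3 t_4^3 - 1196603520000 t_1 t_3^2 t_4^3 - 40481840000 Z^2 t_2 t_3^2 t_4^3 \\ &+ 27536588800 Z^3 t_3^3 t_4^3 - 2854462464000 t_3^4 t_4^3 - 1050000000 Z t_1 t_2 t_4^4 \\ &- 6075000000 Z^3 t_2^2 t_4^4 - 11858000000 Z^2 t_1 t_3 t_4^4 - 237331500000 t_2^2 t_3 t_4^4 \\ &- 361141760000 Z t_2 t_3^2 t_4^4 + 1152093644800 Z^2 t_3^3 t_4^4 + 166320000000 t_1 t_2 t_4^5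 \\ &+ 24714375000 Z^2 t_2^2 t_4^5 + 9408000000 Z t_1 t_3 t_4^5 - 163279200000 Z^3 t_2 t_3 t_4^5 \\ &- 4338329856000 t_2 t_3^2 t_4^5 - 5691700510720 Z t_3^3 t_4^5 + 3430000000 Z^3 t_1 t_4^6 \\ &- 59062000000 Z t_2^2 t_4^6 + 4552719360000 t_1 t_3 t_4^6 + 290661840000 Z^2 t_2 t_3 t_4^6 \\ &- 604041267200 Z^3 t_3^2 t_4^6 - 1144791531520 t_3^3 t_4^6 - 3234000000 Z^2 t_1 t_4^7 \\ &+ 699646500000 t_2^2 t_4^7 + 1311466240000 Z t_2 t_3 t_4^7 - 4066807449600 Z^2 t_3^2 t_4^7 \\ &+ 1008000000 Z t_1 t_4^8 + 147735600000 Z^3 t_2 t_4^8 + 15995339136000 t_2 t_3 t_4^8 \\ &+ 7407908372480 Z t_3^2 t_4^8 - 3837646400000 t_1 t_4^9 - 481752880000 Z^2 t_2 t_4^9 \\ &+ 1597027532800 Z^3 t_3 t_4^9 + 130060834283520 t_3^2 t_4^9 + 105855360000 Z t_2 t_4^{10} \\ &+ 2986145792000 Z^2 t_3 t_4^{10} -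 21627170112000 t_2 t_4^{11} - 10675438878720 Z t_3 t_4^{11} \\ &- 1135868723200 Z^3 t_4^{12} - 398693684838400 t_3 t_4^{12} + 838213017600 Z^2 t_4^{13} \\ &\left. + 2299551252480 Z t_4^{14} + 318244776083456 t_4^{15}\right), \end{align*} \begin{align*} y_2=& \, \frac{256}{3}\left(656250 t_1 t_2 + 109375 Z^2 t_2^2 - 910000 Z^3 t_2 t_3 - 16503200 t_2 t_3^2 \right. \\ &- 18966528 Z t_3^3 - 500000 Z t_2^2 t_4 + 22344000 t_1 t_3 t_4 + 1120000 Z^2 t_2 t_3 t_4 \\ &+ 1881600 Z^3 t_3^2 t_4 + 66382848 t_3^3 t_4 + 3093750 t_2^2 t_4^2 + 8960000 Z t_2 t_3 t_4^2 \\ &- 18816000 Z^2 t_3^2 t_4^2 + 910000 Z^3 t_2 t_4^3 + 56022400 t_2 t_3 t_4^3 + 16758784 Z t_3^2 t_4^3 \\ &- 29484000 t_1 t_4^4 - 3500000 Z^2 t_2 t_4^4 + 6137600 Z^3 t_3 t_4^4 + 298923520 t_3^2 t_4^4 \\ &+ 1920000 Z t_2 t_4^5 + 25446400 Z^2 t_3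 t_4^5 - 164559200 t_2 t_4^6 - 74102784 Z t_3 t_4^6 \\ &- 8019200 Z^3 t_4^7 - 3012660224 t_3 t_4^7 + 6316800 Z^2 t_4^8 + 17123328 Z t_4^9 \\ &\left. + 3641568256 t_4^{10}\right), \\ y_3=& \, 64\left(875 t_1 + 8624 t_3^2 + 4125 t_2 t_4^2 + 66528 t_3 t_4^3 - 196992 t_4^6\right), \\ y_4=& \, 24t_4. \end{align*} \textbf{Theorem.} The relations $y_i=\hat y_i(t,Z)$ hold between the basic invariants of $H_4$ in the flat coordinates of the intersection form of $H_4(3)$ and the coordinates $t$, and they transform the intersection form into the Saito form of $H_4$. Precisely: (0) $\displaystyle\sum_{a=1}^4\frac{\partial y_i}{\partial x_a}\frac{\partial y_j}{\partial x_a}=S^{ij}(y(x))$ for all $x\in\mathbb{C}^4$ and all $i,j$. For every branch $(U,Z)$: (1) $\displaystyle\sum_{\lambda,\mu}g^{\lambda\mu}(t)\frac{\partial\hat y_i}{\partial t_\lambda}\frac{\partial\hat y_j}{\partial t_\mu}=S^{ij}(\hat y(t,Z(t)))$ for all $t\in U$ and all $i,j$. (2) The set of points of $U$ at which both $\det(g^{ij})\neq0$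 and $\det(\partial\hat y_i/\partial t_j)\neq0$ is dense in $U$, and each such point has an open neighbourhood $V\subseteq U$ with flat coordinates $x$ of $g$ on $V$ such that $y_i(x(t))=\hat y_i(t,Z(t))$ for all $t\in V$ and $i=1,\dots,4$. (3) For every connected open $V\subseteq U$ and all flat coordinates $x$ of $g$ on $V$ there is a complex orthogonal matrix $A$ such that $y_i(Ax(t))=\hat y_i(t,Z(t))$ for all $t\in V$ and $i=1,\dots,4$. -/

import Mathlib

open scoped Matrix

namespace AlgFrob

/-- Partial derivative in the `i`-th coordinate of `ℂ⁴`. The coordinates are indexed from `0`,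
so that `t 0, t 1, t 2, t 3` are `t₁, t₂, t₃, t₄`. -/
noncomputable def pd (i : Fin 4) (f : (Fin 4 → ℂ) → ℂ) (t : Fin 4 → ℂ) : ℂ :=
  fderiv ℂ f t (Pi.single i 1)

/-! ### The basic invariants of `H₄` and the Saito form -/

/-- The basic invariants `y₁, y₂, y₃, y₄` of `H₄`, of degrees 30, 20, 12, 2, as polynomials in the
orthonormal coordinates `x₁, x₂, x₃, x₄`. -/
noncomputable def invH4 (x : Fin 4 → ℂ) : Fin 4 → ℂ :=
  let x1 : ℂ := x 0
  let x2 : ℂ := x 1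
  let x3 : ℂ := x 2
  let x4 : ℂ := x 3
  let s5 : ℂ := (Real.sqrt 5 : ℝ)
  let e1 : ℂ := x2^2 + x3^2 + x4^2
  let e2 : ℂ := x2^2 * x3^2 + x2^2 * x4^2 + x3^2 * x4^2
  let e3 : ℂ := x2^2 * x3^2 * x4^2
  let dl : ℂ := (x2^2 - x3^2) * (x2^2 - x4^2) * (x3^2 - x4^2)
  let h2 : ℂ := e1
  let h6 : ℂ := s5 * dl + e1 * e2 - 11 * e3
  let h10 : ℂ := 95 * e2 * e3 - 32 * e1^2 * e3 - 5 * e1 * e2^2 + 2 * e1^3 * e2 + 3 * s5 * dl * e2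
  let y1 : ℂ :=
    (32 / 3) * x1^24 * h2^3 - 40 * x1^22 * (2 * h2^4 + 3 * h2 * h6) + x1^20 * (360 * h10
    + (1344 / 5) * h2^5 + 672 * h2^2 * h6) + x1^18 * (1080 * h6^2 - 1608 * h2^3 * h6
    - (1328 / 3) * h2^6 - 2880 * h10 * h2) + x1^16 * (10024 * h10 * h2^2 + 272 * h2^7
    + 1248 * h2^4 * h6 - 5628 * h2 * h6^2) + x1^14 * (18588 * h2^2 * h6^2 + 272 * h2^8
    - 7620 * h10 * h6 - 16856 * h10 * h2^3) + x1^12 * (14216 * h10 * h2^4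
    + 23508 * h10 * h6 * h2 - (1328 / 3) * h2^9 - 1248 * h6 * h2^6 - 27396 * h6^2 * h2^3
    - 5796 * h6^3) + x1^10 * (3240 * h10^2 - 7160 * h10 * h2^5 - 25332 * h10 * h6 * h2^2
    + (1344 / 5) * h2^10 + 1608 * h2^7 * h6 + 19968 * h2^4 * h6^2 + 7350 * h2 * h6^3)
    + x1^8 * (2144 * h10 * h2^6 - 3232 * h10^2 * h2 + 10908 * h10 * h2^3 * h6 - 906 * h10 * h6^2
    - 80 * h2^11 - 672 * h2^8 * h6 - 6924 * h2^5 * h6^2 - 1956 * h2^2 * h6^3)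
    + x1^6 * (1168 * h10^2 * h2^2 - 344 * h10 * h2^7 - 2172 * h10 * h2^4 * h6
    - 1908 * h10 * h2 * h6^2 + (32 / 3) * h2^12 + 120 * h2^9 * h6 + 1332 * h2^6 * h6^2
    + 288 * h2^3 * h6^3 + 2394 * h6^4) + x1^4 * (348 * h10^2 * h6 - 152 * h10^2 * h2^3
    + 16 * h10 * h2^8 + 60 * h10 * h6 * h2^5 + 408 * h10 * h6^2 * h2^2 - 84 * h2^7 * h6^2
    + 84 * h2^4 * h6^3 - 909 * h2 * h6^4) + x1^2 * (8 * h10^2 * h2^4 - 42 * h10 * h6^2 * h2^3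
    - 87 * h10 * h6^3 - 6 * h2^5 * h6^3 + 135 * h2^2 * h6^4) + (4 / 3) * h10^3
    - 3 * h10 * h2 * h6^3 + (9 / 5) * h6^5
  let y2 : ℂ :=
    4 * x1^16 * h2^2 - 10 * x1^14 * (2 * h2^3 + 3 * h6) + x1^12 * (44 * h2^4 + 138 * h2 * h6)
    + x1^10 * (180 * h10 - 44 * h2^5 - 402 * h2^2 * h6) + x1^8 * (44 * h2^6 - 464 * h10 * h2
    + 402 * h2^3 * h6 + 294 * h6^2) + x1^6 * (296 * h10 * h2^2 - 20 * h2^7 - 138 * h2^4 * h6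
    - 306 * h2 * h6^2) + x1^4 * (4 * h2^8 - 76 * h10 * h2^3 - 114 * h10 * h6 + 30 * h2^5 * h6
    + 168 * h2^2 * h6^2) + x1^2 * (4 * h10 * h2^4 - 21 * h2^3 * h6^2 + (57 / 2) * h6^3) + h10^2
    - (3 / 2) * h2 * h6^3
  let y3 : ℂ :=
    -2 * x1^10 * h2 + 6 * x1^8 * h2^2 + x1^6 * (33 * h6 - 14 * h2^3) - x1^4 * (33 * h2 * h6
    - 6 * h2^4) + x1^2 * (11 * h10 - 2 * h2^5) - h10 * h2 + (3 / 2) * h6^2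
  let y4 : ℂ :=
    x1^2 + h2
  ![y1, y2, y3, y4]

/-- The entries `g^{ij}(y)` of the Saito form of `H₄` as polynomials in the basic invariants. -/
noncomputable def saitoForm (y : Fin 4 → ℂ) : Matrix (Fin 4) (Fin 4) ℂ :=
  let y1 : ℂ := y 0
  let y2 : ℂ := y 1
  let y3 : ℂ := y 2
  let y4 : ℂ := y 3
  let g11 : ℂ :=
    (928 / 3) * y2 * y3^3 * y4 + 240 * y1 * y3^2 * y4^2 + 96 * y2^2 * y3 * y4^3
    + 160 * y1 * y2 * y4^4
  let g12 : ℂ :=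
    -32 * y3^4 - 112 * y2 * y3^2 * y4^2 - 120 * y1 * y3 * y4^3 + 48 * y2^2 * y4^4
  let g13 : ℂ :=
    -80 * y2^2 - (16 / 3) * y3^3 * y4^2 - 16 * y2 * y3 * y4^4 - 40 * y1 * y4^5
  let g14 : ℂ :=
    60 * y1
  let g22 : ℂ :=
    (152 / 3) * y3^3 * y4 - 56 * y2 * y3 * y4^3 + 20 * y1 * y4^4
  let g23 : ℂ :=
    -30 * y1 + 8 * y3^2 * y4^3 - 24 * y2 * y4^5
  let g24 : ℂ :=
    40 * y2
  let g33 : ℂ :=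
    44 * y2 * y4 - 8 * y3 * y4^5
  let g34 : ℂ :=
    24 * y3
  let g44 : ℂ :=
    4 * y4
  !![g11, g12, g13, g14;
     g12, g22, g23, g24;
     g13, g23, g33, g34;
     g14, g24, g34, g44]

/-! ### The algebraic Frobenius manifold `H₄(3)` -/

/-- The quartic in `Z` whose root is the algebraic function `Z` of `t₂, t₃, t₄`. -/
noncomputable def P (t : Fin 4 → ℂ) (Z : ℂ) : ℂ :=
  let t2 : ℂ := t 1
  let t3 : ℂ := t 2
  let t4 : ℂ := t 3
  Z^4 - (224 / 25) * (t4^3 - t3) * Z + (48 / 25) * t4^4 + (224 / 25) * t4 * t3 - t2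

/-- The prepotential as a polynomial in `t₁, t₂, t₃, t₄` and `Z`. -/
noncomputable def F (t : Fin 4 → ℂ) (Z : ℂ) : ℂ :=
  let t1 : ℂ := t 0
  let t2 : ℂ := t 1
  let t3 : ℂ := t 2
  let t4 : ℂ := t 3
  (2016569088 / 43793750) * t4^13 + (7929073152 / 43793750) * t4^10 * t3
  + (11291664384 / 43793750) * t4^7 * t3^2 - (6228045824 / 43793750) * t4^4 * t3^3
  - (1582124544 / 43793750) * t4 * t3^4 + t1 * t2 * t3 + (1 / 2) * t1^2 * t4
  - (256 / 9375) * t4^3 * (t4^3 - t3) * (779 * t4^6 + 20532 * t4^3 * t3 - 18480 * t3^2) * Z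
  + (32256 / 3125) * t4^2 * (17 * t4^3 - 10 * t3) * (t4^3 - t3)^2 * Z^2
  - (7168 / 125) * t4 * (t4^3 - t3)^3 * Z^3 + (96 / 5) * t4 * (t4^3 - t3)^2 * Z^6
  - (8 / 2625) * (1573 * t4^9 - 27588 * t4^6 * t3 + 25536 * t4^3 * t3^2 - 2352 * t3^3) * Z^4
  + (544 / 175) * (t4^3 - t3)^2 * Z^7 - (288 / 125) * t4^2 * (17 * t4^3 - 10 * t3) * (t4^3
  - t3) * Z^5 + (9 / 70) * t4^2 * (17 * t4^3 - 10 * t3) * Z^8 + (50 / 1911) * Z^13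
  - (15 / 7) * t4 * (t4^3 - t3) * Z^9 - (10 / 21) * (t4^3 - t3) * Z^10
  + (125 / 1568) * t4 * Z^12

/-- The degrees `d₁, d₂, d₃, d₄`. -/
noncomputable def deg : Fin 4 → ℂ := ![1, 2 / 3, 1 / 2, 1 / 6]

/-- The charge `d`. -/
noncomputable def charge : ℂ := 5 / 6

/-- The components of the Euler vector field `E = ∑ d_k t_k ∂_{t_k}`. -/
noncomputable def euler (t : Fin 4 → ℂ) (k : Fin 4) : ℂ := deg k * t k

/-- `(U, ζ)` is a chart of the manifold: an open set of values of the coordinates `t` with a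
holomorphic branch `Z = ζ(t)` of the root of the quartic. -/
def IsBranch (U : Set (Fin 4 → ℂ)) (ζ : (Fin 4 → ℂ) → ℂ) : Prop :=
  IsOpen U ∧ DifferentiableOn ℂ ζ U ∧ ∀ t ∈ U, P t (ζ t) = 0

/-- `c_{ijk}(t) = ∂³F / ∂t_i ∂t_j ∂t_k`, where `Z = ζ(t)` is a function of `t`. -/
noncomputable def c (ζ : (Fin 4 → ℂ) → ℂ) (i j k : Fin 4) (t : Fin 4 → ℂ) : ℂ :=
  pd i (pd j (pd k (fun s => F s (ζ s)))) t

/-- The metric `η_{ij}(t) = ∂³F / ∂t_i ∂t_j ∂t_1`. -/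
noncomputable def eta (ζ : (Fin 4 → ℂ) → ℂ) (t : Fin 4 → ℂ) : Matrix (Fin 4) (Fin 4) ℂ :=
  Matrix.of fun i j => c ζ i j 0 t

/-- `c^{ij}_k = η^{iλ} η^{jμ} c_{λμk}`. -/
noncomputable def cUp (ζ : (Fin 4 → ℂ) → ℂ) (i j k : Fin 4) (t : Fin 4 → ℂ) : ℂ :=
  ∑ l, ∑ m, (eta ζ t)⁻¹ i l * (eta ζ t)⁻¹ j m * c ζ l m k t

/-- The intersection form `g^{ij}(t) = E^k c^{ij}_k`. -/
noncomputable def interForm (ζ : (Fin 4 → ℂ) → ℂ) (t : Fin 4 → ℂ) : Matrix (Fin 4) (Fin 4) ℂ :=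
  Matrix.of fun i j => ∑ k, euler t k * cUp ζ i j k t

/-- The pairing `(du, dv) = g^{λμ}(t) ∂u/∂t_λ ∂v/∂t_μ` of two functions of `t`. -/
noncomputable def pairing (ζ : (Fin 4 → ℂ) → ℂ) (u v : (Fin 4 → ℂ) → ℂ) (t : Fin 4 → ℂ) : ℂ :=
  ∑ l, ∑ m, interForm ζ t l m * pd l u t * pd m v t

/-- `x₁, x₂, x₃, x₄` are holomorphic coordinates on `V`, flat for the intersection form and
normalised so that `g^{ij}(x) = δ^{ij}` and `E = (1 - d)/2 ∑ x_i ∂_{x_i}`. -/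
def IsFlatCoord (ζ : (Fin 4 → ℂ) → ℂ) (V : Set (Fin 4 → ℂ))
    (x : (Fin 4 → ℂ) → (Fin 4 → ℂ)) : Prop :=
  DifferentiableOn ℂ x V ∧ Set.InjOn x V ∧
    (∀ t ∈ V, ∀ i j, pairing ζ (fun s => x s i) (fun s => x s j) t = if i = j then 1 else 0) ∧
    (∀ t ∈ V, ∀ i, ∑ k, euler t k * pd k (fun s => x s i) t = (1 - charge) / 2 * x t i)


/-- The polynomial in `t₁, t₂, t₃, t₄, Z` that expresses the basic invariant `y₁`. -/
noncomputable def y1Poly (t : Fin 4 → ℂ) (Z : ℂ) : ℂ :=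
  let t1 : ℂ := t 0
  let t2 : ℂ := t 1
  let t3 : ℂ := t 2
  let t4 : ℂ := t 3
  let s1 : ℂ :=
    273437500 * Z * t1 * t2^2 + 166015625 * Z^3 * t2^3 - 7717500000 * t1^2 * t3
    - 1684375000 * Z^2 * t1 * t2 * t3 + 2810937500 * t2^3 * t3 + 3430000000 * Z^3 * t1 * t3^2
    + 10143000000 * Z * t2^2 * t3^2 + 44562560000 * t1 * t3^3 + 13088880000 * Z^2 * t2 * t3^3
    - 98467891200 * Z^3 * t3^4 - 1066905133056 * t3^5 - 3691406250 * t1 * t2^2 * t4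
    - 615234375 * Z^2 * t2^3 * t4 - 4900000000 * Z * t1 * t2 * t3 * t4
    + 656250000 * Z^3 * t2^2 * t3 * t4
  let s2 : ℂ :=
    15092000000 * Z^2 * t1 * t3^2 * t4 + 17272500000 * t2^2 * t3^2 * t4
    - 75075840000 * Z * t2 * t3^3 * t4 - 117276364800 * Z^2 * t3^4 * t4
    + 1289062500 * Z * t2^3 * t4^2 - 85995000000 * t1 * t2 * t3 * t4^2
    - 4633125000 * Z^2 * t2^2 * t3 * t4^2 + 21952000000 * Z * t1 * t3^2 * t4^2
    + 74499600000 * Z^3 * t2 * t3^2 * t4^2 + 1219784832000 * t2 * t3^3 * t4^2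
    + 2152574484480 * Z * t3^4 * t4^2 + 7717500000 * t1^2 * t4^3
    + 1684375000 * Z^2 * t1 * t2 * t4^3 - 7557031250 * t2^3 * t4^3
    - 6860000000 * Z^3 * t1 * t3 * t4^3
  let s3 : ℂ :=
    -17206000000 * Z * t2^2 * t3 * t4^3 - 1196603520000 * t1 * t3^2 * t4^3
    - 40481840000 * Z^2 * t2 * t3^2 * t4^3 + 27536588800 * Z^3 * t3^3 * t4^3
    - 2854462464000 * t3^4 * t4^3 - 1050000000 * Z * t1 * t2 * t4^4
    - 6075000000 * Z^3 * t2^2 * t4^4 - 11858000000 * Z^2 * t1 * t3 * t4^4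
    - 237331500000 * t2^2 * t3 * t4^4 - 361141760000 * Z * t2 * t3^2 * t4^4
    + 1152093644800 * Z^2 * t3^3 * t4^4 + 166320000000 * t1 * t2 * t4^5
    + 24714375000 * Z^2 * t2^2 * t4^5 + 9408000000 * Z * t1 * t3 * t4^5
    - 163279200000 * Z^3 * t2 * t3 * t4^5
  let s4 : ℂ :=
    -4338329856000 * t2 * t3^2 * t4^5 - 5691700510720 * Z * t3^3 * t4^5
    + 3430000000 * Z^3 * t1 * t4^6 - 59062000000 * Z * t2^2 * t4^6
    + 4552719360000 * t1 * t3 * t4^6 + 290661840000 * Z^2 * t2 * t3 * t4^6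
    - 604041267200 * Z^3 * t3^2 * t4^6 - 1144791531520 * t3^3 * t4^6
    - 3234000000 * Z^2 * t1 * t4^7 + 699646500000 * t2^2 * t4^7
    + 1311466240000 * Z * t2 * t3 * t4^7 - 4066807449600 * Z^2 * t3^2 * t4^7
    + 1008000000 * Z * t1 * t4^8 + 147735600000 * Z^3 * t2 * t4^8
    + 15995339136000 * t2 * t3 * t4^8
  let s5 : ℂ :=
    7407908372480 * Z * t3^2 * t4^8 - 3837646400000 * t1 * t4^9 - 481752880000 * Z^2 * t2 * t4^9
    + 1597027532800 * Z^3 * t3 * t4^9 + 130060834283520 * t3^2 * t4^9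
    + 105855360000 * Z * t2 * t4^10 + 2986145792000 * Z^2 * t3 * t4^10
    - 21627170112000 * t2 * t4^11 - 10675438878720 * Z * t3 * t4^11
    - 1135868723200 * Z^3 * t4^12 - 398693684838400 * t3 * t4^12 + 838213017600 * Z^2 * t4^13
    + 2299551252480 * Z * t4^14 + 318244776083456 * t4^15
  (32768 / 45) * (s1 + s2 + s3 + s4 + s5)

/-- The polynomial in `t₁, t₂, t₃, t₄, Z` that expresses the basic invariant `y₂`. -/
noncomputable def y2Poly (t : Fin 4 → ℂ) (Z : ℂ) : ℂ :=
  let t1 : ℂ := t 0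
  let t2 : ℂ := t 1
  let t3 : ℂ := t 2
  let t4 : ℂ := t 3
  let s1 : ℂ :=
    656250 * t1 * t2 + 109375 * Z^2 * t2^2 - 910000 * Z^3 * t2 * t3 - 16503200 * t2 * t3^2
    - 18966528 * Z * t3^3 - 500000 * Z * t2^2 * t4 + 22344000 * t1 * t3 * t4
    + 1120000 * Z^2 * t2 * t3 * t4 + 1881600 * Z^3 * t3^2 * t4 + 66382848 * t3^3 * t4
    + 3093750 * t2^2 * t4^2 + 8960000 * Z * t2 * t3 * t4^2 - 18816000 * Z^2 * t3^2 * t4^2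
    + 910000 * Z^3 * t2 * t4^3 + 56022400 * t2 * t3 * t4^3
  let s2 : ℂ :=
    16758784 * Z * t3^2 * t4^3 - 29484000 * t1 * t4^4 - 3500000 * Z^2 * t2 * t4^4
    + 6137600 * Z^3 * t3 * t4^4 + 298923520 * t3^2 * t4^4 + 1920000 * Z * t2 * t4^5
    + 25446400 * Z^2 * t3 * t4^5 - 164559200 * t2 * t4^6 - 74102784 * Z * t3 * t4^6
    - 8019200 * Z^3 * t4^7 - 3012660224 * t3 * t4^7 + 6316800 * Z^2 * t4^8 + 17123328 * Z * t4^9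
    + 3641568256 * t4^10
  (256 / 3) * (s1 + s2)

/-- The polynomials in `t₁, t₂, t₃, t₄, Z` that express the basic invariants `y₁, y₂, y₃, y₄`. -/
noncomputable def yPoly (t : Fin 4 → ℂ) (Z : ℂ) : Fin 4 → ℂ :=
  let t1 : ℂ := t 0
  let t2 : ℂ := t 1
  let t3 : ℂ := t 2
  let t4 : ℂ := t 3
  let y3 : ℂ :=
    64 * (875 * t1 + 8624 * t3^2 + 4125 * t2 * t4^2 + 66528 * t3 * t4^3 - 196992 * t4^6)
  let y4 : ℂ := 24 * t4
  ![y1Poly t Z, y2Poly t Z, y3, y4]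

/-- The Jacobi matrix `∂y_i/∂t_j` of the functions `y_i(t, ζ(t))`. -/
noncomputable def jacY (ζ : (Fin 4 → ℂ) → ℂ) (t : Fin 4 → ℂ) : Matrix (Fin 4) (Fin 4) ℂ :=
  Matrix.of fun i j => pd j (fun s => yPoly s (ζ s) i) t

/-- The points of `U` at which the intersection form is nondegenerate and the functions
`y_i(t, ζ(t))` are local coordinates. -/
def regularSet (U : Set (Fin 4 → ℂ)) (ζ : (Fin 4 → ℂ) → ℂ) : Set (Fin 4 → ℂ) :=
  {t | t ∈ U ∧ (interForm ζ t).det ≠ 0 ∧ (jacY ζ t).det ≠ 0}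

end AlgFrob

/-! The quartic is linear in `t₂`. Hence on a branch `w = (t₁, Z, t₃, t₄)` are local coordinates in
which `t₂`, the prepotential, its first and second `t`-derivatives, the `ŷ_i` and their first
`t`-derivatives are all polynomials. General third derivatives of `F` would require division by
`∂P/∂Z`, but they are never computed. Those with an index 1 are constant, so `η` is the antidiagonal
unit matrix. For the rest, `F` is quasi-homogeneous of degree `3 - d = 13/6`, so contracting the
third derivatives with `E` gives a multiple of the Hessian. Thus `g^{ij}` is `d_i + d_j - 1/6` times
a Hessian entry with reversed indices (`IsBranch.interForm_eq`), and (1) becomes a polynomial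
identity in `w`.

These identities are checked in the kernel (`PExpr.eval_eq`). Both sides are homogeneous for
suitable weights, so one variable can be set to 1. Substituting powers of a large power of two for
the other three turns the identity into one equality of integers, and a bound on the coefficients
makes this substitution faithful.

For (0), the basic invariants are polynomials in `x₁` and the invariants `h₂, h₆, h₁₀` of `H₃`. The
scalar products of the gradients of these four functions are again polynomials in them
(`gram_hvec`), and the chain rule leaves one more polynomial identity (`saitoL_gram`).

For (2), write `J` for the Jacobi matrix of `ŷ`. By (1), `det S(ŷ) = (det J)² det g`, so the regular
points are those where `det S(ŷ)`, a nonzero polynomial in `w`, does not vanish; this gives density.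
Flat coordinates near a regular point are a local inverse of `y` composed with `ŷ`, which needs
`ŷ(p)` to be a value of `y` (`exists_invH4_eq`). The invariants are homogeneous with no common zero
except the origin, so `y` is proper and its image closed. The image is open off the discriminant
`det S = 0`, and on a complex line not inside the discriminant the remaining points form a connected
set.

For (3), two flat systems differ by a map with orthogonal Jacobi matrices. Such a map has a constant
Jacobi matrix, by the argument that makes the Levi-Civita connection unique (`pdMat_eq_zero`). The
normalisation of `E` excludes translations. The relation thus holds near one regular point, and the
identity theorem carries it over the connected set. -/

namespace AlgFrob

/-! ### Calculus of partial derivatives -/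

/-- `f` is complex differentiable at `x` with partial derivative `a` in the direction `i`. -/
def HasPd (i : Fin 4) (f : (Fin 4 → ℂ) → ℂ) (a : ℂ) (x : Fin 4 → ℂ) : Prop :=
  DifferentiableAt ℂ f x ∧ pd i f x = a

namespace HasPd

variable {i j : Fin 4} {f g : (Fin 4 → ℂ) → ℂ} {a b : ℂ} {x : Fin 4 → ℂ}

theorem const (r : ℂ) : HasPd i (fun _ => r) 0 x :=
  ⟨differentiableAt_const r, by simp [pd]⟩

theorem coord_same : HasPd i (fun w => w i) 1 x :=
  ⟨by fun_prop, by
    have h : (fun w : Fin 4 → ℂ => w i) = ContinuousLinearMap.proj (R := ℂ) i := rfl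
    simp [pd, h, ContinuousLinearMap.fderiv]⟩

theorem coord_ne (h : j ≠ i) : HasPd i (fun w => w j) 0 x :=
  ⟨by fun_prop, by
    have h' : (fun w : Fin 4 → ℂ => w j) = ContinuousLinearMap.proj (R := ℂ) j := rfl
    simp [pd, h', ContinuousLinearMap.fderiv, h]⟩

theorem add (hf : HasPd i f a x) (hg : HasPd i g b x) :
    HasPd i (fun w => f w + g w) (a + b) x :=
  ⟨hf.1.add hg.1, by
    rw [← hf.2, ← hg.2]; simp only [pd]; rw [fderiv_fun_add hf.1 hg.1]; rfl⟩

theorem sub (hf : HasPd i f a x) (hg : HasPd i g b x) :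
    HasPd i (fun w => f w - g w) (a - b) x :=
  ⟨hf.1.sub hg.1, by
    rw [← hf.2, ← hg.2]; simp only [pd]; rw [fderiv_fun_sub hf.1 hg.1]; rfl⟩

theorem mul (hf : HasPd i f a x) (hg : HasPd i g b x) :
    HasPd i (fun w => f w * g w) (f x * b + g x * a) x :=
  ⟨hf.1.mul hg.1, by
    rw [← hf.2, ← hg.2]; simp only [pd]; rw [fderiv_fun_mul hf.1 hg.1]; rfl⟩

theorem const_mul (r : ℂ) (hf : HasPd i f a x) : HasPd i (fun w => r * f w) (r * a) x := by
  simpa using (const r).mul hf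

theorem pow (n : ℕ) (hf : HasPd i f a x) :
    HasPd i (fun w => f w ^ n) (n * f x ^ (n - 1) * a) x :=
  ⟨hf.1.pow n, by
    rw [← hf.2]; simp only [pd]; rw [fderiv_fun_pow n hf.1]; simp⟩

theorem congr (hf : HasPd i f a x) (h : a = b) : HasPd i f b x := h ▸ hf

end HasPd

/-- Partial derivatives only depend on the germ of the function. -/
theorem pd_congr {i : Fin 4} {f g : (Fin 4 → ℂ) → ℂ} {U : Set (Fin 4 → ℂ)} (hU : IsOpen U)
    (h : ∀ s ∈ U, f s = g s) {t : Fin 4 → ℂ} (ht : t ∈ U) : pd i f t = pd i g t := by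
  have : f =ᶠ[nhds t] g := by
    filter_upwards [hU.mem_nhds ht] with s hs using h s hs
  simp only [pd, this.fderiv_eq]

theorem fderiv_eq_sum_pd {f : (Fin 4 → ℂ) → ℂ} {x v : Fin 4 → ℂ} :
    fderiv ℂ f x v = ∑ a, pd a f x * v a := by
  conv_lhs => rw [pi_eq_sum_univ' v]
  simp [pd, mul_comm]

/-- The chain rule. -/
theorem pd_comp {k : Fin 4} {f : (Fin 4 → ℂ) → ℂ} {w : (Fin 4 → ℂ) → (Fin 4 → ℂ)}
    {t : Fin 4 → ℂ} (hf : DifferentiableAt ℂ f (w t)) (hw : DifferentiableAt ℂ w t) :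
    pd k (fun s => f (w s)) t = ∑ a, pd a f (w t) * pd k (fun s => w s a) t := by
  have h : fderiv ℂ (fun s => f (w s)) t = (fderiv ℂ f (w t)).comp (fderiv ℂ w t) :=
    fderiv_comp t hf hw
  simp only [pd, h, ContinuousLinearMap.comp_apply]
  rw [fderiv_eq_sum_pd]
  refine Finset.sum_congr rfl fun a _ => ?_
  rw [fderiv_apply hw.hasFDerivAt.differentiableAt a]
  rfl

/-! ### Sparse polynomials with integer coefficients, for computations in the kernel -/

/-- The value `k n`, where `n` is evaluated first. -/
def forceNat {α : Type} (n : ℕ) (k : ℕ → α) : α := Nat.rec (k 0) (fun m _ => k (Nat.succ m)) n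

theorem forceNat_eq {α : Type} (n : ℕ) (k : ℕ → α) : forceNat n k = k n := by
  cases n <;> rfl

/-- The value `k n`, where `n` is evaluated first. -/
def forceInt {α : Type} (n : ℤ) (k : ℤ → α) : α :=
  match n with
  | Int.ofNat m => forceNat m fun m' => k (Int.ofNat m')
  | Int.negSucc m => forceNat m fun m' => k (Int.negSucc m')

theorem forceInt_eq {α : Type} (n : ℤ) (k : ℤ → α) : forceInt n k = k n := by
  cases n <;> simp only [forceInt, forceNat_eq]

/-- `(c, a, b, d, e)` stands for the monomial `c w₀ᵃ w₁ᵇ w₂ᵈ w₃ᵉ`. -/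
abbrev Term := ℤ × ℕ × ℕ × ℕ × ℕ

/-- A polynomial in four variables as a list of monomials. -/
abbrev SPoly := List Term

namespace Term

/-- The value of a monomial. -/
noncomputable def eval (t : Term) (w : Fin 4 → ℂ) : ℂ :=
  t.1 * (w 0 ^ t.2.1 * w 1 ^ t.2.2.1 * w 2 ^ t.2.2.2.1 * w 3 ^ t.2.2.2.2)

/-- The product of two monomials. -/
def mul (s t : Term) : Term :=
  (s.1 * t.1, s.2.1 + t.2.1, s.2.2.1 + t.2.2.1, s.2.2.2.1 + t.2.2.2.1, s.2.2.2.2 + t.2.2.2.2)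

theorem eval_mul (s t : Term) (w : Fin 4 → ℂ) : (s.mul t).eval w = s.eval w * t.eval w := by
  simp only [eval, mul, Int.cast_mul, pow_add]; ring

/-- The derivative of a monomial. -/
def deriv (i : Fin 4) (t : Term) : Term :=
  match i with
  | 0 => (t.1 * t.2.1, t.2.1 - 1, t.2.2)
  | 1 => (t.1 * t.2.2.1, t.2.1, t.2.2.1 - 1, t.2.2.2)
  | 2 => (t.1 * t.2.2.2.1, t.2.1, t.2.2.1, t.2.2.2.1 - 1, t.2.2.2.2)
  | 3 => (t.1 * t.2.2.2.2, t.2.1, t.2.2.1, t.2.2.2.1, t.2.2.2.2 - 1)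

theorem hasPd_eval (i : Fin 4) (t : Term) (w : Fin 4 → ℂ) :
    HasPd i t.eval ((t.deriv i).eval w) w := by
  have hp : ∀ (j : Fin 4) (n : ℕ), HasPd i (fun v : Fin 4 → ℂ => v j ^ n)
      (n * w j ^ (n - 1) * if j = i then 1 else 0) w := by
    intro j n
    by_cases h : j = i
    · subst h; simpa using (HasPd.coord_same (i := j) (x := w)).pow n
    · simpa [h] using (HasPd.coord_ne (x := w) h).pow n
  refine ((((hp 0 t.2.1).mul (hp 1 t.2.2.1)).mul (hp 2 t.2.2.2.1)).mul
    (hp 3 t.2.2.2.2)).const_mul (t.1 : ℂ) |>.congr ?_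
  fin_cases i <;> simp [eval, deriv] <;> ring

/-- The degree of a monomial if the variables have degrees `u₀, u₁, u₂, 1`. -/
def wt (u : ℕ × ℕ × ℕ) (t : Term) : ℤ :=
  ((u.1 * t.2.1 + u.2.1 * t.2.2.1 + u.2.2 * t.2.2.2.1 + t.2.2.2.2 : ℕ) : ℤ)

/-- The exponents of the first three variables, read as the digits of a number. -/
def code (v : ℕ × ℕ) (t : Term) : ℕ := t.2.1 + v.1 * (t.2.2.2.1 + v.2 * t.2.2.1)

end Term

/-! ### Polynomials: derivative, product, norm and Kronecker substitution. -/

namespace SPoly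

/-- The value of a polynomial. -/
noncomputable def eval (p : SPoly) (w : Fin 4 → ℂ) : ℂ := (p.map fun t => t.eval w).sum

theorem eval_nil (w : Fin 4 → ℂ) : eval [] w = 0 := rfl

theorem eval_cons (t : Term) (p : SPoly) (w : Fin 4 → ℂ) :
    eval (t :: p) w = t.eval w + eval p w := rfl

theorem eval_append (p q : SPoly) (w : Fin 4 → ℂ) : eval (p ++ q) w = eval p w + eval q w := by
  simp [eval]

/-- The derivative of a polynomial. -/
def deriv (i : Fin 4) (p : SPoly) : SPoly := (p.map (Term.deriv i)).filter fun t => t.1 ≠ 0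

theorem hasPd_eval (i : Fin 4) (p : SPoly) (w : Fin 4 → ℂ) :
    HasPd i p.eval ((p.deriv i).eval w) w := by
  induction p with
  | nil => exact HasPd.const 0
  | cons t p ih =>
    refine ((t.hasPd_eval i w).add ih).congr ?_
    by_cases h : (t.deriv i).1 = 0
    · have h' : deriv i (t :: p) = deriv i p := by simp [deriv, h]
      simp [h', Term.eval, h]
    · have h' : deriv i (t :: p) = t.deriv i :: deriv i p := by simp [deriv, h]
      rw [h', eval_cons]

theorem differentiable_eval (p : SPoly) : Differentiable ℂ p.eval :=
  fun w => (p.hasPd_eval 0 w).1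

/-- The product of two polynomials, without collecting terms. -/
def mul (p q : SPoly) : SPoly := p.flatMap fun t => q.map t.mul

theorem eval_mul (p q : SPoly) (w : Fin 4 → ℂ) : (p.mul q).eval w = p.eval w * q.eval w := by
  induction p with
  | nil => simp [mul, eval]
  | cons t p ih =>
    have h : eval (q.map t.mul) w = t.eval w * eval q w := by
      simp [eval, Function.comp_def, Term.eval_mul, List.sum_map_mul_left]
    have h' : mul (t :: p) q = q.map t.mul ++ mul p q := by simp [mul]
    rw [h', eval_append, h, ih, eval_cons, add_mul]

/-- The sum of the absolute values of the coefficients. -/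
def norm (p : SPoly) : ℕ := (p.map fun t => t.1.natAbs).sum

/-- Equality holds, and not only an inequality, because `mul` does not collect terms and so nothing
cancels. Norms of large products can therefore be computed from the factors. -/
theorem norm_mul (p q : SPoly) : (p.mul q).norm = p.norm * q.norm := by
  induction p with
  | nil => simp [mul, norm]
  | cons t p ih =>
    have h : norm (q.map t.mul) = t.1.natAbs * q.norm := by
      simp [norm, Function.comp_def, Term.mul, Int.natAbs_mul, List.sum_map_mul_left]
    have h' : mul (t :: p) q = q.map t.mul ++ mul p q := by simp [mul]
    have h'' : ∀ a b : SPoly, norm (a ++ b) = norm a + norm b := by simp [norm]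
    rw [h', h'', h, ih]
    simp [norm, add_mul]

/-- The value of a polynomial if the digits of `code v` are substituted for the exponents. -/
def kron (v : ℕ × ℕ) (k : ℕ) (p : SPoly) : ℤ :=
  (p.map fun t => t.1 * ((2 ^ (k * t.code v) : ℕ) : ℤ)).sum

/-- `code` is additive in the exponents, so `kron` is evaluation at a point: the four variables
become `2^k`, `2^(k·v.1·v.2)`, `2^(k·v.1)` and 1. -/
theorem kron_mul (v : ℕ × ℕ) (k : ℕ) (p q : SPoly) :
    (p.mul q).kron v k = p.kron v k * q.kron v k := by
  induction p with
  | nil => simp [mul, kron]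
  | cons t p ih =>
    have h : kron v k (q.map t.mul) = t.1 * ((2 ^ (k * t.code v) : ℕ) : ℤ) * q.kron v k := by
      simp only [kron, List.map_map, Function.comp_def, ← List.sum_map_mul_left]
      congr 1
      refine List.map_congr_left fun s _ => ?_
      have : (t.mul s).code v = t.code v + s.code v := by
        simp only [Term.mul, Term.code]; ring
      rw [this, mul_add k, pow_add]
      simp only [Term.mul]
      push_cast
      ring
    have h' : mul (t :: p) q = q.map t.mul ++ mul p q := by simp [mul]
    have h'' : ∀ a b : SPoly, kron v k (a ++ b) = kron v k a + kron v k b := by simp [kron]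
    rw [h', h'', h, ih]
    simp [kron, add_mul]

end SPoly

/-- An integer polynomial with coefficients smaller than `B` that vanishes at `B` is zero. -/
theorem polynomial_eq_zero_of_eval {B : ℤ} (q : Polynomial ℤ) (hB : ∀ m, |q.coeff m| < B)
    (h : q.eval B = 0) : q = 0 := by
  induction hn : q.natDegree using Nat.strong_induction_on generalizing q with
  | _ n ih =>
    have hd := q.divX_mul_X_add
    -- `B` divides the constant term, which is smaller than `B` in absolute value. The induction
    -- then passes to the quotient by `X`.
    have h0 : q.coeff 0 = 0 := by
      apply Int.eq_zero_of_abs_lt_dvd (m := B) _ (hB 0)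
      rw [← hd] at h
      simp only [Polynomial.eval_add, Polynomial.eval_mul, Polynomial.eval_X,
        Polynomial.eval_C] at h
      exact ⟨-q.divX.eval B, by linear_combination h⟩
    rw [h0, map_zero, add_zero] at hd
    by_cases hq : q.natDegree = 0
    · rw [Polynomial.eq_C_of_natDegree_eq_zero hq, h0, map_zero]
    · have hpos : 0 < B := (abs_nonneg _).trans_lt (hB 0)
      have : q.divX = 0 := by
        refine ih q.divX.natDegree ?_ q.divX (fun m => ?_) ?_ rfl
        · rw [Polynomial.natDegree_divX_eq_natDegree_tsub_one]; omega
        · rw [Polynomial.coeff_divX]; exact hB _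
        · rw [← hd, Polynomial.eval_mul, Polynomial.eval_X] at h
          exact (mul_eq_zero.mp h).resolve_right hpos.ne'
      rw [← hd, this, zero_mul]

/-- A homogeneous polynomial with small coefficients whose Kronecker substitution is zero
vanishes. -/
theorem SPoly.eval_eq_zero {p : SPoly} {u : ℕ × ℕ × ℕ} {v : ℕ × ℕ} {k : ℕ} {n : ℤ}
    (h1 : ∀ t ∈ p, t.wt u = n) (hv1 : n < u.1 * v.1) (hv2 : n < u.2.2 * v.2)
    (h2 : p.norm < 2 ^ k) (h3 : p.kron v k = 0) (w : Fin 4 → ℂ) : p.eval w = 0 := by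
  set q : SPoly → Polynomial ℤ := fun p => (p.map fun t => Polynomial.monomial (t.code v) t.1).sum
    with hqdef
  have hq : q p = 0 := by
    apply polynomial_eq_zero_of_eval (B := 2 ^ k)
    · intro m
      have : ∀ p : SPoly, |(q p).coeff m| ≤ p.norm := by
        intro p
        induction p with
        | nil => simp [hqdef, norm]
        | cons t p ih =>
          have h : (q (t :: p)).coeff m
              = (Polynomial.monomial (t.code v) t.1).coeff m + (q p).coeff m := by
            simp [hqdef]
          have h' : ((norm (t :: p) : ℕ) : ℤ) = |t.1| + norm p := by simp [norm]
          rw [h, h']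
          refine (abs_add_le _ _).trans (add_le_add ?_ ih)
          rw [Polynomial.coeff_monomial]
          split <;> simp
      exact (this p).trans_lt (by exact_mod_cast h2)
    · rw [← h3]
      simp only [hqdef, kron, Polynomial.eval_listSum, List.map_map, Function.comp_def,
        Polynomial.eval_monomial]
      congr 1
      refine List.map_congr_left fun t _ => ?_
      push_cast
      rw [pow_mul]
  -- This inverts `code`: the digits of `m` return the first three exponents and the total degree
  -- `n` returns the fourth. So the value at `w` is a linear function of `q p`, and `q p = 0`
  -- suffices.
  set g : ℕ → ℂ := fun m => w 0 ^ (m % v.1) * w 1 ^ (m / v.1 / v.2) * w 2 ^ (m / v.1 % v.2) *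
    w 3 ^ (n - ((u.1 * (m % v.1) + u.2.1 * (m / v.1 / v.2)
      + u.2.2 * (m / v.1 % v.2) : ℕ) : ℤ)).toNat
    with hg
  have key : ∀ p : SPoly, (∀ t ∈ p, t.wt u = n) →
      p.eval w = (q p).sum fun m c => (c : ℂ) * g m := by
    intro p hp
    induction p with
    | nil => simp [hqdef, eval]
    | cons t p ih =>
      have h : q (t :: p) = Polynomial.monomial (t.code v) t.1 + q p := by simp [hqdef]
      rw [h, Polynomial.sum_add_index _ _ _ (by simp) (by intros; push_cast; ring),
        Polynomial.sum_monomial_index _ _ (by simp), eval_cons,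
        ih fun s hs => hp s (List.mem_cons_of_mem _ hs)]
      congr 1
      have ht := hp t List.mem_cons_self
      obtain ⟨c, a, b, d, e⟩ := t
      obtain ⟨A, D⟩ := v
      obtain ⟨u0, u1, u2⟩ := u
      simp only [Term.wt] at ht hv1 hv2
      have ha : a < A := by
        by_contra hcon
        have : u0 * A ≤ u0 * a := Nat.mul_le_mul_left _ (not_lt.mp hcon)
        zify at this
        push_cast at ht
        have h1 : (0 : ℤ) ≤ u1 * b := by positivity
        have h2 : (0 : ℤ) ≤ u2 * d := by positivity
        linarith [Int.natCast_nonneg e]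
      have hd : d < D := by
        by_contra hcon
        have : u2 * D ≤ u2 * d := Nat.mul_le_mul_left _ (not_lt.mp hcon)
        zify at this
        push_cast at ht
        have h1 : (0 : ℤ) ≤ u1 * b := by positivity
        have h2 : (0 : ℤ) ≤ u0 * a := by positivity
        linarith [Int.natCast_nonneg e]
      have e1 : (a + A * (d + D * b)) % A = a := by
        rw [Nat.add_mul_mod_self_left, Nat.mod_eq_of_lt ha]
      have e2 : (a + A * (d + D * b)) / A = d + D * b := by
        rw [Nat.add_mul_div_left _ _ (by omega), Nat.div_eq_of_lt ha, zero_add]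
      have e3 : (d + D * b) % D = d := by
        rw [Nat.add_mul_mod_self_left, Nat.mod_eq_of_lt hd]
      have e4 : (d + D * b) / D = b := by
        rw [Nat.add_mul_div_left _ _ (by omega), Nat.div_eq_of_lt hd, zero_add]
      have e5 : (n - ((u0 * a + u1 * b + u2 * d : ℕ) : ℤ)).toNat = e := by
        rw [← ht]; push_cast; omega
      simp only [Term.eval, Term.code, hg, e1, e2, e3, e4, e5]
  rw [key p h1, hq, Polynomial.sum_zero_index]

/-- Expressions in polynomials. -/
inductive PExpr where
  | atom (p : SPoly)
  | add (a b : PExpr)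
  | mul (a b : PExpr)
  | smul (c : ℤ) (a : PExpr)

/-! ### Evaluation of expressions without expansion, and the equality test. -/

namespace PExpr

/-- The value of an expression. -/
noncomputable def eval (w : Fin 4 → ℂ) : PExpr → ℂ
  | atom p => p.eval w
  | add a b => eval w a + eval w b
  | mul a b => eval w a * eval w b
  | smul c a => c * eval w a

/-- The polynomial that is given by an expression. -/
def toSPoly : PExpr → SPoly
  | atom p => p
  | add a b => toSPoly a ++ toSPoly b
  | mul a b => (toSPoly a).mul (toSPoly b)
  | smul c a => SPoly.mul [(c, 0, 0, 0, 0)] (toSPoly a)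

theorem eval_toSPoly (w : Fin 4 → ℂ) (a : PExpr) : a.toSPoly.eval w = a.eval w := by
  induction a with
  | atom p => rfl
  | add a b iha ihb => simp only [toSPoly, eval, SPoly.eval_append, iha, ihb]
  | mul a b iha ihb => simp only [toSPoly, eval, SPoly.eval_mul, iha, ihb]
  | smul c a ih =>
    simp [toSPoly, eval, SPoly.eval_mul, ih, SPoly.eval_cons, SPoly.eval_nil, Term.eval]

/-- A bound for the sum of the absolute values of the coefficients. -/
def norm : PExpr → ℕ
  | atom p => List.rec 0 (fun t _ r => forceNat r fun s => t.1.natAbs + s) p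
  | add a b => forceNat (norm a) fun x => forceNat (norm b) fun y => x + y
  | mul a b => forceNat (norm a) fun x => forceNat (norm b) fun y => x * y
  | smul c a => forceNat (norm a) fun x => c.natAbs * x

theorem norm_toSPoly (a : PExpr) : a.toSPoly.norm = a.norm := by
  induction a with
  | atom p =>
    induction p with
    | nil => rfl
    | cons t p ih =>
      have h : norm (atom (t :: p)) = forceNat (norm (atom p)) fun s => t.1.natAbs + s := rfl
      rw [h, forceNat_eq, ← ih]
      simp [SPoly.norm, toSPoly]
  | add a b iha ihb =>
    simp only [norm, forceNat_eq, ← iha, ← ihb]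
    simp [SPoly.norm, toSPoly]
  | mul a b iha ihb => simp only [norm, forceNat_eq, ← iha, ← ihb, toSPoly, SPoly.norm_mul]
  | smul c a ih =>
    simp only [norm, forceNat_eq, ← ih, toSPoly, SPoly.norm_mul]
    simp [SPoly.norm]

/-- The Kronecker substitution. -/
def kron (v : ℕ × ℕ) (k : ℕ) : PExpr → ℤ
  | atom p => List.rec 0 (fun t _ r => forceInt r fun s =>
      forceNat (2 ^ (k * t.code v)) fun x => t.1 * (x : ℤ) + s) p
  | add a b => forceInt (kron v k a) fun x => forceInt (kron v k b) fun y => x + y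
  | mul a b => forceInt (kron v k a) fun x => forceInt (kron v k b) fun y => x * y
  | smul c a => forceInt (kron v k a) fun x => c * x

/-- The right side multiplies integers node by node, so the expanded polynomial occurs only in the
proof and never in a computation. -/
theorem kron_toSPoly (v : ℕ × ℕ) (k : ℕ) (a : PExpr) : a.toSPoly.kron v k = a.kron v k := by
  induction a with
  | atom p =>
    induction p with
    | nil => rfl
    | cons t p ih =>
      have h : kron v k (atom (t :: p)) = forceInt (kron v k (atom p)) fun s =>
        forceNat (2 ^ (k * t.code v)) fun x => t.1 * (x : ℤ) + s := rfl
      rw [h, forceInt_eq, forceNat_eq, ← ih]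
      simp [SPoly.kron, toSPoly]
  | add a b iha ihb =>
    simp only [kron, forceInt_eq, ← iha, ← ihb]
    simp [SPoly.kron, toSPoly]
  | mul a b iha ihb => simp only [kron, forceInt_eq, ← iha, ← ihb, toSPoly, SPoly.kron_mul]
  | smul c a ih =>
    simp only [kron, forceInt_eq, ← ih, toSPoly, SPoly.kron_mul]
    simp [SPoly.kron, Term.code]

/-- The degree of one of the terms of an expression. -/
def deg (u : ℕ × ℕ × ℕ) : PExpr → Option ℤ
  | atom p => p.head?.map (Term.wt u)
  | add a b => (deg u a).or (deg u b)
  | mul a b => (deg u a).bind fun m => (deg u b).map fun n => m + n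
  | smul _ a => deg u a

/-- All terms of an expression have degree `n`. -/
def hom (u : ℕ × ℕ × ℕ) : PExpr → ℤ → Bool
  | atom p, n => p.all fun t => t.wt u == n
  | add a b, n => hom u a n && hom u b n
  | mul a b, n => match deg u a with
    | some m => hom u a m && hom u b (n - m)
    | none => match deg u b with
      | some m => hom u a (n - m) && hom u b m
      | none => hom u a n && hom u b 0
  | smul _ a, n => hom u a n

/-- In a product, the degree of one term of one factor fixes how `n` splits. Degrees are integers so
that `n - m` is a true subtraction even when a factor has no terms. -/
theorem wt_of_hom {u : ℕ × ℕ × ℕ} {a : PExpr} {n : ℤ} (h : a.hom u n = true) :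
    ∀ t ∈ a.toSPoly, t.wt u = n := by
  have hmul : ∀ {p q : SPoly} {m m' n : ℤ}, (∀ t ∈ p, t.wt u = m) → (∀ t ∈ q, t.wt u = m') →
      m + m' = n → ∀ t ∈ p.mul q, t.wt u = n := by
    intro p q m m' n hp hq hn t ht
    simp only [SPoly.mul, List.mem_flatMap, List.mem_map] at ht
    obtain ⟨s, hs, r, hr, rfl⟩ := ht
    rw [← hn, ← hp s hs, ← hq r hr]
    simp only [Term.wt, Term.mul]
    push_cast
    ring
  induction a generalizing n with
  | atom p => simpa [hom, toSPoly] using h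
  | add a b iha ihb =>
    simp only [hom, Bool.and_eq_true] at h
    simp only [toSPoly, List.mem_append]
    rintro t (ht | ht)
    exacts [iha h.1 t ht, ihb h.2 t ht]
  | mul a b iha ihb =>
    simp only [hom] at h
    split at h
    · simp only [Bool.and_eq_true] at h
      exact hmul (iha h.1) (ihb h.2) (by ring)
    · split at h <;> simp only [Bool.and_eq_true] at h <;>
        exact hmul (iha h.1) (ihb h.2) (by ring)
  | smul c a ih =>
    exact hmul (m := 0) (m' := n) (by simp [Term.wt]) (ih h) (by ring)

/-- A test for the equality of two polynomials that are homogeneous if the variables have degrees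
`u₀, u₁, u₂, 1`. -/
def eqv (u : ℕ × ℕ × ℕ) (a b : PExpr) : Bool :=
  forceInt ((deg u a).getD 0) fun n =>
    forceNat (n.toNat / u.1 + 1) fun A => forceNat (n.toNat / u.2.2 + 1) fun D =>
      forceNat (Nat.log2 (norm a + norm b) + 1) fun k =>
        (hom u a n && hom u b n) && ((decide (n < u.1 * A) && decide (n < u.2.2 * D)) &&
          (Nat.blt (norm a + norm b) (2 ^ k) && decide (kron (A, D) k a = kron (A, D) k b)))

/-- The digit bases in `eqv` exceed every exponent possible in degree `n`, and `2^k` exceeds the sum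
of the two norms, so `SPoly.eval_eq_zero` applies to `a - b`. The default degree 0 is harmless,
since `hom` checks the degree of every term afterwards. -/
theorem eval_eq {u : ℕ × ℕ × ℕ} {a b : PExpr} (h : eqv u a b = true) (w : Fin 4 → ℂ) :
    a.eval w = b.eval w := by
  simp only [eqv, forceInt_eq, forceNat_eq, Bool.and_eq_true, decide_eq_true_eq] at h
  obtain ⟨⟨h1, h2⟩, ⟨h3, h4⟩, h5, h6⟩ := h
  have := SPoly.eval_eq_zero (p := (add a (smul (-1) b)).toSPoly) (v := (_, _))
    (wt_of_hom (by simp only [hom, h1, h2, Bool.and_self])) h3 h4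
    (by
      rw [norm_toSPoly]
      simp only [norm, forceNat_eq]
      simpa [Nat.blt] using h5)
    (by
      rw [kron_toSPoly]
      simp only [kron, forceInt_eq, h6]
      ring) w
  rw [eval_toSPoly] at this
  simp only [eval, Int.cast_neg, Int.cast_one, neg_one_mul] at this
  exact sub_eq_zero.mp (by rw [sub_eq_add_neg]; exact this)

end PExpr

/-! ### The prepotential and the invariants in the coordinates `(t₁, Z, t₃, t₄)` -/

/-- The polynomial `25 t₂` in `w = (t₁, Z, t₃, t₄)`. -/
def chartT2L : SPoly :=
  [(25, 0, 4, 0, 0), (224, 0, 1, 1, 0), (-224, 0, 1, 0, 3), (224, 0, 0, 1, 1), (48, 0, 0, 0, 4)]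

/-- The prepotential, multiplied by 2102100000, as a polynomial in `w = (t₁, Z, t₃, t₄)`. -/
def potL : SPoly :=
  [(1051050000, 2, 0, 0, 1), (2102100000, 1, 4, 1, 0), (18834816000, 1, 1, 2, 0),
   (-18834816000, 1, 1, 1, 3), (18834816000, 1, 0, 2, 1), (4036032000, 1, 0, 1, 4),
   (55000000, 0, 13, 0, 0), (167578125, 0, 12, 0, 1), (1001000000, 0, 10, 1, 0),
   (-1001000000, 0, 10, 0, 3), (4504500000, 0, 9, 1, 1), (-4504500000, 0, 9, 0, 4),
   (-2702700000, 0, 8, 1, 2), (4594590000, 0, 8, 0, 5), (6534528000, 0, 7, 2, 0),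
   (-13069056000, 0, 7, 1, 3), (6534528000, 0, 7, 0, 6), (40360320000, 0, 6, 2, 1),
   (-80720640000, 0, 6, 1, 4), (40360320000, 0, 6, 0, 7), (-48432384000, 0, 5, 2, 2),
   (130767436800, 0, 5, 1, 5), (-82335052800, 0, 5, 0, 8), (15067852800, 0, 4, 3, 0),
   (-163593830400, 0, 4, 2, 3), (176739763200, 0, 4, 1, 6), (-10077267200, 0, 4, 0, 9),
   (120542822400, 0, 3, 3, 1), (-361628467200, 0, 3, 2, 4), (361628467200, 0, 3, 1, 7),
   (-120542822400, 0, 3, 0, 10), (-216977080320, 0, 2, 3, 2), (802815197184, 0, 2, 2, 5),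
   (-954699153408, 0, 2, 1, 8), (368861036544, 0, 2, 0, 11), (-1060776837120, 0, 1, 3, 3),
   (2239341232128, 0, 1, 2, 6), (-1133848748032, 0, 1, 1, 9), (-44715646976, 0, 1, 0, 12),
   (-75941978112, 0, 0, 4, 1), (-298946199552, 0, 0, 3, 4), (541999890432, 0, 0, 2, 7),
   (380595511296, 0, 0, 1, 10), (96795316224, 0, 0, 0, 13)]

/-- The derivative of the prepotential by `t_1`, multiplied by 2102100000. -/
def potGradL0 : SPoly :=
  [(2102100000, 1, 0, 0, 1), (2102100000, 0, 4, 1, 0), (18834816000, 0, 1, 2, 0),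
   (-18834816000, 0, 1, 1, 3), (18834816000, 0, 0, 2, 1), (4036032000, 0, 0, 1, 4)]

/-- The derivative of the prepotential by `t_2`, multiplied by 2102100000. -/
def potGradL1 : SPoly :=
  [(2102100000, 1, 0, 1, 0), (178750000, 0, 9, 0, 0), (502734375, 0, 8, 0, 1),
   (2102100000, 0, 6, 1, 0), (-2102100000, 0, 6, 0, 3), (9009000000, 0, 5, 1, 1),
   (-9009000000, 0, 5, 0, 4), (-5405400000, 0, 4, 1, 2), (9189180000, 0, 4, 0, 5),
   (6726720000, 0, 3, 2, 0), (-13453440000, 0, 3, 1, 3), (6726720000, 0, 3, 0, 6),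
   (40360320000, 0, 2, 2, 1), (-80720640000, 0, 2, 1, 4), (40360320000, 0, 2, 0, 7),
   (-48432384000, 0, 1, 2, 2), (130767436800, 0, 1, 1, 5), (-82335052800, 0, 1, 0, 8),
   (-118390272000, 0, 0, 2, 3), (131536204800, 0, 0, 1, 6), (4990585600, 0, 0, 0, 9)]

/-- The derivative of the prepotential by `t_3`, multiplied by 2102100000. -/
def potGradL2 : SPoly :=
  [(2102100000, 1, 4, 0, 0), (18834816000, 1, 1, 1, 0), (-18834816000, 1, 1, 0, 3),
   (18834816000, 1, 0, 1, 1), (4036032000, 1, 0, 0, 4), (-600600000, 0, 10, 0, 0),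
   (-1601600000, 0, 9, 0, 1), (-7207200000, 0, 8, 0, 2), (-5765760000, 0, 7, 1, 0),
   (5765760000, 0, 7, 0, 3), (-18834816000, 0, 6, 1, 1), (18834816000, 0, 6, 0, 4),
   (-129153024000, 0, 5, 1, 2), (129153024000, 0, 5, 0, 5), (-15067852800, 0, 4, 2, 0),
   (-158212454400, 0, 4, 1, 3), (34133299200, 0, 4, 0, 6), (-60271411200, 0, 3, 2, 1),
   (120542822400, 0, 3, 1, 4), (-60271411200, 0, 3, 0, 7), (-578605547520, 0, 2, 2, 2),
   (1157211095040, 0, 2, 1, 5), (-578605547520, 0, 2, 0, 8), (-1687599513600, 0, 1, 2, 3),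
   (2128441835520, 0, 1, 1, 6), (-440842321920, 0, 1, 0, 9), (-303767912448, 0, 0, 3, 1),
   (163938238464, 0, 0, 2, 4), (-94564614144, 0, 0, 1, 7), (335879864320, 0, 0, 0, 10)]

/-- The derivative of the prepotential by `t_4`, multiplied by 2102100000. -/
def potGradL3 : SPoly :=
  [(1051050000, 2, 0, 0, 0), (167578125, 0, 12, 0, 0), (1801800000, 0, 10, 0, 2),
   (2902900000, 0, 9, 1, 0), (-5877300000, 0, 9, 0, 3), (-9909900000, 0, 8, 1, 1),
   (19111950000, 0, 8, 0, 4), (17297280000, 0, 7, 1, 2), (-17297280000, 0, 7, 0, 5),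
   (21525504000, 0, 6, 2, 0), (-78029952000, 0, 6, 1, 3), (56504448000, 0, 6, 0, 6),
   (-177585408000, 0, 5, 2, 1), (520071552000, 0, 5, 1, 4), (-342486144000, 0, 5, 0, 7),
   (-261534873600, 0, 4, 2, 2), (657988531200, 0, 4, 1, 5), (19545926400, 0, 4, 0, 8),
   (60271411200, 0, 3, 3, 0), (-292746854400, 0, 3, 2, 3), (404679475200, 0, 3, 1, 6),
   (-172204032000, 0, 3, 0, 9), (-795582627840, 0, 2, 3, 1), (3125503180800, 0, 2, 2, 4),
   (-3864258478080, 0, 2, 1, 7), (1534337925120, 0, 2, 0, 10), (-2748376350720, 0, 1, 3, 2),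
   (9454001356800, 0, 1, 2, 5), (-6935517388800, 0, 1, 1, 8), (229892382720, 0, 1, 0, 11),
   (-75941978112, 0, 0, 4, 0), (-135007961088, 0, 0, 3, 3), (3524672126976, 0, 0, 2, 6),
   (2751041413120, 0, 0, 1, 9), (1220011413504, 0, 0, 0, 12)]

/-- The second derivative of the prepotential by `t_1` and `t_1`, multiplied by 2102100000. -/
def potHessL00 : SPoly :=
  [(2102100000, 0, 0, 0, 1)]

/-- The second derivative of the prepotential by `t_1` and `t_2`, multiplied by 2102100000. -/
def potHessL01 : SPoly :=
  [(2102100000, 0, 0, 1, 0)]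

/-- The second derivative of the prepotential by `t_1` and `t_3`, multiplied by 2102100000. -/
def potHessL02 : SPoly :=
  [(2102100000, 0, 4, 0, 0), (18834816000, 0, 1, 1, 0), (-18834816000, 0, 1, 0, 3),
   (18834816000, 0, 0, 1, 1), (4036032000, 0, 0, 0, 4)]

/-- The second derivative of the prepotential by `t_1` and `t_4`, multiplied by 2102100000. -/
def potHessL03 : SPoly :=
  [(2102100000, 1, 0, 0, 0)]

/-- The second derivative of the prepotential by `t_2` and `t_2`, multiplied by 2102100000. -/
def potHessL11 : SPoly :=
  [(402187500, 0, 5, 0, 0), (1005468750, 0, 4, 0, 1), (2252250000, 0, 2, 1, 0),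
   (-2252250000, 0, 2, 0, 3), (9009000000, 0, 1, 1, 1), (-9009000000, 0, 1, 0, 4),
   (-5405400000, 0, 0, 1, 2), (9189180000, 0, 0, 0, 5)]

/-- The second derivative of the prepotential by `t_2` and `t_3`, multiplied by 2102100000. -/
def potHessL12 : SPoly :=
  [(2102100000, 1, 0, 0, 0), (-1501500000, 0, 6, 0, 0), (-3603600000, 0, 5, 0, 1),
   (-14414400000, 0, 4, 0, 2), (-6726720000, 0, 3, 1, 0), (6726720000, 0, 3, 0, 3),
   (-20180160000, 0, 2, 1, 1), (20180160000, 0, 2, 0, 4), (-129153024000, 0, 1, 1, 2),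
   (129153024000, 0, 1, 0, 5), (-188348160000, 0, 0, 1, 3), (49201152000, 0, 0, 0, 6)]

/-- The second derivative of the prepotential by `t_2` and `t_4`, multiplied by 2102100000. -/
def potHessL13 : SPoly :=
  [(502734375, 0, 8, 0, 0), (4504500000, 0, 6, 0, 2), (5405400000, 0, 5, 1, 0),
   (-12097800000, 0, 5, 0, 3), (-19819800000, 0, 4, 1, 1), (38223900000, 0, 4, 0, 4),
   (20180160000, 0, 3, 1, 2), (-20180160000, 0, 3, 0, 5), (20180160000, 0, 2, 2, 0),
   (-77837760000, 0, 2, 1, 3), (57657600000, 0, 2, 0, 6), (-177585408000, 0, 1, 2, 1),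
   (520071552000, 0, 1, 1, 4), (-342486144000, 0, 1, 0, 7), (-306738432000, 0, 0, 2, 2),
   (748395648000, 0, 0, 1, 5), (-25657632000, 0, 0, 0, 8)]

/-- The second derivative of the prepotential by `t_3` and `t_3`, multiplied by 2102100000. -/
def potHessL22 : SPoly :=
  [(7687680000, 0, 7, 0, 0), (26906880000, 0, 6, 0, 1), (32288256000, 0, 5, 0, 2),
   (30135705600, 0, 4, 1, 0), (-89330841600, 0, 4, 0, 3), (120542822400, 0, 3, 1, 1),
   (-120542822400, 0, 3, 0, 4), (180814233600, 0, 2, 1, 2), (-180814233600, 0, 2, 0, 5),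
   (-530388418560, 0, 1, 1, 3), (530388418560, 0, 1, 0, 6), (-911303737344, 0, 0, 2, 1),
   (2015475990528, 0, 0, 1, 4), (-535406936064, 0, 0, 0, 7)]

/-- The second derivative of the prepotential by `t_3` and `t_4`, multiplied by 2102100000. -/
def potHessL23 : SPoly :=
  [(-1601600000, 0, 9, 0, 0), (-14414400000, 0, 8, 0, 1), (-23063040000, 0, 7, 0, 2),
   (-5381376000, 0, 6, 1, 0), (-9993984000, 0, 6, 0, 3), (-226017792000, 0, 5, 1, 1),
   (285981696000, 0, 5, 0, 4), (-526298572800, 0, 4, 1, 2), (496316620800, 0, 4, 0, 5),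
   (-68881612800, 0, 3, 1, 3), (68881612800, 0, 3, 0, 6), (-976396861440, 0, 2, 2, 1),
   (2288591585280, 0, 2, 1, 4), (-1312194723840, 0, 2, 0, 7), (-3905587445760, 0, 1, 2, 2),
   (7542536601600, 0, 1, 1, 5), (-3636949155840, 0, 1, 0, 8), (-303767912448, 0, 0, 3, 0),
   (2343352467456, 0, 0, 2, 3), (343719247872, 0, 0, 1, 6), (2980933795840, 0, 0, 0, 9)]

/-- The second derivative of the prepotential by `t_4` and `t_4`, multiplied by 2102100000. -/
def potHessL33 : SPoly :=
  [(3603600000, 0, 10, 0, 1), (-4118400000, 0, 9, 0, 2), (-14414400000, 0, 8, 1, 0),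
   (72586800000, 0, 8, 0, 3), (34594560000, 0, 7, 1, 1), (34594560000, 0, 7, 0, 4),
   (-129153024000, 0, 6, 1, 2), (-20756736000, 0, 6, 0, 5), (-226017792000, 0, 5, 2, 0),
   (1614412800000, 0, 5, 1, 3), (-1277033472000, 0, 5, 0, 6), (-345484339200, 0, 4, 2, 1),
   (3642115276800, 0, 4, 1, 4), (-679634841600, 0, 4, 0, 7), (-516612096000, 0, 3, 2, 2),
   (361628467200, 0, 3, 1, 5), (154983628800, 0, 3, 0, 8), (-976396861440, 0, 2, 3, 0),
   (8270959656960, 0, 2, 2, 3), (-12989104128000, 0, 2, 1, 6), (5694541332480, 0, 2, 0, 9),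
   (-3905587445760, 0, 1, 3, 1), (35728892559360, 0, 1, 2, 4), (-36292737761280, 0, 1, 1, 7),
   (4469432647680, 0, 1, 0, 10), (2343352467456, 0, 0, 3, 2), (16798158913536, 0, 0, 2, 5),
   (19241586524160, 0, 0, 1, 8), (14837187575808, 0, 0, 0, 11)]

/-- The gradient of the prepotential. -/
def potGradL : Fin 4 → SPoly := ![potGradL0, potGradL1, potGradL2, potGradL3]

/-- The Hessian matrix of the prepotential. -/
def potHessL : Fin 4 → Fin 4 → SPoly :=
  ![![potHessL00, potHessL01, potHessL02, potHessL03],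
    ![potHessL01, potHessL11, potHessL12, potHessL13],
    ![potHessL02, potHessL12, potHessL22, potHessL23],
    ![potHessL03, potHessL13, potHessL23, potHessL33]]

/-- The invariant `y_1`, multiplied by 45, as a polynomial in `w = (t₁, Z, t₃, t₄)`. -/
def invL0 : SPoly :=
  [(-252887040000000, 2, 0, 1, 0), (252887040000000, 2, 0, 0, 3), (8960000000000, 1, 9, 0, 0),
   (-120960000000000, 1, 8, 0, 1), (105369600000000, 1, 6, 1, 0), (-105369600000000, 1, 6, 0, 3),
   (-2167603200000000, 1, 5, 1, 1), (2167603200000000, 1, 5, 0, 4),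
   (-4985487360000000, 1, 4, 1, 2), (4985487360000000, 1, 4, 0, 5),
   (337182720000000, 1, 3, 2, 0), (-674365440000000, 1, 3, 1, 3), (337182720000000, 1, 3, 0, 6),
   (-9710862336000000, 1, 2, 2, 1), (19421724672000000, 1, 2, 1, 4),
   (-9710862336000000, 1, 2, 0, 7), (-44669966745600000, 1, 1, 2, 2),
   (89339933491200000, 1, 1, 1, 5), (-44669966745600000, 1, 1, 0, 8),
   (1460225966080000, 1, 0, 3, 0), (-74169408552960000, 1, 0, 2, 3),
   (188443137146880000, 1, 0, 1, 6), (-115733954560000000, 1, 0, 0, 9),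
   (5440000000000, 0, 15, 0, 0), (-20160000000000, 0, 14, 0, 1), (42240000000000, 0, 13, 0, 2),
   (238336000000000, 0, 12, 1, 0), (-393856000000000, 0, 12, 0, 3),
   (-374169600000000, 0, 11, 1, 1), (374169600000000, 0, 11, 0, 4),
   (441692160000000, 0, 10, 1, 2), (-441692160000000, 0, 10, 0, 5),
   (4118446080000000, 0, 9, 2, 0), (-11180933120000000, 0, 9, 1, 3),
   (6274416640000000, 0, 9, 0, 6), (1192181760000000, 0, 8, 2, 1),
   (-10203217920000000, 0, 8, 1, 4), (19649986560000000, 0, 8, 0, 7),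
   (1878589440000000, 0, 7, 2, 2), (-3757178880000000, 0, 7, 1, 5),
   (1878589440000000, 0, 7, 0, 8), (32481935360000000, 0, 6, 3, 0),
   (-120362670489600000, 0, 6, 2, 3), (134011826995200000, 0, 6, 1, 6),
   (-46131091865600000, 0, 6, 0, 9), (56970392371200000, 0, 5, 3, 1),
   (-311025047961600000, 0, 5, 2, 4), (641788909977600000, 0, 5, 1, 7),
   (-387734254387200000, 0, 5, 0, 10), (84052908441600000, 0, 4, 3, 2),
   (-364749237780480000, 0, 4, 2, 5), (915834729922560000, 0, 4, 1, 8),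
   (-635138400583680000, 0, 4, 0, 11), (93555167068160000, 0, 3, 4, 0),
   (-439563981946880000, 0, 3, 3, 3), (727704278138880000, 0, 3, 2, 6),
   (-510937278709760000, 0, 3, 1, 9), (129241815449600000, 0, 3, 0, 12),
   (275529534013440000, 0, 2, 4, 1), (-1729828277452800000, 0, 2, 3, 4),
   (4390419588710400000, 0, 2, 2, 7), (-4693472481116160000, 0, 2, 1, 10),
   (1757351635845120000, 0, 2, 0, 13), (722950826439475200, 0, 1, 4, 2),
   (-3900614297360793600, 0, 1, 3, 5), (11293052951435673600, 0, 1, 2, 8),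
   (-13776066316546867200, 0, 1, 1, 11), (5660676836032512000, 0, 1, 0, 14),
   (-34960347399979008, 0, 0, 5, 0), (376289556703477760, 0, 0, 4, 3),
   (-1974908230115000320, 0, 0, 3, 6), (10154808779766497280, 0, 0, 2, 9),
   (-17671572468373913600, 0, 0, 1, 12), (9150342709418917888, 0, 0, 0, 15)]

/-- The invariant `y_2`, multiplied by 6, as a polynomial in `w = (t₁, Z, t₃, t₄)`. -/
def invL1 : SPoly :=
  [(336000000, 1, 4, 0, 0), (3010560000, 1, 1, 1, 0), (-3010560000, 1, 1, 0, 3),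
   (14450688000, 1, 0, 1, 1), (-14450688000, 1, 0, 0, 4), (56000000, 0, 10, 0, 0),
   (-256000000, 0, 9, 0, 1), (1584000000, 0, 8, 0, 2), (537600000, 0, 7, 1, 0),
   (-537600000, 0, 7, 0, 3), (-3010560000, 0, 6, 1, 1), (3010560000, 0, 6, 0, 4),
   (28385280000, 0, 5, 1, 2), (-28385280000, 0, 5, 0, 5), (-8128512000, 0, 4, 2, 0),
   (56426496000, 0, 4, 1, 3), (-77850624000, 0, 4, 0, 6), (-9633792000, 0, 3, 2, 1),
   (19267584000, 0, 3, 1, 4), (-9633792000, 0, 3, 0, 7), (127166054400, 0, 2, 2, 2),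
   (-254332108800, 0, 2, 1, 5), (127166054400, 0, 2, 0, 8), (-85419622400, 0, 1, 3, 0),
   (616177336320, 0, 1, 2, 3), (-1240887459840, 0, 1, 1, 6), (710129745920, 0, 1, 0, 9),
   (-41720741888, 0, 0, 3, 1), (520995471360, 0, 0, 2, 4), (-2187828658176, 0, 0, 1, 7),
   (1708553928704, 0, 0, 0, 10)]

/-- The invariant `y_3`, multiplied by 2, as a polynomial in `w = (t₁, Z, t₃, t₄)`. -/
def invL2 : SPoly :=
  [(112000, 1, 0, 0, 0), (528000, 0, 4, 0, 2), (4730880, 0, 1, 1, 2), (-4730880, 0, 1, 0, 5),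
   (1103872, 0, 0, 2, 0), (13246464, 0, 0, 1, 3), (-24201216, 0, 0, 0, 6)]

/-- The invariant `y_4`, as a polynomial in `w = (t₁, Z, t₃, t₄)`. -/
def invL3 : SPoly :=
  [(24, 0, 0, 0, 1)]

/-- The derivative of `y_1` by `t_1`, multiplied by 45. -/
def invDL00 : SPoly :=
  [(-505774080000000, 1, 0, 1, 0), (505774080000000, 1, 0, 0, 3), (8960000000000, 0, 9, 0, 0),
   (-120960000000000, 0, 8, 0, 1), (105369600000000, 0, 6, 1, 0), (-105369600000000, 0, 6, 0, 3),
   (-2167603200000000, 0, 5, 1, 1), (2167603200000000, 0, 5, 0, 4),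
   (-4985487360000000, 0, 4, 1, 2), (4985487360000000, 0, 4, 0, 5),
   (337182720000000, 0, 3, 2, 0), (-674365440000000, 0, 3, 1, 3), (337182720000000, 0, 3, 0, 6),
   (-9710862336000000, 0, 2, 2, 1), (19421724672000000, 0, 2, 1, 4),
   (-9710862336000000, 0, 2, 0, 7), (-44669966745600000, 0, 1, 2, 2),
   (89339933491200000, 0, 1, 1, 5), (-44669966745600000, 0, 1, 0, 8),
   (1460225966080000, 0, 0, 3, 0), (-74169408552960000, 0, 0, 2, 3),
   (188443137146880000, 0, 0, 1, 6), (-115733954560000000, 0, 0, 0, 9)]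

/-- The derivative of `y_1` by `t_2`, multiplied by 45. -/
def invDL01 : SPoly :=
  [(20160000000000, 1, 5, 0, 0), (-241920000000000, 1, 4, 0, 1), (112896000000000, 1, 2, 1, 0),
   (-112896000000000, 1, 2, 0, 3), (-2167603200000000, 1, 1, 1, 1),
   (2167603200000000, 1, 1, 0, 4), (-4985487360000000, 1, 0, 1, 2),
   (4985487360000000, 1, 0, 0, 5), (20400000000000, 0, 11, 0, 0), (-70560000000000, 0, 10, 0, 1),
   (137280000000000, 0, 9, 0, 2), (669312000000000, 0, 8, 1, 0), (-1135872000000000, 0, 8, 0, 3),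
   (-870912000000000, 0, 7, 1, 1), (870912000000000, 0, 7, 0, 4), (796723200000000, 0, 6, 1, 2),
   (-796723200000000, 0, 6, 0, 5), (7767244800000000, 0, 5, 2, 0),
   (-21113487360000000, 0, 5, 1, 3), (11573084160000000, 0, 5, 0, 6),
   (4335206400000000, 0, 4, 2, 1), (-24308121600000000, 0, 4, 1, 4),
   (41250816000000000, 0, 4, 0, 7), (1502871552000000, 0, 3, 2, 2),
   (-3005743104000000, 0, 3, 1, 5), (1502871552000000, 0, 3, 0, 8),
   (31324274688000000, 0, 2, 3, 0), (-115851165696000000, 0, 2, 2, 3),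
   (127799820288000000, 0, 2, 1, 6), (-43272929280000000, 0, 2, 0, 9),
   (61502128128000000, 0, 1, 3, 1), (-324620255232000000, 0, 1, 2, 4),
   (655384117248000000, 0, 1, 1, 7), (-392265990144000000, 0, 1, 0, 10),
   (80686476165120000, 0, 0, 3, 2), (-354649940951040000, 0, 0, 2, 5),
   (905735433093120000, 0, 0, 1, 8), (-631771968307200000, 0, 0, 0, 11)]

/-- The derivative of `y_1` by `t_3`, multiplied by 45. -/
def invDL02 : SPoly :=
  [(-252887040000000, 2, 0, 0, 0), (-75264000000000, 1, 6, 0, 0), (-180633600000000, 1, 5, 0, 1),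
   (-2817884160000000, 1, 4, 0, 2), (-337182720000000, 1, 3, 1, 0),
   (337182720000000, 1, 3, 0, 3), (-1011548160000000, 1, 2, 1, 1),
   (1011548160000000, 1, 2, 0, 4), (-25248242073600000, 1, 1, 1, 2),
   (25248242073600000, 1, 1, 0, 5), (4380677898240000, 1, 0, 2, 0),
   (-103668850360320000, 1, 0, 1, 3), (143773170401280000, 1, 0, 0, 6),
   (55552000000000, 0, 12, 0, 0), (75264000000000, 0, 11, 0, 1), (-156119040000000, 0, 10, 0, 2),
   (2239856640000000, 0, 9, 1, 0), (-2233548800000000, 0, 9, 0, 3),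
   (4190699520000000, 0, 8, 1, 1), (-7829176320000000, 0, 8, 0, 4),
   (4421910528000000, 0, 7, 1, 2), (-4421910528000000, 0, 7, 0, 5),
   (27851292672000000, 0, 6, 2, 0), (-58687134105600000, 0, 6, 1, 3),
   (37455632793600000, 0, 6, 0, 6), (62473214361600000, 0, 5, 2, 1),
   (-215072479641600000, 0, 5, 1, 4), (168486764544000000, 0, 5, 0, 7),
   (199849546874880000, 0, 4, 2, 2), (-484766247813120000, 0, 4, 1, 5),
   (532761689456640000, 0, 4, 0, 8), (93555167068160000, 0, 3, 3, 0),
   (-294131230310400000, 0, 3, 2, 3), (337253624709120000, 0, 3, 1, 6),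
   (-136677561466880000, 0, 3, 0, 9), (270393566822400000, 0, 2, 3, 1),
   (-1242860900843520000, 0, 2, 2, 4), (1763511097098240000, 0, 2, 1, 7),
   (-791043763077120000, 0, 2, 0, 10), (1617793411291545600, 0, 1, 3, 2),
   (-5615581934282342400, 0, 1, 2, 5), (8598474731814912000, 0, 1, 1, 8),
   (-4600686208824115200, 0, 1, 0, 11), (-174801736999895040, 0, 0, 4, 0),
   (782207400374435840, 0, 0, 3, 3), (-2747061219423682560, 0, 0, 2, 6),
   (12194228079018639360, 0, 0, 1, 9), (-12010895632341401600, 0, 0, 0, 12)]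

/-- The derivative of `y_1` by `t_4`, multiplied by 45. -/
def invDL03 : SPoly :=
  [(758661120000000, 2, 0, 0, 2), (-120960000000000, 1, 8, 0, 0), (225792000000000, 1, 6, 0, 2),
   (-2348236800000000, 1, 5, 1, 0), (2012774400000000, 1, 5, 0, 3),
   (-7803371520000000, 1, 4, 1, 1), (26785382400000000, 1, 4, 0, 4),
   (1011548160000000, 1, 3, 1, 2), (-1011548160000000, 1, 3, 0, 5),
   (-10722410496000000, 1, 2, 2, 0), (19566231552000000, 1, 2, 1, 3),
   (-8843821056000000, 1, 2, 0, 6), (-69918208819200000, 1, 1, 2, 1),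
   (309915235123200000, 1, 1, 1, 4), (-239997026304000000, 1, 1, 0, 7),
   (-177838258913280000, 1, 0, 2, 2), (1124277399060480000, 1, 0, 1, 5),
   (-1079894133964800000, 1, 0, 0, 8), (-20160000000000, 0, 14, 0, 0),
   (84480000000000, 0, 13, 0, 1), (-633216000000000, 0, 12, 0, 2),
   (-556953600000000, 0, 11, 1, 0), (-556646400000000, 0, 11, 0, 3),
   (1515601920000000, 0, 10, 1, 1), (2023526400000000, 0, 10, 0, 4),
   (-16781721600000000, 0, 9, 1, 2), (6059950080000000, 0, 9, 0, 5),
   (-4804853760000000, 0, 8, 2, 0), (-59185889280000000, 0, 8, 1, 3),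
   (169683517440000000, 0, 8, 0, 6), (11560550400000000, 0, 7, 2, 1),
   (1515257856000000, 0, 7, 1, 4), (-13075808256000000, 0, 7, 0, 7),
   (-159443111116800000, 0, 6, 2, 2), (237560227430400000, 0, 6, 1, 5),
   (-97976490393600000, 0, 6, 0, 8), (-12624121036800000, 0, 5, 3, 0),
   (-998045437132800000, 0, 5, 2, 3), (3897576810086400000, 0, 5, 1, 6),
   (-2857401896140800000, 0, 5, 0, 9), (129262367539200000, 0, 4, 3, 1),
   (-1598842617200640000, 0, 4, 2, 4), (7062962527272960000, 0, 4, 1, 7),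
   (-7262931485982720000, 0, 4, 0, 10), (-490161171333120000, 0, 3, 3, 2),
   (1267535739617280000, 0, 3, 2, 5), (-1153557961113600000, 0, 3, 1, 8),
   (376183392829440000, 0, 3, 0, 11), (-5135967191040000, 0, 2, 4, 0),
   (-4468679890698240000, 0, 2, 3, 3), (21751795223101440000, 0, 2, 2, 6),
   (-29911776912998400000, 0, 2, 1, 9), (12633797547786240000, 0, 2, 0, 12),
   (894842584852070400, 0, 1, 4, 1), (-14897957864629862400, 0, 1, 3, 4),
   (77432275068361113600, 0, 1, 2, 7), (-128709207789246873600, 0, 1, 1, 10),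
   (65280048000663552000, 0, 1, 0, 13), (405917843670958080, 0, 0, 4, 2),
   (-9291458046716805120, 0, 0, 3, 5), (86001601083888107520, 0, 0, 2, 8),
   (-213354240910609612800, 0, 0, 1, 11), (142107149357883064320, 0, 0, 0, 14)]

/-- The derivative of `y_2` by `t_1`, multiplied by 6. -/
def invDL10 : SPoly :=
  [(336000000, 0, 4, 0, 0), (3010560000, 0, 1, 1, 0), (-3010560000, 0, 1, 0, 3),
   (14450688000, 0, 0, 1, 1), (-14450688000, 0, 0, 0, 4)]

/-- The derivative of `y_2` by `t_2`, multiplied by 6. -/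
def invDL11 : SPoly :=
  [(336000000, 1, 0, 0, 0), (140000000, 0, 6, 0, 0), (-576000000, 0, 5, 0, 1),
   (3168000000, 0, 4, 0, 2), (627200000, 0, 3, 1, 0), (-627200000, 0, 3, 0, 3),
   (-3225600000, 0, 2, 1, 1), (3225600000, 0, 2, 0, 4), (28385280000, 0, 1, 1, 2),
   (-28385280000, 0, 1, 0, 5), (-9533440000, 0, 0, 2, 0), (59236352000, 0, 0, 1, 3),
   (-79255552000, 0, 0, 0, 6)]

/-- The derivative of `y_2` by `t_3`, multiplied by 6. -/
def invDL12 : SPoly :=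
  [(11440128000, 1, 0, 0, 1), (-716800000, 0, 7, 0, 0), (896000000, 0, 6, 0, 1),
   (5160960000, 0, 5, 0, 2), (-21876736000, 0, 4, 1, 0), (33660928000, 0, 4, 0, 3),
   (4014080000, 0, 3, 1, 1), (-4014080000, 0, 3, 0, 4), (28901376000, 0, 2, 1, 2),
   (-28901376000, 0, 2, 0, 5), (-170839244800, 0, 1, 2, 0), (447264849920, 0, 1, 1, 3),
   (-276425605120, 0, 1, 0, 6), (-39742603264, 0, 0, 2, 1), (511233228800, 0, 0, 1, 4),
   (-1477698912256, 0, 0, 0, 7)]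

/-- The derivative of `y_2` by `t_4`, multiplied by 6. -/
def invDL13 : SPoly :=
  [(11440128000, 1, 0, 1, 0), (-60383232000, 1, 0, 0, 3), (-256000000, 0, 9, 0, 0),
   (3168000000, 0, 8, 0, 1), (2150400000, 0, 7, 0, 2), (-4264960000, 0, 6, 1, 0),
   (-4515840000, 0, 6, 0, 3), (61931520000, 0, 5, 1, 1), (-52346880000, 0, 5, 0, 4),
   (157753344000, 0, 4, 1, 2), (-508293120000, 0, 4, 0, 5), (-15253504000, 0, 3, 2, 0),
   (-8830976000, 0, 3, 1, 3), (24084480000, 0, 3, 0, 6), (283233484800, 0, 2, 2, 1),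
   (-512792985600, 0, 2, 1, 4), (229559500800, 0, 2, 0, 7), (1337941032960, 0, 1, 2, 2),
   (-5816718458880, 0, 1, 1, 5), (4478777425920, 0, 1, 0, 8), (43698880512, 0, 0, 3, 0),
   (1626440990720, 0, 0, 2, 3), (-15059606044672, 0, 0, 1, 6), (17694221926400, 0, 0, 0, 9)]

/-- The derivative of `y_3` by `t_1`, multiplied by 2. -/
def invDL20 : SPoly :=
  [(112000, 0, 0, 0, 0)]

/-- The derivative of `y_3` by `t_2`, multiplied by 2. -/
def invDL21 : SPoly :=
  [(528000, 0, 0, 0, 2)]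

/-- The derivative of `y_3` by `t_3`, multiplied by 2. -/
def invDL22 : SPoly :=
  [(2207744, 0, 0, 1, 0), (8515584, 0, 0, 0, 3)]

/-- The derivative of `y_3` by `t_4`, multiplied by 2. -/
def invDL23 : SPoly :=
  [(1056000, 0, 4, 0, 1), (9461760, 0, 1, 1, 1), (-9461760, 0, 1, 0, 4), (35008512, 0, 0, 1, 2),
   (-149262336, 0, 0, 0, 5)]

/-- The derivative of `y_4` by `t_4`. -/
def invDL33 : SPoly :=
  [(24, 0, 0, 0, 0)]

/-- The invariants `(45 y₁, 6 y₂, 2 y₃, y₄)`. -/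
def invL : Fin 4 → SPoly := ![invL0, invL1, invL2, invL3]

/-- The Jacobi matrix of the invariants. -/
def invDL : Fin 4 → Fin 4 → SPoly :=
  ![![invDL00, invDL01, invDL02, invDL03], ![invDL10, invDL11, invDL12, invDL13],
    ![invDL20, invDL21, invDL22, invDL23], ![[], [], [], invDL33]]

/-! ### Polynomial identities -/

namespace PExpr

/-- The sum of four expressions. -/
def sum4 (p : Fin 4 → PExpr) : PExpr := add (p 0) (add (p 1) (add (p 2) (p 3)))

theorem eval_sum4 (p : Fin 4 → PExpr) (w : Fin 4 → ℂ) :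
    (sum4 p).eval w = ∑ a, (p a).eval w := by
  simp only [sum4, eval, Fin.sum_univ_four, add_assoc]

/-- The power of an expression. -/
def pow (p : PExpr) (n : ℕ) : PExpr := Nat.rec (atom [(1, 0, 0, 0, 0)]) (fun _ r => mul p r) n

theorem eval_pow (p : PExpr) (n : ℕ) (w : Fin 4 → ℂ) : (p.pow n).eval w = p.eval w ^ n := by
  induction n with
  | zero => simp [pow, eval, SPoly.eval_cons, SPoly.eval_nil, Term.eval]
  | succ n ih =>
    have h : p.pow (n + 1) = mul p (p.pow n) := rfl
    rw [h, eval, ih, pow_succ']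

/-- The expression obtained by substituting `y` for the variables of a polynomial. -/
def subst (y : Fin 4 → PExpr) (p : SPoly) : PExpr :=
  List.rec (atom []) (fun t _ r => add (smul t.1 (mul (mul (mul (pow (y 0) t.2.1)
    (pow (y 1) t.2.2.1)) (pow (y 2) t.2.2.2.1)) (pow (y 3) t.2.2.2.2))) r) p

theorem eval_subst (y : Fin 4 → PExpr) (p : SPoly) (w : Fin 4 → ℂ) :
    (subst y p).eval w = p.eval fun i => (y i).eval w := by
  induction p with
  | nil => rfl
  | cons t p ih =>
    have h : subst y (t :: p) = add (smul t.1 (mul (mul (mul (pow (y 0) t.2.1)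
      (pow (y 1) t.2.2.1)) (pow (y 2) t.2.2.2.1)) (pow (y 3) t.2.2.2.2))) (subst y p) := rfl
    rw [h, SPoly.eval_cons, ← ih]
    simp only [eval, eval_pow, Term.eval]

end PExpr

open PExpr

/-- The scaling factors of the invariants that clear denominators. -/
def invScale : Fin 4 → ℤ := ![45, 6, 2, 1]

/-- The Saito form, multiplied by `3`, in the basis `(45 y₁, 6 y₂, 2 y₃, y₄)`. -/
def saitoL : Fin 4 → Fin 4 → SPoly :=
  let g11 := [(3600, 1, 1, 0, 4), (8100, 1, 0, 2, 2), (8100, 0, 2, 1, 3), (39150, 0, 1, 3, 1)]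
  let g12 := [(-1080, 1, 0, 1, 3), (1080, 0, 2, 0, 4), (-3780, 0, 1, 2, 2), (-1620, 0, 0, 4, 0)]
  let g13 := [(-240, 1, 0, 0, 5), (-600, 0, 2, 0, 0), (-360, 0, 1, 1, 4), (-180, 0, 0, 3, 2)]
  let g22 := [(48, 1, 0, 0, 4), (-504, 0, 1, 1, 3), (684, 0, 0, 3, 1)]
  let g23 := [(-24, 1, 0, 0, 0), (-144, 0, 1, 0, 5), (72, 0, 0, 2, 3)]
  let g33 := [(88, 0, 1, 0, 1), (-48, 0, 0, 1, 5)]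
  ![![g11, g12, g13, [(180, 1, 0, 0, 0)]], ![g12, g22, g23, [(120, 0, 1, 0, 0)]],
    ![g13, g23, g33, [(72, 0, 0, 1, 0)]],
    ![[(180, 1, 0, 0, 0)], [(120, 0, 1, 0, 0)], [(72, 0, 0, 1, 0)], [(12, 0, 0, 0, 1)]]]

theorem eval_saitoL (y : Fin 4 → ℂ) (i j : Fin 4) :
    (saitoL i j).eval (fun k => invScale k * y k) =
      3 * (invScale i * invScale j) * saitoForm y i j := by
  fin_cases i <;> fin_cases j <;>
    simp [saitoL, SPoly.eval_cons, SPoly.eval_nil, Term.eval, invScale, saitoForm] <;> ring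

/-- The weights of the coordinates `t`, multiplied by `6`. -/
def degL : Fin 4 → ℤ := ![6, 4, 3, 1]

/-- The matrix of the intersection form, multiplied by `12612600000`. -/
def interL (i j : Fin 4) : PExpr :=
  smul (degL i + degL j - 1) (atom (potHessL i.rev j.rev))

/-- This is `J g Jᵀ = S(ŷ)` with denominators cleared. The weights are six times the degrees of `t₁,
Z, t₃, t₄`; `Z` has weight 1 because `Z⁴` occurs beside `t₂`, of weight 4. -/
theorem saitoL_inter : ∀ i j : Fin 4, eqv (6, 1, 3)
    (smul 3 (sum4 fun l => mul (atom (invDL i l))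
      (sum4 fun m => mul (interL l m) (atom (invDL j m)))))
    (smul 12612600000 (subst (fun k => atom (invL k)) (saitoL i j))) = true := by
  decide +kernel

/-! ### The basic invariants of `H₄` in terms of those of `H₃` -/

/-- The invariant `y_1`, multiplied by 45, as a polynomial in `(h₁₀, h₂, h₆, x₁)`. -/
def invH4L0 : SPoly :=
  [(60, 3, 0, 0, 0), (360, 2, 4, 0, 2), (-6840, 2, 3, 0, 4), (52560, 2, 2, 0, 6),
   (-145440, 2, 1, 0, 8), (15660, 2, 0, 1, 4), (145800, 2, 0, 0, 10), (720, 1, 8, 0, 4),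
   (-15480, 1, 7, 0, 6), (96480, 1, 6, 0, 8), (2700, 1, 5, 1, 4), (-322200, 1, 5, 0, 10),
   (-97740, 1, 4, 1, 6), (639720, 1, 4, 0, 12), (-1890, 1, 3, 2, 2), (490860, 1, 3, 1, 8),
   (-758520, 1, 3, 0, 14), (18360, 1, 2, 2, 4), (-1139940, 1, 2, 1, 10), (451080, 1, 2, 0, 16),
   (-135, 1, 1, 3, 0), (-85860, 1, 1, 2, 6), (1057860, 1, 1, 1, 12), (-129600, 1, 1, 0, 18),
   (-3915, 1, 0, 3, 2), (-40770, 1, 0, 2, 8), (-342900, 1, 0, 1, 14), (16200, 1, 0, 0, 20),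
   (480, 0, 12, 0, 6), (-3600, 0, 11, 0, 8), (12096, 0, 10, 0, 10), (5400, 0, 9, 1, 6),
   (-19920, 0, 9, 0, 12), (-30240, 0, 8, 1, 8), (12240, 0, 8, 0, 14), (-3780, 0, 7, 2, 4),
   (72360, 0, 7, 1, 10), (12240, 0, 7, 0, 16), (59940, 0, 6, 2, 6), (-56160, 0, 6, 1, 12),
   (-19920, 0, 6, 0, 18), (-270, 0, 5, 3, 2), (-311580, 0, 5, 2, 8), (12096, 0, 5, 0, 20),
   (3780, 0, 4, 3, 4), (898560, 0, 4, 2, 10), (56160, 0, 4, 1, 16), (-3600, 0, 4, 0, 22),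
   (12960, 0, 3, 3, 6), (-1232820, 0, 3, 2, 12), (-72360, 0, 3, 1, 18), (480, 0, 3, 0, 24),
   (6075, 0, 2, 4, 2), (-88020, 0, 2, 3, 8), (836460, 0, 2, 2, 14), (30240, 0, 2, 1, 20),
   (-40905, 0, 1, 4, 4), (330750, 0, 1, 3, 10), (-253260, 0, 1, 2, 16), (-5400, 0, 1, 1, 22),
   (81, 0, 0, 5, 0), (107730, 0, 0, 4, 6), (-260820, 0, 0, 3, 12), (48600, 0, 0, 2, 18)]

/-- The invariant `y_2`, multiplied by 6, as a polynomial in `(h₁₀, h₂, h₆, x₁)`. -/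
def invH4L1 : SPoly :=
  [(6, 2, 0, 0, 0), (24, 1, 4, 0, 2), (-456, 1, 3, 0, 4), (1776, 1, 2, 0, 6),
   (-2784, 1, 1, 0, 8), (-684, 1, 0, 1, 4), (1080, 1, 0, 0, 10), (24, 0, 8, 0, 4),
   (-120, 0, 7, 0, 6), (264, 0, 6, 0, 8), (180, 0, 5, 1, 4), (-264, 0, 5, 0, 10),
   (-828, 0, 4, 1, 6), (264, 0, 4, 0, 12), (-126, 0, 3, 2, 2), (2412, 0, 3, 1, 8),
   (-120, 0, 3, 0, 14), (1008, 0, 2, 2, 4), (-2412, 0, 2, 1, 10), (24, 0, 2, 0, 16),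
   (-9, 0, 1, 3, 0), (-1836, 0, 1, 2, 6), (828, 0, 1, 1, 12), (171, 0, 0, 3, 2),
   (1764, 0, 0, 2, 8), (-180, 0, 0, 1, 14)]

/-- The invariant `y_3`, multiplied by 2, as a polynomial in `(h₁₀, h₂, h₆, x₁)`. -/
def invH4L2 : SPoly :=
  [(-2, 1, 1, 0, 0), (22, 1, 0, 0, 2), (-4, 0, 5, 0, 2), (12, 0, 4, 0, 4), (-28, 0, 3, 0, 6),
   (12, 0, 2, 0, 8), (-66, 0, 1, 1, 4), (-4, 0, 1, 0, 10), (3, 0, 0, 2, 0), (66, 0, 0, 1, 6)]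

/-- The invariant `y_4` as a polynomial in `(h₁₀, h₂, h₆, x₁)`. -/
def invH4L3 : SPoly :=
  [(1, 0, 1, 0, 0), (1, 0, 0, 0, 2)]

/-- The invariants `(45 y₁, 6 y₂, 2 y₃, y₄)`. -/
def invH4L : Fin 4 → SPoly := ![invH4L0, invH4L1, invH4L2, invH4L3]

/-- The products of the gradients of `h₁₀, h₂, h₆, x₁`. -/
def gramL : Fin 4 → Fin 4 → SPoly :=
  ![![[(8, 1, 4, 0, 0), (36, 0, 3, 2, 0), (30, 0, 0, 3, 0)], [(20, 1, 0, 0, 0)],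
      [(8, 0, 4, 1, 0), (28, 0, 1, 2, 0)], []],
    ![[(20, 1, 0, 0, 0)], [(4, 0, 1, 0, 0)], [(12, 0, 0, 1, 0)], []],
    ![[(8, 0, 4, 1, 0), (28, 0, 1, 2, 0)], [(12, 0, 0, 1, 0)],
      [(8, 1, 0, 0, 0), (8, 0, 2, 1, 0)], []],
    ![[], [], [], [(1, 0, 0, 0, 0)]]]

/-- The part of (0) that remains after the chain rule through `h₁₀, h₂, h₆, x₁`, whose degrees in
`x` are 10, 2, 6, 1. -/
theorem saitoL_gram : ∀ i j : Fin 4, eqv (10, 2, 6)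
    (smul 3 (sum4 fun l => mul (atom ((invH4L i).deriv l))
      (sum4 fun m => mul (atom (gramL l m)) (atom ((invH4L j).deriv m)))))
    (subst (fun k => atom (invH4L k)) (saitoL i j)) = true := by
  decide +kernel

/-! ### The gradients of the basic invariants of `H₄` -/

/-- The functions `h₁₀, h₂, h₆, x₁`. -/
noncomputable def hvec (x : Fin 4 → ℂ) : Fin 4 → ℂ :=
  let s5 : ℂ := (Real.sqrt 5 : ℝ)
  let e1 : ℂ := x 1 ^ 2 + x 2 ^ 2 + x 3 ^ 2
  let e2 : ℂ := x 1 ^ 2 * x 2 ^ 2 + x 1 ^ 2 * x 3 ^ 2 + x 2 ^ 2 * x 3 ^ 2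
  let e3 : ℂ := x 1 ^ 2 * x 2 ^ 2 * x 3 ^ 2
  let dl : ℂ := (x 1 ^ 2 - x 2 ^ 2) * (x 1 ^ 2 - x 3 ^ 2) * (x 2 ^ 2 - x 3 ^ 2)
  ![95 * e2 * e3 - 32 * e1 ^ 2 * e3 - 5 * e1 * e2 ^ 2 + 2 * e1 ^ 3 * e2 + 3 * s5 * dl * e2, e1,
    s5 * dl + e1 * e2 - 11 * e3, x 0]

theorem sqrt_five_sq : ((Real.sqrt 5 : ℝ) : ℂ) ^ 2 = 5 := by
  rw [← Complex.ofReal_pow, Real.sq_sqrt (by norm_num)]; norm_num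

theorem eval_invH4L (x : Fin 4 → ℂ) (i : Fin 4) :
    (invH4L i).eval (hvec x) = invScale i * invH4 x i := by
  simp only [invH4, hvec]
  generalize ((Real.sqrt 5 : ℝ) : ℂ) = s5
  generalize (95 : ℂ) * _ * _ - _ - _ + _ + _ = h10
  generalize s5 * _ + _ - _ = h6
  generalize x 1 ^ 2 + _ + _ = h2
  fin_cases i <;>
  simp only [invH4L, invH4L0, invH4L1, invH4L2, invH4L3, invScale, Fin.zero_eta, Fin.mk_one,
    Fin.reduceFinMk, Matrix.cons_val, SPoly.eval_cons, SPoly.eval_nil, Term.eval] <;>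
  push_cast <;> ring

/-- The derivatives of `h₂, h₆, h₁₀` by the square of the coordinate `a`. -/
noncomputable def hvecD (x : Fin 4 → ℂ) : Fin 4 → Fin 4 → ℂ :=
  let s5 : ℂ := (Real.sqrt 5 : ℝ)
  let a := x 1 ^ 2
  let b := x 2 ^ 2
  let c := x 3 ^ 2
  let e1 : ℂ := a + b + c
  let e2 : ℂ := a * b + a * c + b * c
  let e3 : ℂ := a * b * c
  let dl : ℂ := (a - b) * (a - c) * (b - c)
  let d6 : ℂ → ℂ → ℂ → ℂ := fun d f g => s5 * d + e2 + e1 * f - 11 * g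
  let d10 : ℂ → ℂ → ℂ → ℂ := fun d f g => 95 * (f * e3 + e2 * g) - 32 * (2 * e1 * e3 + e1 ^ 2 * g)
    - 5 * (e2 ^ 2 + 2 * e1 * e2 * f) + 2 * (3 * e1 ^ 2 * e2 + e1 ^ 3 * f)
    + 3 * s5 * (d * e2 + dl * f)
  let da := (b - c) * (2 * a - b - c)
  let db := (a - c) * (a - 2 * b + c)
  let dc := (a - b) * (2 * c - a - b)
  ![![0, 2 * x 1 * d10 da (b + c) (b * c), 2 * x 2 * d10 db (a + c) (a * c),
      2 * x 3 * d10 dc (a + b) (a * b)],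
    ![0, 2 * x 1, 2 * x 2, 2 * x 3],
    ![0, 2 * x 1 * d6 da (b + c) (b * c), 2 * x 2 * d6 db (a + c) (a * c),
      2 * x 3 * d6 dc (a + b) (a * b)],
    ![1, 0, 0, 0]]

theorem hasPd_hvec (x : Fin 4 → ℂ) (i a : Fin 4) :
    HasPd a (fun z => hvec z i) (hvecD x i a) x := by
  fin_cases i <;> fin_cases a <;>
  simp only [hvec, hvecD, Fin.zero_eta, Fin.mk_one, Fin.reduceFinMk, Matrix.cons_val] <;>
  apply HasPd.congr
  any_goals
    repeat' with_reducible first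
      | apply HasPd.add | apply HasPd.sub | apply HasPd.mul | apply HasPd.pow
      | exact HasPd.coord_same | apply HasPd.coord_ne | apply HasPd.const
  any_goals decide
  all_goals ring1

/-- The functions `h₂, h₆, h₁₀` do not involve `x₁`, so its gradient is orthogonal to theirs. The
other products are polynomial identities in `x₂, x₃, x₄` over `ℚ(√5)`; where they are not linear in
`√5`, the relation `√5² = 5` is needed. -/
theorem gram_hvec (x : Fin 4 → ℂ) (l m : Fin 4) :
    ∑ a, hvecD x l a * hvecD x m a = (gramL l m).eval (hvec x) := by
  have hs := sqrt_five_sq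
  have comm : ∀ l m, ∑ a, hvecD x l a * hvecD x m a = ∑ a, hvecD x m a * hvecD x l a :=
    fun l m => Finset.sum_congr rfl fun a _ => mul_comm _ _
  have h66 : ∑ a, hvecD x 2 a * hvecD x 2 a = (gramL 2 2).eval (hvec x) := by
    simp only [hvecD, gramL, hvec, Fin.sum_univ_four, Matrix.cons_val, SPoly.eval_cons,
      SPoly.eval_nil, Term.eval]
    generalize ((Real.sqrt 5 : ℝ) : ℂ) = s5 at hs
    generalize x 1 = p, x 2 = q, x 3 = r
    push_cast
    -- The factor of `hs` is the quotient of the difference of both sides by `s5² - 5`: here the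
    -- coefficient of `s5²`, which is `|∇δ|²`. In the next two cases it is found the same way; in
    -- `hTT` a term linear in `s5` comes from the cube of `h₆`.
    linear_combination 4 * (p ^ 2 * ((q ^ 2 - r ^ 2) * (2 * p ^ 2 - q ^ 2 - r ^ 2)) ^ 2
      + q ^ 2 * ((p ^ 2 - r ^ 2) * (p ^ 2 - 2 * q ^ 2 + r ^ 2)) ^ 2
      + r ^ 2 * ((p ^ 2 - q ^ 2) * (2 * r ^ 2 - p ^ 2 - q ^ 2)) ^ 2) * hs
  have h6T : ∑ a, hvecD x 2 a * hvecD x 0 a = (gramL 2 0).eval (hvec x) := by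
    simp only [hvecD, gramL, hvec, Fin.sum_univ_four, Matrix.cons_val, SPoly.eval_cons,
      SPoly.eval_nil, Term.eval]
    generalize ((Real.sqrt 5 : ℝ) : ℂ) = s5 at hs
    generalize x 1 = p, x 2 = q, x 3 = r
    push_cast
    linear_combination (12 * (p ^ 2 * ((q ^ 2 - r ^ 2) * (2 * p ^ 2 - q ^ 2 - r ^ 2)) *
        ((q ^ 2 - r ^ 2) * (2 * p ^ 2 - q ^ 2 - r ^ 2) *
            (p ^ 2 * q ^ 2 + p ^ 2 * r ^ 2 + q ^ 2 * r ^ 2)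
          + (p ^ 2 - q ^ 2) * (p ^ 2 - r ^ 2) * (q ^ 2 - r ^ 2) * (q ^ 2 + r ^ 2))
      + q ^ 2 * ((p ^ 2 - r ^ 2) * (p ^ 2 - 2 * q ^ 2 + r ^ 2)) *
        ((p ^ 2 - r ^ 2) * (p ^ 2 - 2 * q ^ 2 + r ^ 2) *
            (p ^ 2 * q ^ 2 + p ^ 2 * r ^ 2 + q ^ 2 * r ^ 2)
          + (p ^ 2 - q ^ 2) * (p ^ 2 - r ^ 2) * (q ^ 2 - r ^ 2) * (p ^ 2 + r ^ 2))
      + r ^ 2 * ((p ^ 2 - q ^ 2) * (2 * r ^ 2 - p ^ 2 - q ^ 2)) *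
        ((p ^ 2 - q ^ 2) * (2 * r ^ 2 - p ^ 2 - q ^ 2) *
            (p ^ 2 * q ^ 2 + p ^ 2 * r ^ 2 + q ^ 2 * r ^ 2)
          + (p ^ 2 - q ^ 2) * (p ^ 2 - r ^ 2) * (q ^ 2 - r ^ 2) * (p ^ 2 + q ^ 2)))
      - 28 * (p ^ 2 + q ^ 2 + r ^ 2) *
        ((p ^ 2 - q ^ 2) * (p ^ 2 - r ^ 2) * (q ^ 2 - r ^ 2)) ^ 2) * hs
  have hTT : ∑ a, hvecD x 0 a * hvecD x 0 a = (gramL 0 0).eval (hvec x) := by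
    simp only [hvecD, gramL, hvec, Fin.sum_univ_four, Matrix.cons_val, SPoly.eval_cons,
      SPoly.eval_nil, Term.eval]
    generalize ((Real.sqrt 5 : ℝ) : ℂ) = s5 at hs
    generalize x 1 = p, x 2 = q, x 3 = r
    push_cast
    linear_combination (36 * (p ^ 2 *
        ((q ^ 2 - r ^ 2) * (2 * p ^ 2 - q ^ 2 - r ^ 2) *
            (p ^ 2 * q ^ 2 + p ^ 2 * r ^ 2 + q ^ 2 * r ^ 2)
          + (p ^ 2 - q ^ 2) * (p ^ 2 - r ^ 2) * (q ^ 2 - r ^ 2) * (q ^ 2 + r ^ 2)) ^ 2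
      + q ^ 2 *
        ((p ^ 2 - r ^ 2) * (p ^ 2 - 2 * q ^ 2 + r ^ 2) *
            (p ^ 2 * q ^ 2 + p ^ 2 * r ^ 2 + q ^ 2 * r ^ 2)
          + (p ^ 2 - q ^ 2) * (p ^ 2 - r ^ 2) * (q ^ 2 - r ^ 2) * (p ^ 2 + r ^ 2)) ^ 2
      + r ^ 2 *
        ((p ^ 2 - q ^ 2) * (2 * r ^ 2 - p ^ 2 - q ^ 2) *
            (p ^ 2 * q ^ 2 + p ^ 2 * r ^ 2 + q ^ 2 * r ^ 2)
          + (p ^ 2 - q ^ 2) * (p ^ 2 - r ^ 2) * (q ^ 2 - r ^ 2) * (p ^ 2 + q ^ 2)) ^ 2)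
      - 36 * (p ^ 2 + q ^ 2 + r ^ 2) ^ 3 *
        ((p ^ 2 - q ^ 2) * (p ^ 2 - r ^ 2) * (q ^ 2 - r ^ 2)) ^ 2
      - 30 * (3 * ((p ^ 2 + q ^ 2 + r ^ 2) * (p ^ 2 * q ^ 2 + p ^ 2 * r ^ 2 + q ^ 2 * r ^ 2)
          - 11 * (p ^ 2 * q ^ 2 * r ^ 2)) *
          ((p ^ 2 - q ^ 2) * (p ^ 2 - r ^ 2) * (q ^ 2 - r ^ 2)) ^ 2
        + s5 * ((p ^ 2 - q ^ 2) * (p ^ 2 - r ^ 2) * (q ^ 2 - r ^ 2)) ^ 3)) * hs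
  -- The gradient of `h₂` is twice the radial field in `x₂, x₃, x₄`, so this is Euler's identity
  -- with factor `2 deg`.
  have hl : ∀ m, ∑ a, hvecD x 1 a * hvecD x m a = (gramL 1 m).eval (hvec x) := by
    intro m
    fin_cases m <;>
    simp only [hvecD, gramL, hvec, Fin.sum_univ_four, Fin.zero_eta, Fin.mk_one, Fin.reduceFinMk,
      Matrix.cons_val, SPoly.eval_cons, SPoly.eval_nil, Term.eval] <;>
    push_cast <;> ring
  have hx : ∀ m, ∑ a, hvecD x 3 a * hvecD x m a = (gramL 3 m).eval (hvec x) := by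
    intro m
    fin_cases m <;>
    simp [hvecD, gramL, hvec, Fin.sum_univ_four, SPoly.eval_cons, SPoly.eval_nil, Term.eval]
  have symm : ∀ l m, gramL l m = gramL m l := by decide
  have swap : ∀ l m, ∑ a, hvecD x l a * hvecD x m a = (gramL l m).eval (hvec x) →
      ∑ a, hvecD x m a * hvecD x l a = (gramL m l).eval (hvec x) := fun l m h => by
    rw [comm, h, symm]
  match l, m with
  | 0, 0 => exact hTT
  | 0, 1 => exact swap 1 0 (hl 0)
  | 0, 2 => exact swap 2 0 h6T
  | 0, 3 => exact swap 3 0 (hx 0)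
  | 1, m => exact hl m
  | 2, 0 => exact h6T
  | 2, 1 => exact swap 1 2 (hl 2)
  | 2, 2 => exact h66
  | 2, 3 => exact swap 3 2 (hx 2)
  | 3, m => exact hx m

theorem invScale_ne_zero (i : Fin 4) : (invScale i : ℂ) ≠ 0 := by
  fin_cases i <;> simp [invScale]

/-- The matrix of the products of the gradients of the basic invariants. -/
theorem gram_invH4 (x : Fin 4 → ℂ) (i j : Fin 4) :
    ∑ a, pd a (fun z => invH4 z i) x * pd a (fun z => invH4 z j) x
      = saitoForm (invH4 x) i j := by
  have hw : DifferentiableAt ℂ hvec x := differentiableAt_pi.mpr fun i => (hasPd_hvec x i 0).1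
  have hc := invScale_ne_zero
  have hpd : ∀ i a, invScale i * pd a (fun z => invH4 z i) x =
      ∑ l, ((invH4L i).deriv l).eval (hvec x) * hvecD x l a := by
    intro i a
    have h1 : DifferentiableAt ℂ (fun z => (invH4L i).eval (hvec z)) x :=
      (SPoly.differentiable_eval _ _).comp x hw
    have h2 : (fun z => invH4 z i) = fun z => (invScale i : ℂ)⁻¹ * (invH4L i).eval (hvec z) := by
      funext z; rw [eval_invH4L, inv_mul_cancel_left₀ (hc i)]
    have h3 := (HasPd.const_mul (i := a) (invScale i : ℂ)⁻¹ ⟨h1, rfl⟩).2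
    rw [h2, h3, mul_inv_cancel_left₀ (hc i), pd_comp (SPoly.differentiable_eval _ _) hw]
    exact Finset.sum_congr rfl fun l _ => by
      rw [((invH4L i).hasPd_eval l _).2, (hasPd_hvec x l a).2]
  have key := PExpr.eval_eq (saitoL_gram i j) (hvec x)
  simp only [PExpr.eval, PExpr.eval_sum4, PExpr.eval_subst, eval_invH4L, eval_saitoL,
    ← gram_hvec] at key
  apply mul_left_cancel₀ (hc i)
  apply mul_left_cancel₀ (hc j)
  have e1 : invScale j *
      (invScale i * ∑ a, pd a (fun z => invH4 z i) x * pd a (fun z => invH4 z j) x)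
      = ∑ a, (invScale i * pd a (fun z => invH4 z i) x) *
        (invScale j * pd a (fun z => invH4 z j) x) := by
    simp only [Finset.mul_sum]
    exact Finset.sum_congr rfl fun a _ => by ring
  rw [e1]
  simp only [hpd]
  have e2 : ∑ a, (∑ l, ((invH4L i).deriv l).eval (hvec x) * hvecD x l a) *
      (∑ l, ((invH4L j).deriv l).eval (hvec x) * hvecD x l a) =
      ∑ l, ((invH4L i).deriv l).eval (hvec x) * ∑ m, (∑ a, hvecD x l a * hvecD x m a) *
        ((invH4L j).deriv m).eval (hvec x) := by
    simp only [Fin.sum_univ_four]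
    ring
  rw [e2]
  push_cast at key
  linear_combination key / 3

/-! ### Derivatives on a branch -/

/-- The coordinates `(t₁, Z, t₃, t₄)` on a branch. -/
noncomputable def chart (ζ : (Fin 4 → ℂ) → ℂ) (t : Fin 4 → ℂ) : Fin 4 → ℂ :=
  ![t 0, ζ t, t 2, t 3]

/-- A test whether `G k` is the derivative of `H` by `t_k`, at constant values of the other
coordinates `t`, where `H` and `G k` are polynomials in `(t₁, Z, t₃, t₄)`. -/
def isTDeriv (H : SPoly) (G : Fin 4 → SPoly) (k : Fin 4) : Bool :=
  eqv (6, 1, 3) (smul 25 (atom (H.deriv k)))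
    (add (smul 25 (atom (if k = 1 then [] else G k)))
      (mul (atom (chartT2L.deriv k)) (atom (G 1))))

section Branch

variable {U : Set (Fin 4 → ℂ)} {ζ : (Fin 4 → ℂ) → ℂ} {t : Fin 4 → ℂ}

theorem IsBranch.differentiableAt (hb : IsBranch U ζ) (ht : t ∈ U) : DifferentiableAt ℂ ζ t :=
  hb.2.1.differentiableAt (hb.1.mem_nhds ht)

theorem IsBranch.differentiableAt_chart (hb : IsBranch U ζ) (ht : t ∈ U) :
    DifferentiableAt ℂ (chart ζ) t := by
  refine differentiableAt_pi.mpr fun i => ?_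
  fin_cases i
  · exact differentiableAt_apply 0 t
  · exact hb.differentiableAt ht
  · exact differentiableAt_apply 2 t
  · exact differentiableAt_apply 3 t

theorem pd_coord (k i : Fin 4) : pd k (fun s => s i) t = if k = i then 1 else 0 := by
  split_ifs with h
  · subst h; exact HasPd.coord_same.2
  · exact (HasPd.coord_ne (Ne.symm h)).2

/-- Slot 1 of the chart holds `Z` in place of `t₂`, so differentiation by `t₂` acts only through
`Z`. -/
theorem IsBranch.pd_eval_chart (hb : IsBranch U ζ) (ht : t ∈ U) (p : SPoly) (k : Fin 4) :
    HasPd k (fun s => p.eval (chart ζ s)) ((p.deriv 1).eval (chart ζ t) * pd k ζ t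
      + if k = 1 then 0 else (p.deriv k).eval (chart ζ t)) t := by
  refine ⟨(p.differentiable_eval _).comp t (hb.differentiableAt_chart ht), ?_⟩
  rw [pd_comp (p.differentiable_eval _) (hb.differentiableAt_chart ht), Fin.sum_univ_four]
  simp only [(p.hasPd_eval _ _).2]
  have h0 : pd k (fun s => chart ζ s 0) t = if k = 0 then 1 else 0 := pd_coord k 0
  have h1 : pd k (fun s => chart ζ s 1) t = pd k ζ t := rfl
  have h2 : pd k (fun s => chart ζ s 2) t = if k = 2 then 1 else 0 := pd_coord k 2
  have h3 : pd k (fun s => chart ζ s 3) t = if k = 3 then 1 else 0 := pd_coord k 3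
  rw [h0, h1, h2, h3]
  fin_cases k <;> simp [add_comm]

theorem IsBranch.t2_eq (hb : IsBranch U ζ) (ht : t ∈ U) :
    t 1 = ζ t ^ 4 - (224 / 25) * (t 3 ^ 3 - t 2) * ζ t + (48 / 25) * t 3 ^ 4
      + (224 / 25) * t 3 * t 2 := by
  have := hb.2.2 t ht
  simp only [P] at this
  linear_combination -this

theorem IsBranch.eval_chartT2L (hb : IsBranch U ζ) (ht : t ∈ U) :
    chartT2L.eval (chart ζ t) = 25 * t 1 := by
  rw [hb.t2_eq ht]
  simp only [chartT2L, chart, SPoly.eval_cons, SPoly.eval_nil, Term.eval, Matrix.cons_val]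
  push_cast
  ring

/-- The derivatives of the branch `ζ`. -/
theorem IsBranch.pd_zeta (hb : IsBranch U ζ) (ht : t ∈ U) (k : Fin 4) :
    (chartT2L.deriv 1).eval (chart ζ t) * pd k ζ t
      + (if k = 1 then 0 else (chartT2L.deriv k).eval (chart ζ t)) = if k = 1 then 25 else 0 := by
  rw [← (hb.pd_eval_chart ht chartT2L k).2,
    pd_congr hb.1 (fun s hs => hb.eval_chartT2L hs) ht,
    (HasPd.const_mul 25 ⟨differentiableAt_apply 1 t, pd_coord k 1⟩).2]
  split_ifs <;> simp

/-- Write `T = 25 t₂` as a polynomial in the chart. The test says `25 H_Z = T_Z G₂` and, for `k ≠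
2`, `25 H_k = 25 G_k + T_k G₂`. Differentiating `T` along the branch gives `T_Z ∂_k Z`, and with it
`H_Z ∂_k Z`, so the derivative of `H` follows without division by `T_Z`. -/
theorem IsBranch.hasPd_eval (hb : IsBranch U ζ) (ht : t ∈ U) {H : SPoly} {G : Fin 4 → SPoly}
    (h : ∀ k, isTDeriv H G k = true) (k : Fin 4) :
    HasPd k (fun s => H.eval (chart ζ s)) ((G k).eval (chart ζ t)) t := by
  refine (hb.pd_eval_chart ht H k).congr ?_
  have hk := eval_eq (h k) (chart ζ t)
  have h1 := eval_eq (h 1) (chart ζ t)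
  have hz := hb.pd_zeta ht k
  simp only [PExpr.eval, Int.cast_ofNat, if_true, SPoly.eval_nil, mul_zero, zero_add] at hk h1
  apply mul_left_cancel₀ (by norm_num : (25 : ℂ) ≠ 0)
  by_cases hk1 : k = 1
  · subst hk1
    simp only [if_true, add_zero] at hz ⊢
    linear_combination pd 1 ζ t * h1 + (G 1).eval (chart ζ t) * hz
  · simp only [if_neg hk1] at hz hk ⊢
    linear_combination pd k ζ t * h1 + (G 1).eval (chart ζ t) * hz + hk

/-! ### The intersection form on a branch -/

theorem IsBranch.eval_potL (hb : IsBranch U ζ) (ht : t ∈ U) :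
    F t (ζ t) = 2102100000⁻¹ * potL.eval (chart ζ t) := by
  simp only [F, hb.t2_eq ht, potL, chart, SPoly.eval_cons, SPoly.eval_nil, Term.eval,
    Matrix.cons_val]
  generalize ζ t = Z
  push_cast
  ring

theorem isTDeriv_potL : ∀ k, isTDeriv potL potGradL k = true := by decide +kernel

theorem isTDeriv_potGradL : ∀ j k, isTDeriv (potGradL j) (fun i => potHessL i j) k = true := by
  decide +kernel

/-- The third derivatives with an index 1 are constants, so they pass the polynomial test. They are
the entries of `η`. -/
theorem isTDeriv_potHessL : ∀ j k, isTDeriv (potHessL j 0)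
    (fun i => if i = j.rev then [(2102100000, 0, 0, 0, 0)] else []) k = true := by
  decide +kernel

theorem IsBranch.pd_F (hb : IsBranch U ζ) (ht : t ∈ U) (k : Fin 4) :
    pd k (fun s => F s (ζ s)) t = 2102100000⁻¹ * (potGradL k).eval (chart ζ t) := by
  rw [pd_congr hb.1 (fun s hs => hb.eval_potL hs) ht,
    ((hb.hasPd_eval ht isTDeriv_potL k).const_mul _).2]

theorem IsBranch.pd_pd_F (hb : IsBranch U ζ) (ht : t ∈ U) (j k : Fin 4) :
    pd j (pd k (fun s => F s (ζ s))) t = 2102100000⁻¹ * (potHessL j k).eval (chart ζ t) := by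
  rw [pd_congr hb.1 (fun s hs => hb.pd_F hs k) ht,
    ((hb.hasPd_eval ht (isTDeriv_potGradL k) j).const_mul _).2]

theorem IsBranch.c_eq (hb : IsBranch U ζ) (ht : t ∈ U) (i j k : Fin 4) :
    c ζ i j k t = 2102100000⁻¹ * pd i (fun s => (potHessL j k).eval (chart ζ s)) t := by
  rw [c, pd_congr hb.1 (fun s hs => hb.pd_pd_F hs j k) ht,
    (HasPd.const_mul _ ⟨(hb.pd_eval_chart ht (potHessL j k) i).1, rfl⟩).2]

theorem IsBranch.eta_eq (hb : IsBranch U ζ) (ht : t ∈ U) :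
    eta ζ t = Matrix.of fun i j : Fin 4 => if i = j.rev then 1 else 0 := by
  ext i j
  simp only [eta, Matrix.of_apply]
  rw [hb.c_eq ht, (hb.hasPd_eval ht (isTDeriv_potHessL j) i).2]
  split_ifs <;> simp [SPoly.eval_cons, SPoly.eval_nil, Term.eval]

theorem eq_rev_iff (a b : Fin 4) : a = b.rev ↔ a.rev = b := by
  rw [← Fin.rev_inj, Fin.rev_rev]

theorem IsBranch.eta_inv (hb : IsBranch U ζ) (ht : t ∈ U) :
    (eta ζ t)⁻¹ = Matrix.of fun i j : Fin 4 => if i = j.rev then 1 else 0 := by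
  rw [hb.eta_eq ht]
  refine Matrix.inv_eq_right_inv ?_
  ext i j
  simp only [Matrix.mul_apply, Matrix.of_apply, eq_rev_iff, ite_mul, one_mul, zero_mul,
    Finset.sum_ite_eq, Finset.mem_univ, if_true, Fin.rev_rev, Matrix.one_apply]

theorem IsBranch.cUp_eq (hb : IsBranch U ζ) (ht : t ∈ U) (i j k : Fin 4) :
    cUp ζ i j k t = c ζ i.rev j.rev k t := by
  simp only [cUp, hb.eta_inv ht, Matrix.of_apply, eq_rev_iff, ite_mul, mul_ite, one_mul,
    zero_mul, mul_zero, mul_one]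
  simp

/-- The Euler vector field, multiplied by `150`. -/
def eulerL : Fin 4 → SPoly :=
  ![[(150, 1, 0, 0, 0)], SPoly.mul [(4, 0, 0, 0, 0)] chartT2L, [(75, 0, 0, 1, 0)],
    [(25, 0, 0, 0, 1)]]

/-- The derivative of `F` by `t_m` is homogeneous of degree `13/6 - d_m`, written with second
derivatives only so that all entries are polynomials. -/
theorem euler_potGradL : ∀ m, eqv (6, 1, 3)
    (sum4 fun k => mul (atom (eulerL k)) (atom (potHessL m k)))
    (smul (25 * (13 - degL m)) (atom (potGradL m))) = true := by
  decide +kernel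

theorem IsBranch.eval_eulerL (hb : IsBranch U ζ) (ht : t ∈ U) (k : Fin 4) :
    (eulerL k).eval (chart ζ t) = 150 * euler t k := by
  match k with
  | 0 => simp [eulerL, euler, deg, SPoly.eval_cons, SPoly.eval_nil, Term.eval, chart]
  | 1 =>
    have := hb.eval_chartT2L ht
    simp [eulerL, euler, deg, SPoly.eval_mul, this, SPoly.eval_cons, SPoly.eval_nil, Term.eval]
    ring
  | 2 =>
    simp [eulerL, euler, deg, SPoly.eval_cons, SPoly.eval_nil, Term.eval, chart]; ring
  | 3 =>
    simp [eulerL, euler, deg, SPoly.eval_cons, SPoly.eval_nil, Term.eval, chart]; ring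

theorem deg_eq (k : Fin 4) : deg k = degL k / 6 := by
  fin_cases k <;> simp [deg, degL] <;> norm_num

theorem potHessL_symm : ∀ l m, potHessL l m = potHessL m l := by decide

/-- Differentiating the Euler identity for `∂F/∂t_m` by `t_l` produces the contraction of the third
derivatives with `E` plus `d_l` times a Hessian entry. No third derivative has to be known
explicitly. -/
theorem IsBranch.euler_c (hb : IsBranch U ζ) (ht : t ∈ U) (l m : Fin 4) :
    ∑ k, euler t k * c ζ l m k t =
      12612600000⁻¹ * ((13 - degL l - degL m) * (potHessL l m).eval (chart ζ t)) := by
  have h1 : ∀ s ∈ U, ∑ k, euler s k * (potHessL m k).eval (chart ζ s) =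
      (13 - degL m) / 6 * (potGradL m).eval (chart ζ s) := by
    intro s hs
    have := eval_eq (euler_potGradL m) (chart ζ s)
    simp only [PExpr.eval, eval_sum4, hb.eval_eulerL hs] at this
    push_cast at this
    simp only [Fin.sum_univ_four] at this ⊢
    linear_combination this / 150
  have hE : ∀ k, HasPd l (fun s => euler s k) (if l = k then deg k else 0) t := by
    intro k
    refine (HasPd.const_mul (deg k) ⟨differentiableAt_apply k t, pd_coord l k⟩).congr ?_
    split_ifs <;> simp
  have hk : ∀ k, HasPd l (fun s => euler s k * (potHessL m k).eval (chart ζ s))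
      (euler t k * (2102100000 * c ζ l m k t) +
        (potHessL m k).eval (chart ζ t) * if l = k then deg k else 0) t := by
    intro k
    refine (hE k).mul ⟨(hb.pd_eval_chart ht (potHessL m k) l).1, ?_⟩
    rw [hb.c_eq ht]
    ring
  have h2 := ((((hk 0).add (hk 1)).add (hk 2)).add (hk 3)).2
  have h3 := ((hb.hasPd_eval ht (isTDeriv_potGradL m) l).const_mul ((13 - degL m) / 6)).2
  rw [← pd_congr hb.1 h1 ht] at h3
  simp only [Fin.sum_univ_four] at h3
  rw [h2] at h3
  have h4 : ∑ k, (potHessL m k).eval (chart ζ t) * (if l = k then deg k else 0) =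
      (potHessL m l).eval (chart ζ t) * (degL l / 6) := by
    simp [deg_eq]
  rw [potHessL_symm, Fin.sum_univ_four] at h4
  rw [Fin.sum_univ_four]
  linear_combination h3 / 2102100000 - h4 / 2102100000

theorem IsBranch.interForm_eq (hb : IsBranch U ζ) (ht : t ∈ U) (i j : Fin 4) :
    interForm ζ t i j = 12612600000⁻¹ * (interL i j).eval (chart ζ t) := by
  simp only [interForm, Matrix.of_apply, hb.cUp_eq ht, hb.euler_c ht, interL, PExpr.eval]
  -- Duality of the degrees, `d_i + d_{5-i} = 2 - d = 7/6`. It turns the factor `13 - …` at reversed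
  -- indices into `degL i + degL j - 1`.
  have h : ∀ i : Fin 4, (degL i.rev : ℂ) = 7 - degL i := by
    intro i; fin_cases i <;> simp [degL, Fin.rev] <;> norm_num
  rw [h, h]
  push_cast
  ring

/-! ### The transformation of the intersection form into the Saito form -/

theorem IsBranch.eval_invL (hb : IsBranch U ζ) (ht : t ∈ U) (i : Fin 4) :
    (invL i).eval (chart ζ t) = invScale i * yPoly t (ζ t) i := by
  simp only [yPoly, y1Poly, y2Poly, hb.t2_eq ht]
  fin_cases i <;>
  simp only [invL, invL0, invL1, invL2, invL3, invScale, Fin.zero_eta, Fin.mk_one,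
    Fin.reduceFinMk, Matrix.cons_val, SPoly.eval_cons, SPoly.eval_nil, Term.eval, chart] <;>
  generalize ζ t = Z <;> push_cast <;> ring

theorem isTDeriv_invL : ∀ i k, isTDeriv (invL i) (invDL i) k = true := by decide +kernel

theorem IsBranch.hasPd_yPoly (hb : IsBranch U ζ) (ht : t ∈ U) (i k : Fin 4) :
    HasPd k (fun s => yPoly s (ζ s) i) ((invScale i : ℂ)⁻¹ * (invDL i k).eval (chart ζ t)) t := by
  have h := (hb.hasPd_eval ht (isTDeriv_invL i) k).const_mul (invScale i : ℂ)⁻¹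
  have heq : ∀ s ∈ U, (invScale i : ℂ)⁻¹ * (invL i).eval (chart ζ s) = yPoly s (ζ s) i :=
    fun s hs => by rw [hb.eval_invL hs, inv_mul_cancel_left₀ (invScale_ne_zero i)]
  refine ⟨h.1.congr_of_eventuallyEq ?_, (pd_congr hb.1 heq ht).symm.trans h.2⟩
  filter_upwards [hb.1.mem_nhds ht] with s hs using (heq s hs).symm

theorem IsBranch.pairing_yPoly (hb : IsBranch U ζ) (ht : t ∈ U) (i j : Fin 4) :
    pairing ζ (fun s => yPoly s (ζ s) i) (fun s => yPoly s (ζ s) j) t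
      = saitoForm (yPoly t (ζ t)) i j := by
  have key := PExpr.eval_eq (saitoL_inter i j) (chart ζ t)
  have hI : ∀ l m, (interL l m).eval (chart ζ t) = 12612600000 * interForm ζ t l m :=
    fun l m => by rw [hb.interForm_eq ht, mul_inv_cancel_left₀ (by norm_num)]
  have hY : ∀ i k, (invDL i k).eval (chart ζ t) = invScale i * pd k (fun s => yPoly s (ζ s) i) t :=
    fun i k => by
      rw [(hb.hasPd_yPoly ht i k).2, mul_inv_cancel_left₀ (invScale_ne_zero i)]
  simp only [PExpr.eval, PExpr.eval_sum4, PExpr.eval_subst, hb.eval_invL ht, eval_saitoL, hI, hY,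
    PExpr.eval] at key
  apply mul_left_cancel₀ (invScale_ne_zero i)
  apply mul_left_cancel₀ (invScale_ne_zero j)
  rw [pairing]
  push_cast at key
  simp only [Fin.sum_univ_four] at key ⊢
  linear_combination key / 37837800000

end Branch

/-! ### Holomorphic functions of several variables -/

open Metric Filter Topology

section Holomorphic

variable {U : Set (Fin 4 → ℂ)} {t : Fin 4 → ℂ}

theorem pd_eq_deriv {f : (Fin 4 → ℂ) → ℂ} (hf : DifferentiableAt ℂ f t) (k : Fin 4) :
    pd k f t = deriv (fun z : ℂ => f (t + z • Pi.single k 1)) 0 := by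
  have h1 : HasDerivAt (fun z : ℂ => t + z • (Pi.single k 1 : Fin 4 → ℂ)) (Pi.single k 1) 0 := by
    simpa using ((hasDerivAt_id (0 : ℂ)).smul_const (Pi.single k 1 : Fin 4 → ℂ)).const_add t
  have h2 : HasFDerivAt f (fderiv ℂ f t) (t + (0 : ℂ) • (Pi.single k 1 : Fin 4 → ℂ)) := by
    simpa using hf.hasFDerivAt
  exact (h2.comp_hasDerivAt (0 : ℂ) h1).deriv.symm

/-- Partial derivatives of holomorphic functions are holomorphic. -/
theorem differentiableAt_pd (hU : IsOpen U) {f : (Fin 4 → ℂ) → ℂ} (hf : DifferentiableOn ℂ f U)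
    (k : Fin 4) (ht : t ∈ U) : DifferentiableAt ℂ (pd k f) t := by
  obtain ⟨R, hR, hRU⟩ := nhds_basis_closedBall.mem_iff.mp (hU.mem_nhds ht)
  -- Base points stay within `r` of `t`, a shift along the coordinate line adds at most `2r`, and
  -- the derivative bound needs a further ball of radius `r`.
  set r := R / 4 with hr
  have hr0 : 0 < r := by positivity
  obtain ⟨M, hM⟩ := (isCompact_closedBall t R).exists_bound_of_continuousOn
    (hf.continuousOn.mono hRU)
  have hdiff : ∀ p ∈ closedBall t R, DifferentiableAt ℂ f p := fun p hp =>
    hf.differentiableAt (hU.mem_nhds (hRU hp))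
  set e : Fin 4 → ℂ := Pi.single k 1 with he
  have hnorm : ∀ z : ℂ, ‖z • e‖ ≤ ‖z‖ := by
    intro z
    rw [norm_smul, he, Pi.norm_single, norm_one, mul_one]
  have hmem : ∀ s ∈ closedBall t r, ∀ z : ℂ, ‖z‖ ≤ 2 * r → s + z • e ∈ closedBall t (3 * r) := by
    intro s hs z hz
    rw [mem_closedBall, dist_eq_norm] at hs ⊢
    calc ‖s + z • e - t‖ = ‖(s - t) + z • e‖ := by congr 1; abel
      _ ≤ ‖s - t‖ + ‖z • e‖ := norm_add_le _ _
      _ ≤ 3 * r := by linarith [hnorm z]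
  have hsub : closedBall t (3 * r) ⊆ closedBall t R := closedBall_subset_closedBall (by linarith)
  -- `f` maps the ball of radius `r` about `p` into the ball of radius `2M` about `f p`; the Schwarz
  -- lemma bounds the derivative.
  have hfd : ∀ p ∈ closedBall t (3 * r), ‖fderiv ℂ f p‖ ≤ (M + M) / r := by
    intro p hp
    have hpR : ball p r ⊆ closedBall t R := by
      refine ball_subset_closedBall.trans (closedBall_subset_closedBall' ?_)
      linarith [mem_closedBall.mp hp]
    refine Complex.norm_fderiv_le_div_of_mapsTo_ball
      (fun q hq => (hdiff q (hpR hq)).differentiableWithinAt) (fun q hq => ?_) hr0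
    rw [mem_closedBall, dist_eq_norm]
    exact (norm_sub_le _ _).trans (add_le_add (hM q (hpR hq)) (hM p (hsub hp)))
  have hcircle : ∀ θ : ℝ, ‖circleMap 0 r θ‖ ≤ 2 * r := by
    intro θ
    rw [norm_circleMap_zero, abs_of_pos hr0]
    linarith
  -- Cauchy's formula
  have hcauchy : ∀ s ∈ closedBall t r, pd k f s = (2 * Real.pi * Complex.I : ℂ)⁻¹ •
      ∮ z in C(0, r), ((z - 0) ^ 2)⁻¹ • f (s + z • e) := by
    intro s hs
    rw [pd_eq_deriv (hdiff s (closedBall_subset_closedBall (by linarith) hs)) k]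
    symm
    refine Complex.two_pi_I_inv_smul_circleIntegral_sub_sq_inv_smul_of_differentiable
      (U := ball 0 (2 * r)) isOpen_ball (closedBall_subset_ball (by linarith)) (fun z hz => ?_)
      (mem_ball_self hr0)
    have hz' : ‖z‖ ≤ 2 * r := by simpa using (mem_ball.mp hz).le
    have h2 : DifferentiableAt ℂ f (s + z • e) := hdiff _ (hsub (hmem s hs z hz'))
    exact (h2.comp (f := fun w : ℂ => s + w • e) z (by fun_prop)).differentiableWithinAt
  set c : ℝ → ℂ := fun θ => deriv (circleMap 0 r) θ * ((circleMap 0 r θ - 0) ^ 2)⁻¹ with hc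
  have hcont : Continuous c := by
    simp only [hc, deriv_circleMap]
    refine ((continuous_circleMap 0 r).mul continuous_const).mul
      ((((continuous_circleMap 0 r).sub continuous_const).pow 2).inv₀ fun θ => ?_)
    simpa using hr0.ne'
  have hline : ∀ s : Fin 4 → ℂ, Continuous fun θ : ℝ => s + circleMap 0 r θ • e := fun s =>
    continuous_const.add ((continuous_circleMap 0 r).smul continuous_const)
  have hFc : ∀ s ∈ closedBall t r, Continuous fun θ : ℝ => c θ • f (s + circleMap 0 r θ • e) := by
    intro s hs
    refine hcont.smul (continuous_iff_continuousAt.mpr fun θ => ?_)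
    have := (hdiff _ (hsub (hmem s hs _ (hcircle θ)))).continuousAt
    exact ContinuousAt.comp (f := fun θ : ℝ => s + circleMap 0 r θ • e) this
      (hline s).continuousAt
  -- Differentiation of Cauchy's integral in the base point `s`, dominated by the uniform bound for
  -- the derivative of `f`.
  have key := intervalIntegral.hasFDerivAt_integral_of_dominated_of_fderiv_le
    (μ := MeasureTheory.volume) (a := 0) (b := 2 * Real.pi) (𝕜 := ℂ) (x₀ := t) (s := closedBall t r)
    (F := fun s θ => c θ • f (s + circleMap 0 r θ • e))
    (F' := fun s θ => c θ • fderiv ℂ f (s + circleMap 0 r θ • e))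
    (bound := fun θ => ‖c θ‖ * ((M + M) / r))
    (closedBall_mem_nhds t hr0)
    (by filter_upwards [closedBall_mem_nhds t hr0] with s hs
        exact (hFc s hs).aestronglyMeasurable)
    ((hFc t (mem_closedBall_self hr0.le)).intervalIntegrable _ _)
    (by
      refine Measurable.aestronglyMeasurable ?_
      exact hcont.measurable.smul ((measurable_fderiv ℂ f).comp (hline t).measurable))
    (by
      refine Eventually.of_forall fun θ _ s hs => ?_
      rw [norm_smul]
      exact mul_le_mul_of_nonneg_left (hfd _ (hmem s hs _ (hcircle θ))) (norm_nonneg _))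
    ((hcont.norm.mul continuous_const).intervalIntegrable _ _)
    (by
      refine Eventually.of_forall fun θ _ s hs => ?_
      have h2 := (hdiff _ (hsub (hmem s hs _ (hcircle θ)))).hasFDerivAt
      exact ((hasFDerivAt_comp_add_right _).mpr h2).const_smul (c θ))
  refine (key.differentiableAt.const_smul (2 * Real.pi * Complex.I : ℂ)⁻¹).congr_of_eventuallyEq ?_
  filter_upwards [closedBall_mem_nhds t hr0] with s hs
  rw [hcauchy s hs, circleIntegral]
  simp only [Pi.smul_apply, hc, smul_eq_mul, mul_assoc]

theorem fderiv_eq_sum_smul_proj (f : (Fin 4 → ℂ) → ℂ) (x : Fin 4 → ℂ) :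
    fderiv ℂ f x = ∑ a, pd a f x • ContinuousLinearMap.proj (R := ℂ) (φ := fun _ => ℂ) a := by
  ext v
  simp [fderiv_eq_sum_pd]

theorem differentiableAt_fderiv (hU : IsOpen U) {f : (Fin 4 → ℂ) → ℂ}
    (hf : DifferentiableOn ℂ f U) (ht : t ∈ U) : DifferentiableAt ℂ (fderiv ℂ f) t := by
  rw [show fderiv ℂ f = _ from funext (fderiv_eq_sum_smul_proj f)]
  exact DifferentiableAt.fun_sum fun a _ => (differentiableAt_pd hU hf a ht).smul_const _

/-- Symmetry of the second derivatives. -/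
theorem pd_pd_comm (hU : IsOpen U) {f : (Fin 4 → ℂ) → ℂ} (hf : DifferentiableOn ℂ f U)
    (ht : t ∈ U) (k l : Fin 4) : pd k (pd l f) t = pd l (pd k f) t := by
  have h := differentiableAt_fderiv hU hf ht
  have hsymm := second_derivative_symmetric_of_eventually
    (by filter_upwards [hU.mem_nhds ht] with s hs
        exact (hf.differentiableAt (hU.mem_nhds hs)).hasFDerivAt) h.hasFDerivAt
    (Pi.single k 1) (Pi.single l 1)
  have hpd : ∀ a b, pd a (pd b f) t =
      fderiv ℂ (fderiv ℂ f) t (Pi.single a 1) (Pi.single b 1) := by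
    intro a b
    have : HasFDerivAt (pd b f)
        ((ContinuousLinearMap.apply ℂ ℂ (Pi.single b 1)).comp (fderiv ℂ (fderiv ℂ f) t)) t :=
      (ContinuousLinearMap.apply ℂ ℂ (Pi.single b 1 : Fin 4 → ℂ)).hasFDerivAt.comp t h.hasFDerivAt
    simp [pd, this.fderiv]
  rw [hpd, hpd, hsymm]

theorem continuousAt_fderiv_pi (hU : IsOpen U) {f : (Fin 4 → ℂ) → (Fin 4 → ℂ)}
    (hf : DifferentiableOn ℂ f U) (ht : t ∈ U) : ContinuousAt (fderiv ℂ f) t := by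
  have h : ∀ s ∈ U, fderiv ℂ f s =
      ContinuousLinearMap.pi fun i => fderiv ℂ (fun x => f x i) s := by
    intro s hs
    ext1 v
    funext i
    rw [ContinuousLinearMap.pi_apply,
      fderiv_apply (hf.differentiableAt (hU.mem_nhds hs)) i]
    rfl
  have hcont : ContinuousAt (fun s => ContinuousLinearMap.pi fun i =>
      fderiv ℂ (fun x => f x i) s) t := by
    have : ContinuousAt (fun s i => fderiv ℂ (fun x => f x i) s) t :=
      continuousAt_pi.mpr fun i => (differentiableAt_fderiv hU
        (fun s hs => (differentiableWithinAt_pi.mp (hf s hs)) i) ht).continuousAt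
    exact (ContinuousLinearMap.piEquivL ℂ (Fin 4 → ℂ)
      (fun _ : Fin 4 => ℂ)).continuous.continuousAt.comp this
  refine hcont.congr ?_
  filter_upwards [hU.mem_nhds ht] with s hs using (h s hs).symm

/-- The Jacobi matrix `∂f_i/∂t_j`. -/
noncomputable def jac (f : (Fin 4 → ℂ) → (Fin 4 → ℂ)) (t : Fin 4 → ℂ) :
    Matrix (Fin 4) (Fin 4) ℂ :=
  Matrix.of fun i j => pd j (fun s => f s i) t

theorem toLin'_jac {f : (Fin 4 → ℂ) → (Fin 4 → ℂ)} (hf : DifferentiableAt ℂ f t) :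
    Matrix.toLin' (jac f t) = (fderiv ℂ f t : (Fin 4 → ℂ) →ₗ[ℂ] (Fin 4 → ℂ)) := by
  ext1 a
  ext i
  simp only [jac, LinearMap.comp_apply, LinearMap.single_apply, Matrix.toLin'_apply,
    Matrix.mulVec_single_one, Matrix.col_apply, Matrix.of_apply, ContinuousLinearMap.coe_coe, pd]
  rw [fderiv_apply hf i]
  rfl

/-- A holomorphic map is strictly differentiable, with invertible derivative where the Jacobi
determinant does not vanish. -/
theorem exists_hasStrictFDerivAt (hU : IsOpen U) {f : (Fin 4 → ℂ) → (Fin 4 → ℂ)}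
    (hf : DifferentiableOn ℂ f U) (ht : t ∈ U) (hdet : (jac f t).det ≠ 0) :
    ∃ e : (Fin 4 → ℂ) ≃L[ℂ] (Fin 4 → ℂ),
      HasStrictFDerivAt f (e : (Fin 4 → ℂ) →L[ℂ] (Fin 4 → ℂ)) t := by
  have hd := hf.differentiableAt (hU.mem_nhds ht)
  have hdet' : (fderiv ℂ f t).det ≠ 0 := by
    rw [ContinuousLinearMap.det, ← toLin'_jac hd, LinearMap.det_toLin']
    exact hdet
  refine ⟨(fderiv ℂ f t).toContinuousLinearEquivOfDetNeZero hdet', ?_⟩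
  rw [ContinuousLinearMap.coe_toContinuousLinearEquivOfDetNeZero]
  refine hasStrictFDerivAt_of_hasFDerivAt_of_continuousAt ?_ (continuousAt_fderiv_pi hU hf ht)
  filter_upwards [hU.mem_nhds ht] with s hs
  exact (hf.differentiableAt (hU.mem_nhds hs)).hasFDerivAt

theorem jac_comp {f g : (Fin 4 → ℂ) → (Fin 4 → ℂ)} (hf : DifferentiableAt ℂ f (g t))
    (hg : DifferentiableAt ℂ g t) : jac (fun s => f (g s)) t = jac f (g t) * jac g t := by
  ext i j
  simp only [jac, Matrix.of_apply, Matrix.mul_apply]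
  exact pd_comp (f := fun s => f s i) (differentiableAt_pi.mp hf i) hg

end Holomorphic

/-! ### The basic invariants have no common zero -/

/-- The degrees of the basic invariants. -/
def invDeg : Fin 4 → ℕ := ![30, 20, 12, 2]

theorem SPoly.eval_of_weighted {p : SPoly} {n : ℕ}
    (h : ∀ t ∈ p, 10 * t.2.1 + 2 * t.2.2.1 + 6 * t.2.2.2.1 + t.2.2.2.2 = n) (r : ℂ)
    {w w' : Fin 4 → ℂ} (h0 : w' 0 = r ^ 10 * w 0) (h1 : w' 1 = r ^ 2 * w 1)
    (h2 : w' 2 = r ^ 6 * w 2) (h3 : w' 3 = r * w 3) : p.eval w' = r ^ n * p.eval w := by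
  induction p with
  | nil => simp [SPoly.eval_nil]
  | cons t p ih =>
    rw [SPoly.eval_cons, SPoly.eval_cons, ih fun s hs => h s (List.mem_cons_of_mem t hs), mul_add,
      ← h t List.mem_cons_self]
    simp only [Term.eval, h0, h1, h2, h3, mul_pow, pow_add, pow_mul]
    ring

theorem invH4L_weighted : ∀ i, ∀ t ∈ invH4L i,
    10 * t.2.1 + 2 * t.2.2.1 + 6 * t.2.2.2.1 + t.2.2.2.2 = invDeg i := by
  decide +kernel

/-- Homogeneity is read off from the weights 10, 2, 6, 1 of the short polynomials in `h₁₀, h₂, h₆,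
x₁`, so nothing is expanded in `x`. -/
theorem invH4_smul (r : ℂ) (x : Fin 4 → ℂ) (i : Fin 4) :
    invH4 (r • x) i = r ^ invDeg i * invH4 x i := by
  apply mul_left_cancel₀ (invScale_ne_zero i)
  rw [← eval_invH4L, mul_left_comm, ← eval_invH4L]
  apply SPoly.eval_of_weighted (invH4L_weighted i) <;>
  simp only [hvec, Matrix.cons_val, Pi.smul_apply, smul_eq_mul] <;> ring

/-- `a` is a root of the cubic with these elementary symmetric functions, which is `X³`. -/
theorem eq_zero_of_esymm_eq_zero {a b c : ℂ} (h1 : a + b + c = 0) (h2 : a * b + a * c + b * c = 0)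
    (h3 : a * b * c = 0) : a = 0 :=
  eq_zero_of_pow_eq_zero (n := 3) (by linear_combination a ^ 2 * h1 - a * h2 + h3)

/-- The invariants of `H₃` have no common zero. -/
theorem eq_zero_of_hvec_eq_zero {x : Fin 4 → ℂ} (h : hvec x = 0) : x = 0 := by
  have h10 := congrFun h 0
  have h2 := congrFun h 1
  have h6 := congrFun h 2
  have h0 := congrFun h 3
  have hs := sqrt_five_sq
  simp only [hvec, Matrix.cons_val, Pi.zero_apply] at h10 h2 h6 h0
  generalize ((Real.sqrt 5 : ℝ) : ℂ) = s at *
  have key : ∀ a b c : ℂ, a + b + c = 0 →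
      s * ((a - b) * (a - c) * (b - c)) + (a + b + c) * (a * b + a * c + b * c) - 11 * (a * b * c)
        = 0 →
      95 * (a * b + a * c + b * c) * (a * b * c) - 32 * (a + b + c) ^ 2 * (a * b * c)
        - 5 * (a + b + c) * (a * b + a * c + b * c) ^ 2
        + 2 * (a + b + c) ^ 3 * (a * b + a * c + b * c)
        + 3 * s * ((a - b) * (a - c) * (b - c)) * (a * b + a * c + b * c) = 0 →
      a = 0 ∧ b = 0 ∧ c = 0 := by
    intro a b c h1 h6 h10
    obtain rfl : c = -a - b := by linear_combination h1
    set e2 := a * b + a * (-a - b) + b * (-a - b) with he2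
    set e3 := a * b * (-a - b) with he3
    -- When `e1 = 0`, the vanishing of `h₆` gives `√5 δ = 11 e3`, and then `h₁₀ = 95 e2 e3 + 33 e2
    -- e3 = 128 e2 e3`.
    have h23 : e2 * e3 = 0 := by
      linear_combination (1 / 128) * h10 - (3 / 128) * e2 * h6
    -- `δ²` is the discriminant of the cubic with roots `a, b, c`; compare it with `5 δ² = 121 e3²`.
    have h32 : 64 * e3 ^ 2 + 5 * e2 ^ 3 = 0 := by
      have h' : s * ((a - b) * (a - (-a - b)) * (b - (-a - b))) = 11 * e3 := by
        linear_combination h6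
      have hsq : 5 * ((a - b) * (a - (-a - b)) * (b - (-a - b))) ^ 2 = 121 * e3 ^ 2 := by
        rw [← hs, ← mul_pow, h', mul_pow]; norm_num
      have hdisc : ((a - b) * (a - (-a - b)) * (b - (-a - b))) ^ 2 = -4 * e2 ^ 3 - 27 * e3 ^ 2 := by
        rw [he2, he3]; ring
      linear_combination (1 / 4) * (5 * hdisc - hsq)
    have h2 : e2 = 0 := by
      rcases mul_eq_zero.mp h23 with h | h
      · exact h
      · rw [h] at h32
        exact eq_zero_of_pow_eq_zero (n := 3) (by linear_combination (1 / 5) * h32)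
    have h3 : e3 = 0 := by
      rw [h2] at h32
      exact eq_zero_of_pow_eq_zero (n := 2) (by linear_combination (1 / 64) * h32)
    have ha : a = 0 := eq_zero_of_esymm_eq_zero (by ring) (he2 ▸ h2) (he3 ▸ h3)
    have hb : b = 0 := by
      refine eq_zero_of_esymm_eq_zero (a := b) (b := a) (c := -a - b) (by ring) ?_ ?_
      · rw [← h2, he2]; ring
      · rw [← h3, he3]; ring
    exact ⟨ha, hb, by rw [ha, hb]; ring⟩
  obtain ⟨h1', h2', h3'⟩ := key (x 1 ^ 2) (x 2 ^ 2) (x 3 ^ 2) h2 h6 h10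
  funext i
  fin_cases i
  · exact h0
  · exact eq_zero_of_pow_eq_zero h1'
  · exact eq_zero_of_pow_eq_zero h2'
  · exact eq_zero_of_pow_eq_zero h3'

/-- The basic invariants of `H₄` have no common zero apart from the origin. -/
theorem eq_zero_of_invH4_eq_zero {x : Fin 4 → ℂ} (h : invH4 x = 0) : x = 0 := by
  have hE : ∀ z, invH4 z = 0 → ∀ i, (invH4L i).eval (hvec z) = 0 := fun z hz i => by
    rw [eval_invH4L, hz, Pi.zero_apply, mul_zero]
  have hx0 : x 0 = 0 := by
    by_contra hx
    -- By homogeneity `x₁ = 1` may be assumed. Then `y₄ = 0` and `y₃ = 0` determine `h₂` and `h₁₀`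
    -- in terms of `u = h₆`, and two polynomials in `u` remain.
    have hz : invH4 ((x 0)⁻¹ • x) = 0 := by
      funext i
      rw [invH4_smul, h, Pi.zero_apply, mul_zero]
    have h3 : hvec ((x 0)⁻¹ • x) 3 = 1 := by
      simp [hvec, hx]
    have e0 := hE _ hz 0
    have e1 := hE _ hz 1
    have e2 := hE _ hz 2
    have e3 := hE _ hz 3
    simp only [invH4L, invH4L0, invH4L1, invH4L2, invH4L3, Matrix.cons_val, SPoly.eval_cons,
      SPoly.eval_nil, Term.eval, h3, one_pow, mul_one, pow_zero, pow_one, add_zero] at e0 e1 e2 e3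
    generalize hvec ((x 0)⁻¹ • x) 0 = a at *
    generalize hvec ((x 0)⁻¹ • x) 1 = b at *
    generalize hvec ((x 0)⁻¹ • x) 2 = u at *
    obtain rfl : b = -1 := by push_cast at e3; linear_combination e3
    obtain rfl : a = -5 / 2 - 11 / 2 * u - 1 / 8 * u ^ 2 := by
      push_cast at e2; linear_combination (1 / 24) * e2
    have p0 : (-7764375 / 2) + (8418375 / 2) * u + (253263375 / 8) * u ^ 2
        + (1234425 / 4) * u ^ 3 + (6197175 / 32) * u ^ 4 + (25047 / 32) * u ^ 5
        + (-15 / 128) * u ^ 6 = 0 := by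
      rw [← e0]; push_cast; ring
    have p1 : (-28365 / 2) + (-38625) * u + (31665 / 4) * u ^ 2 + (1095 / 4) * u ^ 3
        + (3 / 32) * u ^ 4 = 0 := by
      rw [← e1]; push_cast; ring
    refine one_ne_zero (α := ℂ) ?_
    -- The polynomials from `y₁` and `y₂`, of degrees 6 and 4 in `u`, are coprime; these are Bézout
    -- cofactors.
    linear_combination ((-4446776755/7599824371187712) + (8438776879/75998243711877120) * u
      + (65600371/16888498602639360) * u ^ 2 + (2022161/1519964874237542400) * u ^ 3) * p0
      + ((3406803018637/37999121855938560) + (-2270918942965/5066549580791808) * u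
      + (-263061784423/75998243711877120) * u ^ 2 + (-139052604001/50665495807918080) * u ^ 3
      + (-33767736203/3039929748475084800) * u ^ 4
      + (2022161/1215971899390033920) * u ^ 5) * p1
  -- When `x₁ = 0`, the invariants reduce successively to `y₄ = h₂`, `y₃ = (3/2) h₆²` and `y₂ =
  -- h₁₀²`.
  refine eq_zero_of_hvec_eq_zero ?_
  have h3 : hvec x 3 = 0 := by simpa [hvec] using hx0
  have e1 := hE _ h 1
  have e2 := hE _ h 2
  have e3 := hE _ h 3
  have hb : hvec x 1 = 0 := by
    simpa [invH4L, invH4L3, SPoly.eval_cons, SPoly.eval_nil, Term.eval, h3] using e3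
  have hu : hvec x 2 = 0 := by
    simpa [invH4L, invH4L2, SPoly.eval_cons, SPoly.eval_nil, Term.eval, h3, hb] using e2
  have ha : hvec x 0 = 0 := by
    simpa [invH4L, invH4L1, SPoly.eval_cons, SPoly.eval_nil, Term.eval, h3, hb, hu] using e1
  funext i
  fin_cases i <;> assumption

/-! ### The image of the basic invariants -/

open Metric Filter Topology Set

theorem differentiable_invH4 : Differentiable ℂ invH4 := by
  intro x
  have hw : DifferentiableAt ℂ hvec x := differentiableAt_pi.mpr fun i => (hasPd_hvec x i 0).1
  have h : invH4 = fun z i => (invScale i : ℂ)⁻¹ * (invH4L i).eval (hvec z) := by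
    funext z i
    rw [eval_invH4L, inv_mul_cancel_left₀ (invScale_ne_zero i)]
  rw [h]
  exact differentiableAt_pi.mpr fun i =>
    ((SPoly.differentiable_eval (invH4L i) (hvec x)).comp x hw).const_mul _

theorem jac_invH4_mul_transpose (x : Fin 4 → ℂ) :
    jac invH4 x * (jac invH4 x)ᵀ = saitoForm (invH4 x) := by
  ext i j
  rw [← gram_invH4, Matrix.mul_apply]
  rfl

theorem det_jac_invH4_ne_zero {x : Fin 4 → ℂ} (h : (saitoForm (invH4 x)).det ≠ 0) :
    (jac invH4 x).det ≠ 0 := by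
  rw [← jac_invH4_mul_transpose, Matrix.det_mul] at h
  exact left_ne_zero_of_mul h

/-- `m` is the minimum of the norm on the unit sphere, positive since there is no common zero there.
All degrees are at least 1, so scaling gives at least linear growth; this is what properness needs.
-/
theorem exists_norm_invH4_ge : ∃ m > 0, ∀ x : Fin 4 → ℂ, 1 ≤ ‖x‖ → m * ‖x‖ ≤ ‖invH4 x‖ := by
  obtain ⟨u, hu, hmin⟩ := (isCompact_sphere (0 : Fin 4 → ℂ) 1).exists_isMinOn
    (NormedSpace.sphere_nonempty.mpr zero_le_one)
    differentiable_invH4.continuous.norm.continuousOn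
  have hu1 : ‖u‖ = 1 := by simpa using hu
  refine ⟨‖invH4 u‖, norm_pos_iff.mpr fun h => ?_, fun x hx => ?_⟩
  · have hu0 := eq_zero_of_invH4_eq_zero h
    rw [hu0, norm_zero] at hu1
    exact zero_ne_one hu1
  · have hx0 : (‖x‖ : ℂ) ≠ 0 := by
      rw [Complex.ofReal_ne_zero]; positivity
    set v : Fin 4 → ℂ := (‖x‖ : ℂ)⁻¹ • x with hv
    have hxv : x = (‖x‖ : ℂ) • v := by rw [hv, smul_inv_smul₀ hx0]
    have hv1 : v ∈ sphere (0 : Fin 4 → ℂ) 1 := by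
      rw [mem_sphere_zero_iff_norm, hv, norm_smul, norm_inv, Complex.norm_real, norm_norm,
        inv_mul_cancel₀ (by positivity)]
    have hle : ‖invH4 u‖ ≤ ‖invH4 v‖ := isMinOn_iff.mp hmin v hv1
    have hcomp : ‖invH4 v‖ ≤ ‖x‖⁻¹ * ‖invH4 x‖ := by
      rw [pi_norm_le_iff_of_nonneg (mul_nonneg (inv_nonneg.mpr (norm_nonneg _)) (norm_nonneg _))]
      intro i
      rw [hv, invH4_smul, norm_mul, norm_pow, norm_inv, Complex.norm_real, norm_norm]
      refine mul_le_mul ?_ (norm_le_pi_norm _ i) (norm_nonneg _)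
        (inv_nonneg.mpr (norm_nonneg _))
      refine pow_le_of_le_one (inv_nonneg.mpr (norm_nonneg _)) (inv_le_one_of_one_le₀ hx) ?_
      fin_cases i <;> simp [invDeg]
    calc ‖invH4 u‖ * ‖x‖ ≤ ‖x‖⁻¹ * ‖invH4 x‖ * ‖x‖ := by gcongr; exact hle.trans hcomp
      _ = ‖invH4 x‖ := by field_simp

theorem isClosed_range_invH4 : IsClosed (range invH4) := by
  have h : IsProperMap invH4 := by
    rw [isProperMap_iff_tendsto_cocompact]
    refine ⟨differentiable_invH4.continuous, ?_⟩
    rw [← cobounded_eq_cocompact, ← tendsto_norm_atTop_iff_cobounded]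
    obtain ⟨m, hm, hle⟩ := exists_norm_invH4_ge
    have h1 : Tendsto (fun x : Fin 4 → ℂ => m * ‖x‖) (Bornology.cobounded _) atTop :=
      tendsto_norm_cobounded_atTop.const_mul_atTop hm
    refine tendsto_atTop_mono' _ ?_ h1
    filter_upwards [tendsto_norm_cobounded_atTop.eventually_ge_atTop 1] with x hx using hle x hx
  exact h.isClosed_range

theorem range_invH4_mem_nhds {x : Fin 4 → ℂ} (h : (saitoForm (invH4 x)).det ≠ 0) :
    range invH4 ∈ 𝓝 (invH4 x) := by
  obtain ⟨e, he⟩ := exists_hasStrictFDerivAt isOpen_univ differentiable_invH4.differentiableOn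
    (mem_univ x) (det_jac_invH4_ne_zero h)
  rw [← he.map_nhds_eq_of_equiv]
  exact range_mem_map

theorem differentiable_det_saitoForm :
    Differentiable ℂ fun y : Fin 4 → ℂ => (saitoForm y).det := by
  have h : ∀ i j, Differentiable ℂ fun y : Fin 4 → ℂ => saitoForm y i j := by
    intro i j
    fin_cases i <;> fin_cases j <;>
    simp only [saitoForm, Fin.zero_eta, Fin.mk_one, Fin.reduceFinMk, Matrix.of_apply,
      Matrix.cons_val] <;> fun_prop
  simp only [Matrix.det_apply']
  fun_prop

/-- The point has `x₂ = x₃`, so `δ = 0` and the values of the invariants do not involve `√5`. -/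
theorem exists_det_saitoForm_invH4_ne_zero : ∃ x, (saitoForm (invH4 x)).det ≠ 0 := by
  refine ⟨![3, 1, 1, 2], ?_⟩
  have h : invH4 ![3, 1, 1, 2] = ![384128614836000, 4339926180, -900570, 15] := by
    funext i
    fin_cases i <;> simp [invH4] <;> norm_num
  rw [h]
  simp [saitoForm, Matrix.det_succ_row_zero, Fin.sum_univ_succ, Fin.succAbove]
  norm_num

/-- The zeros of a nonzero entire function do not disconnect the plane. -/
theorem isPreconnected_ne_zero {f : ℂ → ℂ} (hf : Differentiable ℂ f) {z : ℂ} (hz : f z ≠ 0) :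
    IsPreconnected {s | f s ≠ 0} := by
  have hcod : f ⁻¹' {0}ᶜ ∈ codiscreteWithin univ :=
    (hf.differentiableOn.analyticOnNhd isOpen_univ).preimage_zero_mem_codiscreteWithin
      hz (mem_univ z) isConnected_univ
  -- A compact disc contains finitely many zeros. The complement of a countable set is connected in
  -- real dimension 2.
  have hcount : {s | f s = 0}.Countable := by
    have : {s | f s = 0} = ⋃ n : ℕ, closedBall (0 : ℂ) n \ f ⁻¹' {0}ᶜ := by
      ext s
      obtain ⟨n, hn⟩ := exists_nat_ge ‖s‖
      simp only [mem_ofPred_eq, mem_iUnion, Set.mem_sdiff, mem_closedBall_zero_iff, mem_preimage,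
        mem_compl_iff, mem_singleton_iff, not_not]
      exact ⟨fun h => ⟨n, hn, h⟩, fun ⟨_, _, h⟩ => h⟩
    rw [this]
    refine countable_iUnion fun n => Finite.countable ?_
    exact (isCompact_closedBall _ _).finite_sdiff_of_mem_codiscreteWithin
      (codiscreteWithin_mono (subset_univ _) hcod)
  exact (hcount.isConnected_compl_of_one_lt_rank
    (by rw [Complex.rank_real_complex]; norm_num)).isPreconnected

/-- Every point where the Saito form is nondegenerate is a value of the basic invariants. -/
theorem exists_invH4_eq {y : Fin 4 → ℂ} (hy : (saitoForm y).det ≠ 0) : ∃ x, invH4 x = y := by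
  obtain ⟨x₀, hx₀⟩ := exists_det_saitoForm_invH4_ne_zero
  set L : ℂ → (Fin 4 → ℂ) := fun s => invH4 x₀ + s • (y - invH4 x₀) with hL
  have hLd : Differentiable ℂ L := by fun_prop
  have hL0 : L 0 = invH4 x₀ := by simp [hL]
  have hL1 : L 1 = y := by simp [hL]
  -- On the line from a known regular value to `y`, the points off the discriminant form a connected
  -- set. Those in the image of the invariants form an open and closed part of it.
  have hpre := isPreconnected_ne_zero (f := fun s => (saitoForm (L s)).det)
    (differentiable_det_saitoForm.comp hLd) (z := 0) (by simpa only [hL0])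
  by_contra hcon
  obtain ⟨s, -, hs1, hs2⟩ := hpre (L ⁻¹' interior (range invH4)) (L ⁻¹' (range invH4)ᶜ)
    (isOpen_interior.preimage hLd.continuous)
    (isClosed_range_invH4.isOpen_compl.preimage hLd.continuous)
    (fun s hs => by
      by_cases h : L s ∈ range invH4
      · obtain ⟨x, hx⟩ := h
        left
        rw [mem_preimage, mem_interior_iff_mem_nhds, ← hx]
        refine range_invH4_mem_nhds ?_
        rw [hx]
        exact hs
      · exact Or.inr h)
    ⟨0, by simpa only [mem_ofPred_eq, hL0], by
      rw [mem_preimage, mem_interior_iff_mem_nhds, hL0]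
      exact range_invH4_mem_nhds hx₀⟩
    ⟨1, by simpa only [mem_ofPred_eq, hL1], fun ⟨x, hx⟩ => hcon ⟨x, hx.trans hL1⟩⟩
  exact hs2 (interior_subset hs1)

/-! ### Density of the regular points -/

/-- The complex line through `q` and `p` meets the ball in a convex set, where the identity theorem
in one variable applies. -/
theorem eqOn_zero_ball {f : (Fin 4 → ℂ) → ℂ} {t q : Fin 4 → ℂ} {r : ℝ}
    (hf : DifferentiableOn ℂ f (ball t r)) (hq : q ∈ ball t r) (h : f =ᶠ[𝓝 q] 0) :
    ∀ p ∈ ball t r, f p = 0 := by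
  intro p hp
  set L : ℂ → (Fin 4 → ℂ) := fun s => q + s • (p - q) with hL
  have hLd : Differentiable ℂ L := by fun_prop
  have hL0 : L 0 = q := by simp [hL]
  have hL1 : L 1 = p := by simp [hL]
  have hopen : IsOpen (L ⁻¹' ball t r) := isOpen_ball.preimage hLd.continuous
  have hconv : Convex ℝ (L ⁻¹' ball t r) := by
    intro a ha b hb u v hu hv huv
    have huv' : (u : ℂ) + v = 1 := by exact_mod_cast huv
    have : L (u • a + v • b) = u • L a + v • L b := by
      funext i
      simp only [hL, Pi.add_apply, Pi.smul_apply, Complex.real_smul, smul_eq_mul, Pi.sub_apply]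
      linear_combination -q i * huv'
    rw [mem_preimage, this]
    exact convex_ball t r ha hb hu hv huv
  have han : AnalyticOnNhd ℂ (fun s => f (L s)) (L ⁻¹' ball t r) :=
    (hf.comp hLd.differentiableOn fun s hs => hs).analyticOnNhd hopen
  have hz : (fun s => f (L s)) =ᶠ[𝓝 0] 0 := by
    have : Tendsto L (𝓝 0) (𝓝 q) := hL0 ▸ hLd.continuous.tendsto 0
    exact this.eventually h
  have := han.eqOn_zero_of_preconnected_of_eventuallyEq_zero hconv.isPreconnected
    (z₀ := 0) (by rwa [mem_preimage, hL0]) hz (x := 1) (by rwa [mem_preimage, hL1])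
  simpa only [hL1, Pi.zero_apply] using this

/-- The identity theorem for holomorphic functions of several variables. -/
theorem eqOn_zero_of_isPreconnected {f : (Fin 4 → ℂ) → ℂ} {V : Set (Fin 4 → ℂ)}
    {p : Fin 4 → ℂ} (hV : IsOpen V) (hc : IsPreconnected V) (hf : DifferentiableOn ℂ f V)
    (hp : p ∈ V) (h : f =ᶠ[𝓝 p] 0) : ∀ t ∈ V, f t = 0 := by
  have hsub : V ⊆ {t | f =ᶠ[𝓝 t] 0} := by
    refine hc.subset_of_closure_inter_subset isOpen_setOfPred_eventually_nhds ⟨p, hp, h⟩ ?_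
    rintro t ⟨htc, htV⟩
    obtain ⟨r, hr, hrV⟩ := Metric.isOpen_iff.mp hV t htV
    obtain ⟨q, hq, hqr⟩ := Metric.mem_closure_iff.mp htc r hr
    filter_upwards [ball_mem_nhds t hr] with s hs
    exact eqOn_zero_ball (hf.mono hrV) (by rwa [mem_ball, dist_comm]) hq s hs
  exact fun t ht => (hsub ht).self_of_nhds

theorem eqOn_of_isPreconnected {f g : (Fin 4 → ℂ) → (Fin 4 → ℂ)} {V : Set (Fin 4 → ℂ)}
    {p : Fin 4 → ℂ} (hV : IsOpen V) (hc : IsPreconnected V) (hf : DifferentiableOn ℂ f V)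
    (hg : DifferentiableOn ℂ g V) (hp : p ∈ V) (h : f =ᶠ[𝓝 p] g) : ∀ t ∈ V, f t = g t := by
  intro t ht
  funext i
  refine sub_eq_zero.mp (eqOn_zero_of_isPreconnected (f := fun s => f s i - g s i) hV hc
    (fun s hs => (differentiableWithinAt_pi.mp (hf s hs) i).fun_sub
      (differentiableWithinAt_pi.mp (hg s hs) i)) hp ?_ t ht)
  filter_upwards [h] with s hs
  rw [hs, sub_self, Pi.zero_apply]

/-! ### The Jacobi matrix of `ŷ` and the regular points. -/

variable {U : Set (Fin 4 → ℂ)} {ζ : (Fin 4 → ℂ) → ℂ} {t : Fin 4 → ℂ}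

theorem pairing_eq (u v : (Fin 4 → ℂ) → (Fin 4 → ℂ)) (i j : Fin 4) :
    pairing ζ (fun s => u s i) (fun s => v s j) t = (jac u t * interForm ζ t * (jac v t)ᵀ) i j := by
  simp only [pairing, Matrix.mul_apply, jac, Matrix.of_apply, Matrix.transpose_apply,
    Finset.sum_mul]
  rw [Finset.sum_comm]
  exact Finset.sum_congr rfl fun m _ => Finset.sum_congr rfl fun l _ => by ring

theorem IsBranch.jac_yPoly (hb : IsBranch U ζ) (ht : t ∈ U) :
    jac (fun s => yPoly s (ζ s)) t * interForm ζ t * (jac (fun s => yPoly s (ζ s)) t)ᵀ =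
      saitoForm (yPoly t (ζ t)) := by
  ext i j
  rw [← pairing_eq, hb.pairing_yPoly ht]

theorem IsBranch.mem_regularSet_iff (hb : IsBranch U ζ) (ht : t ∈ U) :
    t ∈ regularSet U ζ ↔ (saitoForm (yPoly t (ζ t))).det ≠ 0 := by
  have h : t ∈ regularSet U ζ ↔
      (interForm ζ t).det ≠ 0 ∧ (jac (fun s => yPoly s (ζ s)) t).det ≠ 0 := by
    rw [regularSet, mem_ofPred_eq, and_iff_right ht]
    rfl
  rw [h, ← hb.jac_yPoly ht, Matrix.det_mul, Matrix.det_mul, Matrix.det_transpose,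
    mul_ne_zero_iff, mul_ne_zero_iff]
  tauto

theorem IsBranch.differentiableOn_yPoly (hb : IsBranch U ζ) :
    DifferentiableOn ℂ (fun s => yPoly s (ζ s)) U := fun _ ht =>
  (differentiableAt_pi.mpr fun i => (hb.hasPd_yPoly ht i 0).1).differentiableWithinAt

/-- The determinant is `∂Z/∂t₂`. It cannot vanish, because its product with `∂(25 t₂)/∂Z` is 25; a
holomorphic branch never meets the ramification locus. -/
theorem IsBranch.det_jac_chart_ne_zero (hb : IsBranch U ζ) (ht : t ∈ U) :
    (jac (chart ζ) t).det ≠ 0 := by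
  have h : jac (chart ζ) t = !![1, 0, 0, 0; pd 0 ζ t, pd 1 ζ t, pd 2 ζ t, pd 3 ζ t;
      0, 0, 1, 0; 0, 0, 0, 1] := by
    have h0 : ∀ j, pd j (fun s => chart ζ s 0) t = if j = 0 then 1 else 0 := fun j => pd_coord j 0
    have h1 : ∀ j, pd j (fun s => chart ζ s 1) t = pd j ζ t := fun j => rfl
    have h2 : ∀ j, pd j (fun s => chart ζ s 2) t = if j = 2 then 1 else 0 := fun j => pd_coord j 2
    have h3 : ∀ j, pd j (fun s => chart ζ s 3) t = if j = 3 then 1 else 0 := fun j => pd_coord j 3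
    ext i j
    fin_cases i <;> simp only [jac, Matrix.of_apply, Fin.zero_eta, Fin.mk_one, Fin.reduceFinMk,
      h0, h1, h2, h3] <;> fin_cases j <;> simp
  have hdet : (jac (chart ζ) t).det = pd 1 ζ t := by
    rw [h]
    simp [Matrix.det_succ_row_zero, Fin.sum_univ_succ, Fin.succAbove]
  rw [hdet]
  intro h0
  have := hb.pd_zeta ht 1
  simp [h0] at this

/-- The invariants as functions of `(t₁, Z, t₃, t₄)`. -/
noncomputable def chartY (w : Fin 4 → ℂ) : Fin 4 → ℂ :=
  fun i => (invScale i : ℂ)⁻¹ * (invL i).eval w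

theorem IsBranch.chartY_chart (hb : IsBranch U ζ) (ht : t ∈ U) :
    chartY (chart ζ t) = yPoly t (ζ t) := by
  funext i
  rw [chartY, hb.eval_invL ht, inv_mul_cancel_left₀ (invScale_ne_zero i)]

theorem differentiable_chartY : Differentiable ℂ chartY := fun w =>
  differentiableAt_pi.mpr fun i => (SPoly.differentiable_eval (invL i) w).const_mul _

/-- Here only `y₃` is nonzero, so only the entries `S¹²` and `S³⁴` and their mirror images survive.
-/
theorem det_saitoForm_chartY_ne_zero : (saitoForm (chartY ![1, 0, 0, 0])).det ≠ 0 := by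
  have h : chartY ![1, 0, 0, 0] = ![0, 0, 56000, 0] := by
    funext i
    fin_cases i <;>
    simp [chartY, invL, invL0, invL1, invL2, invL3, SPoly.eval_cons, SPoly.eval_nil, Term.eval,
      invScale]
    norm_num
  rw [h]
  simp [saitoForm, Matrix.det_succ_row_zero, Fin.sum_univ_succ, Fin.succAbove]

/-- The regular points are dense. -/
theorem IsBranch.subset_closure_regularSet (hb : IsBranch U ζ) :
    U ⊆ closure (regularSet U ζ) := by
  intro t ht
  by_contra hcon
  have hev : ∀ᶠ s in 𝓝 t, (saitoForm (chartY (chart ζ s))).det = 0 := by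
    filter_upwards [hb.1.mem_nhds ht, isClosed_closure.isOpen_compl.mem_nhds hcon] with s hs hs'
    rw [hb.chartY_chart hs]
    by_contra h
    exact hs' (subset_closure ((hb.mem_regularSet_iff hs).mpr h))
  obtain ⟨e, he⟩ := exists_hasStrictFDerivAt hb.1
    (fun s hs => (hb.differentiableAt_chart hs).differentiableWithinAt) ht
    (hb.det_jac_chart_ne_zero ht)
  -- The chart is a local homeomorphism, so vanishing near `t` becomes vanishing of a polynomial in
  -- `w` on an open set.
  have hev' : (fun w => (saitoForm (chartY w)).det) =ᶠ[𝓝 (chart ζ t)] 0 := by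
    rw [← he.map_nhds_eq_of_equiv, EventuallyEq, eventually_map]
    exact hev
  exact det_saitoForm_chartY_ne_zero (eqOn_zero_of_isPreconnected isOpen_univ
    isPreconnected_univ (differentiable_det_saitoForm.comp differentiable_chartY).differentiableOn
    (mem_univ _) hev' _ (mem_univ _))

/-! ### Existence of flat coordinates -/

theorem jac_congr {f g : (Fin 4 → ℂ) → (Fin 4 → ℂ)} {V : Set (Fin 4 → ℂ)} (hV : IsOpen V)
    (h : ∀ s ∈ V, f s = g s) (ht : t ∈ V) : jac f t = jac g t := by
  ext i j
  exact pd_congr hV (fun s hs => congrFun (h s hs) i) ht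

/-- Raising the index 4 gives a lower index 1, the direction of the unit field, so `c^{l4}_k` is the
Kronecker delta. -/
theorem interForm_last (hb : IsBranch U ζ) (ht : t ∈ U) (l : Fin 4) :
    interForm ζ t l 3 = euler t l := by
  have h : ∀ k, cUp ζ l 3 k t = if k = l then 1 else 0 := by
    intro k
    have h1 : c ζ l.rev 0 k t = eta ζ t l.rev k := by
      rw [eta, Matrix.of_apply, hb.c_eq ht, hb.c_eq ht, potHessL_symm]
    rw [hb.cUp_eq ht, show (3 : Fin 4).rev = 0 from rfl, h1, hb.eta_eq ht, Matrix.of_apply]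
    simp only [Fin.rev_inj, eq_comm]
  simp only [interForm, Matrix.of_apply, h]
  simp

theorem jac_invH4_last (x : Fin 4 → ℂ) (a : Fin 4) : jac invH4 x 3 a = 2 * x a := by
  have h : (fun z => invH4 z 3) = fun z => z 0 ^ 2 + (z 1 ^ 2 + z 2 ^ 2 + z 3 ^ 2) := by
    funext z; simp [invH4]
  simp only [jac, Matrix.of_apply, h]
  have hsq : ∀ i, HasPd a (fun z => z i ^ 2) (2 * x i * if a = i then 1 else 0) x := fun i =>
    (HasPd.pow 2 ⟨differentiableAt_apply i x, pd_coord a i⟩).congr (by simp)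
  rw [((hsq 0).add (((hsq 1).add (hsq 2)).add (hsq 3))).2]
  fin_cases a <;> simp

theorem jac_yPoly_last (j : Fin 4) :
    jac (fun s => yPoly s (ζ s)) t 3 j = if j = 3 then 24 else 0 := by
  have h : (fun s => yPoly s (ζ s) 3) = fun s => 24 * s 3 := by
    funext z; simp [yPoly]
  simp only [jac, Matrix.of_apply, h]
  rw [(HasPd.const_mul 24 ⟨differentiableAt_apply 3 t, pd_coord j 3⟩).2]
  split_ifs <;> simp

/-- Functions with the values `yPoly` of the basic invariants are flat coordinates. -/
theorem IsBranch.isFlatCoord (hb : IsBranch U ζ) {V : Set (Fin 4 → ℂ)} (hVU : V ⊆ U)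
    (hV : IsOpen V) {x : (Fin 4 → ℂ) → (Fin 4 → ℂ)} (hx : DifferentiableOn ℂ x V)
    (hinj : InjOn (fun s => yPoly s (ζ s)) V) (hV0 : ∀ t ∈ V, (saitoForm (yPoly t (ζ t))).det ≠ 0)
    (h : ∀ t ∈ V, invH4 (x t) = yPoly t (ζ t)) : IsFlatCoord ζ V x := by
  have hjac : ∀ t ∈ V, jac (fun s => yPoly s (ζ s)) t = jac invH4 (x t) * jac x t := by
    intro t ht
    rw [← jac_comp (differentiable_invH4 _) (hx.differentiableAt (hV.mem_nhds ht))]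
    exact jac_congr hV (fun s hs => (h s hs).symm) ht
  have hA : ∀ t ∈ V, IsUnit (jac invH4 (x t)) := fun t ht =>
    (Matrix.isUnit_iff_isUnit_det _).mpr
      (det_jac_invH4_ne_zero ((h t ht).symm ▸ hV0 t ht)).isUnit
  refine ⟨hx, fun s hs t ht hst => hinj hs ht ?_, fun t ht i j => ?_, fun t ht i => ?_⟩
  · simp only [← h s hs, ← h t ht, hst]
  · rw [pairing_eq, ← Matrix.one_apply]
    have h1 := hb.jac_yPoly (hVU ht)
    rw [hjac t ht, ← h t ht, ← jac_invH4_mul_transpose, Matrix.transpose_mul] at h1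
    -- Both sides equal `S(y(x))`: one by (1) and the chain rule, the other by (0). Cancelling the
    -- invertible Jacobi matrix of `y` gives `g^{ij}(x) = δ^{ij}`.
    have h2 : jac invH4 (x t) * (jac x t * interForm ζ t * (jac x t)ᵀ) * (jac invH4 (x t))ᵀ =
        jac invH4 (x t) * 1 * (jac invH4 (x t))ᵀ := by
      rw [Matrix.mul_one, ← h1]
      simp only [Matrix.mul_assoc]
    have hAT : IsUnit (jac invH4 (x t))ᵀ := (Matrix.isUnit_transpose _).mpr (hA t ht)
    rw [(hA t ht).mul_left_cancel (hAT.mul_right_cancel h2)]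
  · have h1 : jac invH4 (x t) *ᵥ (24 • (jac x t *ᵥ euler t)) = jac invH4 (x t) *ᵥ (2 • x t) := by
      have hS := hb.jac_yPoly (hVU ht)
      rw [← h t ht, ← jac_invH4_mul_transpose] at hS
      funext j
      have hj := congrFun (congrFun hS j) 3
      rw [Matrix.mul_apply, Matrix.mul_apply] at hj
      simp only [Matrix.transpose_apply, jac_invH4_last, jac_yPoly_last] at hj
      simp only [Matrix.mul_apply, interForm_last hb (hVU ht), mul_ite, mul_zero,
        Finset.sum_ite_eq', Finset.mem_univ, if_true, hjac t ht] at hj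
      simp only [Matrix.mulVec_smul, Matrix.mulVec_mulVec]
      simp only [Pi.smul_apply, Matrix.mulVec, dotProduct, Matrix.mul_apply, nsmul_eq_mul]
      rw [Finset.sum_congr rfl fun k _ => mul_left_comm _ _ _, ← Finset.mul_sum] at hj
      push_cast
      rw [← hj, mul_comm]
    have h2 := congrFun (Matrix.mulVec_injective_of_isUnit (hA t ht) h1) i
    simp only [Pi.smul_apply, Matrix.mulVec, dotProduct, nsmul_eq_mul, jac, Matrix.of_apply] at h2
    push_cast at h2
    simp only [charge]
    rw [Finset.sum_congr rfl fun k _ => mul_comm _ _]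
    linear_combination (1 / 24) * h2

/-- There are flat coordinates with the values `yPoly` of the basic invariants near every regular
point. -/
theorem IsBranch.exists_isFlatCoord (hb : IsBranch U ζ) {p : Fin 4 → ℂ}
    (hp : p ∈ regularSet U ζ) : ∃ V ⊆ U, IsOpen V ∧ p ∈ V ∧ ∃ x : (Fin 4 → ℂ) → (Fin 4 → ℂ),
      IsFlatCoord ζ V x ∧ ∀ t ∈ V, invH4 (x t) = yPoly t (ζ t) := by
  have hpU : p ∈ U := hp.1
  have hS := (hb.mem_regularSet_iff hpU).mp hp
  set Y : (Fin 4 → ℂ) → (Fin 4 → ℂ) := fun s => yPoly s (ζ s) with hY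
  obtain ⟨x₀, hx₀⟩ := exists_invH4_eq hS
  obtain ⟨eY, heY⟩ := exists_hasStrictFDerivAt hb.1 hb.differentiableOn_yPoly hpU hp.2.2
  obtain ⟨e, he⟩ := exists_hasStrictFDerivAt isOpen_univ differentiable_invH4.differentiableOn
    (mem_univ x₀) (det_jac_invH4_ne_zero (by rwa [hx₀]))
  set Ψ := heY.toOpenPartialHomeomorph Y
  set Φ := he.toOpenPartialHomeomorph invH4
  -- Off the discriminant the local inverse `Φ.symm` is holomorphic at every point of `W`, not only
  -- at the centre.
  set W : Set (Fin 4 → ℂ) := Φ.target ∩ {y | (saitoForm y).det ≠ 0} with hW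
  have hWo : IsOpen W := Φ.open_target.inter
    (isOpen_ne_fun differentiable_det_saitoForm.continuous continuous_const)
  have hVo : IsOpen ((U ∩ Y ⁻¹' W) ∩ Ψ.source) :=
    (hb.differentiableOn_yPoly.continuousOn.isOpen_inter_preimage hb.1 hWo).inter Ψ.open_source
  have hVU : (U ∩ Y ⁻¹' W) ∩ Ψ.source ⊆ U := fun s hs => hs.1.1
  have hright : ∀ y ∈ Φ.target, invH4 (Φ.symm y) = y := fun y hy => Φ.right_inv hy
  have hsymm : ∀ y ∈ W, DifferentiableAt ℂ Φ.symm y := by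
    intro y hy
    obtain ⟨e', he'⟩ := exists_hasStrictFDerivAt isOpen_univ
      differentiable_invH4.differentiableOn (mem_univ (Φ.symm y))
      (det_jac_invH4_ne_zero (by rw [hright y hy.1]; exact hy.2))
    exact (Φ.hasFDerivAt_symm hy.1 he'.hasFDerivAt).differentiableAt
  refine ⟨_, hVU, hVo, ⟨⟨hpU, ?_, hS⟩, heY.mem_toOpenPartialHomeomorph_source⟩,
    fun s => Φ.symm (Y s), hb.isFlatCoord hVU hVo ?_ ?_ ?_ ?_, ?_⟩
  · have := he.image_mem_toOpenPartialHomeomorph_target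
    rwa [hx₀] at this
  · intro s hs
    exact ((hsymm _ hs.1.2).comp s (hb.differentiableOn_yPoly.differentiableAt
      (hb.1.mem_nhds hs.1.1))).differentiableWithinAt
  · exact Ψ.injOn.mono inter_subset_right
  · exact fun s hs => hs.1.2.2
  · exact fun s hs => hright _ hs.1.2.1
  · exact fun s hs => hright _ hs.1.2.1

/-! ### Uniqueness of flat coordinates -/

/-- The entrywise partial derivative of a matrix. -/
noncomputable def pdMat (k : Fin 4) (M : (Fin 4 → ℂ) → Matrix (Fin 4) (Fin 4) ℂ)
    (t : Fin 4 → ℂ) : Matrix (Fin 4) (Fin 4) ℂ :=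
  Matrix.of fun i j => pd k (fun s => M s i j) t

/-! ### The product rule for matrices of functions. -/

section PdMat

variable {M N : (Fin 4 → ℂ) → Matrix (Fin 4) (Fin 4) ℂ} {k : Fin 4}

theorem differentiableAt_mul_apply (hM : ∀ i j, DifferentiableAt ℂ (fun s => M s i j) t)
    (hN : ∀ i j, DifferentiableAt ℂ (fun s => N s i j) t) (i j : Fin 4) :
    DifferentiableAt ℂ (fun s => (M s * N s) i j) t := by
  simp only [Matrix.mul_apply]
  exact DifferentiableAt.fun_sum fun l _ => (hM i l).mul (hN l j)

theorem pdMat_mul (hM : ∀ i j, DifferentiableAt ℂ (fun s => M s i j) t)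
    (hN : ∀ i j, DifferentiableAt ℂ (fun s => N s i j) t) :
    pdMat k (fun s => M s * N s) t = pdMat k M t * N t + M t * pdMat k N t := by
  ext i j
  have h : ∀ l, HasPd k (fun s => M s i l * N s l j)
      (M t i l * pdMat k N t l j + N t l j * pdMat k M t i l) t := fun l =>
    HasPd.mul ⟨hM i l, rfl⟩ ⟨hN l j, rfl⟩
  simp only [pdMat, Matrix.of_apply, Matrix.add_apply, Matrix.mul_apply, Fin.sum_univ_four]
  rw [((((h 0).add (h 1)).add (h 2)).add (h 3)).2]
  simp only [pdMat, Matrix.of_apply]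
  ring

theorem pdMat_congr {V : Set (Fin 4 → ℂ)} (hV : IsOpen V) (h : ∀ s ∈ V, M s = N s) (ht : t ∈ V) :
    pdMat k M t = pdMat k N t := by
  ext i j
  exact pd_congr hV (fun s hs => congrFun (congrFun (h s hs) i) j) ht

end PdMat

variable {V : Set (Fin 4 → ℂ)} {x x' : (Fin 4 → ℂ) → (Fin 4 → ℂ)}

theorem differentiableAt_jac_apply (hV : IsOpen V) (hx : DifferentiableOn ℂ x V) (ht : t ∈ V)
    (i j : Fin 4) : DifferentiableAt ℂ (fun s => jac x s i j) t :=
  differentiableAt_pd hV (fun s hs => differentiableWithinAt_pi.mp (hx s hs) i) j ht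

/-- The Christoffel symbols vanish in flat coordinates: a change of coordinates with orthogonal
Jacobi matrices is affine. -/
theorem pdMat_eq_zero (hV : IsOpen V) (hx : DifferentiableOn ℂ x V)
    (hx' : DifferentiableOn ℂ x' V) {M : (Fin 4 → ℂ) → Matrix (Fin 4) (Fin 4) ℂ}
    (hM : ∀ s ∈ V, ∀ i j, DifferentiableAt ℂ (fun s => M s i j) s)
    (hMM : ∀ s ∈ V, (M s)ᵀ * M s = 1) (hMX : ∀ s ∈ V, jac x' s = M s * jac x s)
    (ht : t ∈ V) (hX : IsUnit (jac x t)) (k : Fin 4) : pdMat k M t = 0 := by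
  have hd := hM t ht
  have hdX := differentiableAt_jac_apply hV hx ht
  have hsymm : ∀ (u : (Fin 4 → ℂ) → (Fin 4 → ℂ)), DifferentiableOn ℂ u V → ∀ b k l,
      pdMat k (jac u) t b l = pdMat l (jac u) t b k := fun u hu b k l =>
    pd_pd_comm hV (fun s hs => differentiableWithinAt_pi.mp (hu s hs) b) ht k l
  have h1 : ∀ k, pdMat k M t * jac x t = pdMat k (jac x') t - M t * pdMat k (jac x) t := fun k => by
    rw [pdMat_congr hV hMX ht, pdMat_mul hd hdX, add_sub_cancel_right]
  have h2 : ∀ k, (pdMat k M t)ᵀ * M t + (M t)ᵀ * pdMat k M t = 0 := fun k => by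
    have hT : pdMat k (fun s => (M s)ᵀ) t = (pdMat k M t)ᵀ := rfl
    have hmul := pdMat_mul (k := k) (M := fun s => (M s)ᵀ) (N := M) (fun i j => hd j i) hd
    rw [← hT, ← hmul, pdMat_congr hV hMM ht]
    ext i j
    exact (HasPd.const _).2
  -- `R k m l` is symmetric in `k, l`, because `∂_k M · jac x` involves only second derivatives of
  -- `x` and `x'`. It is skew in `m, l`, because `Mᵀ ∂_k M` is skew for orthogonal `M`. Alternating
  -- the two symmetries gives `R = -R`.
  set R : Fin 4 → Matrix (Fin 4) (Fin 4) ℂ := fun k =>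
    (jac x t)ᵀ * (M t)ᵀ * (pdMat k M t * jac x t) with hR
  have hR1 : ∀ k m l, R k m l = R l m k := by
    intro k m l
    simp only [hR]
    rw [Matrix.mul_apply, Matrix.mul_apply]
    refine Finset.sum_congr rfl fun b _ => ?_
    rw [h1, h1, Matrix.sub_apply, Matrix.sub_apply, Matrix.mul_apply (M := M t),
      Matrix.mul_apply (M := M t), hsymm x' hx' b k l]
    simp only [hsymm x hx _ k l]
  have hR2 : ∀ k m l, R k m l = -R k l m := by
    intro k m l
    have h : R k + (R k)ᵀ = 0 := by
      simp only [hR, Matrix.transpose_mul, Matrix.transpose_transpose]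
      calc _ = (jac x t)ᵀ * ((pdMat k M t)ᵀ * M t + (M t)ᵀ * pdMat k M t) * jac x t := by
            simp only [Matrix.mul_add, Matrix.add_mul, Matrix.mul_assoc]
            rw [add_comm]
        _ = 0 := by rw [h2, Matrix.mul_zero, Matrix.zero_mul]
    exact eq_neg_of_add_eq_zero_left (congrFun (congrFun h m) l)
  have hR0 : R k = 0 := by
    ext m l
    have : R k m l = -R k m l := by
      calc R k m l = R l m k := hR1 _ _ _
        _ = -R l k m := hR2 _ _ _
        _ = -R m k l := by rw [hR1]
        _ = R m l k := by rw [hR2 m k l, neg_neg]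
        _ = R k l m := hR1 _ _ _
        _ = -R k m l := hR2 _ _ _
    exact self_eq_neg.mp this
  have hU : IsUnit ((jac x t)ᵀ * (M t)ᵀ) :=
    ((Matrix.isUnit_transpose _).mpr hX).mul (IsUnit.of_mul_eq_one _ (hMM t ht))
  refine hX.mul_right_cancel (hU.mul_left_cancel ?_)
  rw [Matrix.zero_mul, Matrix.mul_zero]
  exact hR0

theorem IsFlatCoord.jac_mul (h : IsFlatCoord ζ V x) (ht : t ∈ V) :
    jac x t * interForm ζ t * (jac x t)ᵀ = 1 := by
  ext i j
  rw [← pairing_eq, h.2.2.1 t ht, Matrix.one_apply]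

theorem IsFlatCoord.mono {W : Set (Fin 4 → ℂ)} (h : IsFlatCoord ζ V x) (hW : W ⊆ V) :
    IsFlatCoord ζ W x :=
  ⟨h.1.mono hW, h.2.1.mono hW, fun t ht => h.2.2.1 t (hW ht), fun t ht => h.2.2.2 t (hW ht)⟩

/-- With `(1 - d)/2 = 1/12`, the coordinates are recovered from their Jacobi matrix, so no
integration constant is left in a change of flat coordinates. -/
theorem IsFlatCoord.euler_eq (h : IsFlatCoord ζ V x) (ht : t ∈ V) :
    x t = (12 : ℂ) • (jac x t *ᵥ euler t) := by
  funext i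
  have := h.2.2.2 t ht i
  simp only [Pi.smul_apply, Matrix.mulVec, dotProduct, jac, Matrix.of_apply, smul_eq_mul]
  rw [Finset.sum_congr rfl fun k _ => mul_comm _ _, this, charge]
  ring

theorem IsBranch.differentiableAt_interForm (hb : IsBranch U ζ) (ht : t ∈ U) (i j : Fin 4) :
    DifferentiableAt ℂ (fun s => interForm ζ s i j) t := by
  have h := (hb.pd_eval_chart ht ((interL i j).toSPoly) 0).1.const_mul (12612600000⁻¹ : ℂ)
  refine h.congr_of_eventuallyEq ?_
  filter_upwards [hb.1.mem_nhds ht] with s hs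
  rw [hb.interForm_eq hs, PExpr.eval_toSPoly]

/-- Two systems of flat coordinates on a ball differ by an orthogonal transformation. -/
theorem IsBranch.exists_orthogonal (hb : IsBranch U ζ) {p : Fin 4 → ℂ} {r : ℝ} (hr : 0 < r)
    (hU : ball p r ⊆ U) (hx : IsFlatCoord ζ (ball p r) x) (hx' : IsFlatCoord ζ (ball p r) x') :
    ∃ A : Matrix (Fin 4) (Fin 4) ℂ, A * Aᵀ = 1 ∧ ∀ t ∈ ball p r, x' t = A *ᵥ x t := by
  -- `g · (jac x)ᵀ` is the inverse of `jac x`, so `M` is the Jacobi matrix of the change of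
  -- coordinates, written without an inverse to keep it visibly holomorphic.
  obtain ⟨M, hM⟩ : ∃ M : (Fin 4 → ℂ) → Matrix (Fin 4) (Fin 4) ℂ,
    M = fun s => jac x' s * (interForm ζ s * (jac x s)ᵀ) := ⟨_, rfl⟩
  have hinv : ∀ y, IsFlatCoord ζ (ball p r) y → ∀ s ∈ ball p r,
      interForm ζ s * (jac y s)ᵀ * jac y s = 1 := fun y hy s hs => by
    have := hy.jac_mul hs
    rw [Matrix.mul_assoc] at this
    exact mul_eq_one_comm.mp this
  have hMX : ∀ s ∈ ball p r, jac x' s = M s * jac x s := fun s hs => by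
    rw [hM, Matrix.mul_assoc, hinv x hx s hs, Matrix.mul_one]
  have hXu : ∀ s ∈ ball p r, IsUnit (jac x s) := fun s hs =>
    IsUnit.of_mul_eq_one_right _ (hinv x hx s hs)
  have hMM : ∀ s ∈ ball p r, (M s)ᵀ * M s = 1 := by
    intro s hs
    have h1 := hinv x hx s hs
    have h2 := hinv x' hx' s hs
    rw [Matrix.mul_assoc] at h1 h2
    -- Both are the inverse of `g`.
    have h3 : (jac x' s)ᵀ * jac x' s = (jac x s)ᵀ * jac x s :=
      left_inv_eq_right_inv (mul_eq_one_comm.mp h2) h1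
    have hXT : IsUnit (jac x s)ᵀ := (Matrix.isUnit_transpose _).mpr (hXu s hs)
    refine (hXu s hs).mul_right_cancel (hXT.mul_left_cancel ?_)
    rw [Matrix.one_mul, ← h3, hMX s hs, Matrix.transpose_mul]
    simp only [Matrix.mul_assoc]
  have hMd : ∀ s ∈ ball p r, ∀ i j, DifferentiableAt ℂ (fun s => M s i j) s := fun s hs => by
    rw [hM]
    exact differentiableAt_mul_apply (differentiableAt_jac_apply isOpen_ball hx'.1 hs)
      (differentiableAt_mul_apply (hb.differentiableAt_interForm (hU hs))
        fun i j => differentiableAt_jac_apply isOpen_ball hx.1 hs j i)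
  have hconst : ∀ s ∈ ball p r, M s = M p := by
    intro s hs
    ext i j
    refine isOpen_ball.is_const_of_fderiv_eq_zero (𝕜 := ℂ) (f := fun s => M s i j)
      (convex_ball p r).isPreconnected
      (fun q hq => (hMd q hq i j).differentiableWithinAt) (fun q hq => ?_) hs (mem_ball_self hr)
    have h0 : ∀ k, pd k (fun s => M s i j) q = 0 := fun k =>
      congrFun (congrFun (pdMat_eq_zero isOpen_ball hx.1 hx'.1 hMd hMM hMX hq (hXu q hq) k) i) j
    ext1 v
    simp [fderiv_eq_sum_pd, h0]
  refine ⟨M p, mul_eq_one_comm.mp (hMM p (mem_ball_self hr)), fun s hs => ?_⟩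
  rw [hx.euler_eq hs, hx'.euler_eq hs, hMX s hs, hconst s hs, Matrix.mulVec_smul,
    Matrix.mulVec_mulVec]

/-- All flat coordinates have the values `yPoly` of the basic invariants, up to an orthogonal
transformation. -/
theorem IsBranch.exists_orthogonal_invH4_eq (hb : IsBranch U ζ) (hVU : V ⊆ U) (hV : IsOpen V)
    (hc : IsPreconnected V) (hx : IsFlatCoord ζ V x) :
    ∃ A : Matrix (Fin 4) (Fin 4) ℂ, A * Aᵀ = 1 ∧
      ∀ t ∈ V, invH4 (A *ᵥ x t) = yPoly t (ζ t) := by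
  rcases V.eq_empty_or_nonempty with rfl | ⟨q, hq⟩
  · exact ⟨1, by simp, by simp⟩
  -- One regular point in `V` suffices: there `x` is compared with flat coordinates that satisfy the
  -- relations, and the identity theorem extends the result to all of `V`.
  obtain ⟨p, hpV, hp⟩ := mem_closure_iff.mp (hb.subset_closure_regularSet (hVU hq)) V hV hq
  obtain ⟨W, hWU, hWo, hpW, x', hx', hinv⟩ := hb.exists_isFlatCoord hp
  obtain ⟨r, hr, hrVW⟩ := Metric.isOpen_iff.mp (hV.inter hWo) p ⟨hpV, hpW⟩
  obtain ⟨A, hA, hAx⟩ := hb.exists_orthogonal hr (fun s hs => hWU (hrVW hs).2)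
    (hx.mono fun s hs => (hrVW hs).1) (hx'.mono fun s hs => (hrVW hs).2)
  refine ⟨A, hA, ?_⟩
  have hlin : DifferentiableOn ℂ (fun s => A *ᵥ x s) V :=
    (Matrix.toLin' A).toContinuousLinearMap.differentiable.comp_differentiableOn hx.1
  have hcomp : DifferentiableOn ℂ (fun s => invH4 (A *ᵥ x s)) V := by
    have h := differentiable_invH4
    generalize invH4 = f at h ⊢
    exact h.comp_differentiableOn hlin
  have hnear : (fun s => invH4 (A *ᵥ x s)) =ᶠ[𝓝 p] fun s => yPoly s (ζ s) := by
    filter_upwards [ball_mem_nhds p hr] with s hs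
    rw [← hAx s hs, hinv s (hrVW hs).2]
  exact eqOn_of_isPreconnected (f := fun s => invH4 (A *ᵥ x s)) (g := fun s => yPoly s (ζ s))
    hV hc hcomp (hb.differentiableOn_yPoly.mono hVU) hpV hnear

end AlgFrob

theorem mainTheorem7 :
    -- the Saito form is the matrix of the products of the gradients of the basic invariants
    (∀ (x : Fin 4 → ℂ) (i j : Fin 4),
      ∑ a, AlgFrob.pd a (fun z => AlgFrob.invH4 z i) x * AlgFrob.pd a (fun z => AlgFrob.invH4 z j) x
        = AlgFrob.saitoForm (AlgFrob.invH4 x) i j) ∧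
    ∀ (U : Set (Fin 4 → ℂ)) (ζ : (Fin 4 → ℂ) → ℂ), AlgFrob.IsBranch U ζ →
      -- the intersection form transforms into the Saito form
      (∀ t ∈ U, ∀ i j : Fin 4,
        AlgFrob.pairing ζ (fun s => AlgFrob.yPoly s (ζ s) i) (fun s => AlgFrob.yPoly s (ζ s) j) t
          = AlgFrob.saitoForm (AlgFrob.yPoly t (ζ t)) i j) ∧
      -- the regular points are dense
      U ⊆ closure (AlgFrob.regularSet U ζ) ∧
      -- near each of them there are flat coordinates of the intersection form with the relations
      (∀ p ∈ AlgFrob.regularSet U ζ, ∃ V ⊆ U, IsOpen V ∧ p ∈ V ∧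
        ∃ x : (Fin 4 → ℂ) → (Fin 4 → ℂ), AlgFrob.IsFlatCoord ζ V x ∧
          ∀ t ∈ V, AlgFrob.invH4 (x t) = AlgFrob.yPoly t (ζ t)) ∧
      -- all flat coordinates satisfy the relations after an orthogonal change of coordinates
      (∀ V ⊆ U, IsOpen V → IsPreconnected V →
        ∀ x : (Fin 4 → ℂ) → (Fin 4 → ℂ), AlgFrob.IsFlatCoord ζ V x →
          ∃ A : Matrix (Fin 4) (Fin 4) ℂ, A * Aᵀ = 1 ∧
            ∀ t ∈ V, AlgFrob.invH4 (A *ᵥ x t) = AlgFrob.yPoly t (ζ t)) := by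
  refine ⟨AlgFrob.gram_invH4, fun U ζ hb => ⟨fun t ht => hb.pairing_yPoly ht,
    hb.subset_closure_regularSet, fun p hp => hb.exists_isFlatCoord hp,
    fun V hVU hV hc x hx => hb.exists_orthogonal_invH4_eq hVU hV hc hx⟩⟩
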